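/- All input numbers are rational; a rational is represented by the numerator and denominator, in binary, of its irreducible fraction. Write $\mathrm{trunc}(t)=\max\{0,\min\{t,1\}\}$. **QUADRATIC-KKT.** Given a polynomial $p$ of degree at most $2$ in $N$ variables with rational coefficients, written down as a sum of monomials, find a KKT point of $\min p(x)$ subject to $x\in[0,1]^N$, i.e. $x\in[0,1]^N$ such that for all $i$: if $x_i>0$ then $\frac{\partial p}{\partial x_i}(x)\le 0$, and if $x_i<1$ then $\frac{\partial p}{\partial x_i}(x)\ge 0$. **2D-LINEAR-KKT.** A circuit $\mathcal C$ of truncated linear gates with two inputs and one output has variables $x_1,\dots,x_n$ ($n\ge 2$), where $x_1,x_2$ are the inputs, $x_n$ is the output, and each $x_i$ with $3\le i\le n$ is computed by a gate $x_i=\mathrm{trunc}(a_i x_{\ell(i)}+b_i x_{r(i)}+c_i)$ with $\ell(i),r(i)<i$ and $a_i,b_i,c_i\in\mathbb Q$. For $\pi\in\mathbb R^{n-2}$ let $f^\pi:\mathbb R^2\to\mathbb R$ be the function computed when $\pi_i$ is added inside the truncation of gate $i$, for every $i$. For $\delta'>0$ put $$\widetilde\partial_{\delta'}\mathcal C(y)=\mathrm{conv}\{\nabla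 f^\pi(y):\ \pi\in[-\delta',\delta']^{n-2},\ f^\pi\text{ differentiable at }y\}.$$ Given rational $\varepsilon',\delta'>0$ and $\mathcal C$, find $y\in[0,1]^2$ for which some $u\in\widetilde\partial_{\delta'}\mathcal C(y)$ satisfies, for $i=1,2$: if $y_i>0$ then $u_i\le\varepsilon'$, and if $y_i<1$ then $u_i\ge-\varepsilon'$. **Construction.** Write gate $i$ as $x_i=\mathrm{trunc}(\sum_{j<i}a_{ij}x_j+c_i)$, where $a_{ij}$ is the total coefficient of $x_j$ in it. Let $K\ge 1$ be rational with $K\ge\sum_{j<i}|a_{ij}|+|c_i|$ for all $3\le i\le n$, and let $\delta=\min\{\delta'/(8K^2),\,1/(32K^2)\}$. In the $3n-4$ variables $y_1,\dots,y_n,z_3^+,z_3^-,\dots,z_n^+,z_n^-$ put $$q_i=\Big(y_i+Kz_i^+-Kz_i^--\sum_{j<i}a_{ij}y_j-c_i\Big)^2+2K^2z_i^+z_i^-+2Kz_i^+(1-y_i)+2Kz_i^-y_i,$$ $$p=\delta^{n+1}y_n+\sum_{i=3}^n\delta^i q_i .$$ **Proposition.** (1) For every instance $(\varepsilon',\delta',\mathcal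 C)$ of 2D-LINEAR-KKT, every $K$ as above, and every (real) KKT point $(y,z)$ of $\min p$ over $[0,1]^{3n-4}$, the point $(y_1,y_2)$ is a solution of the instance. (2) There is a polynomial-time reduction from 2D-LINEAR-KKT to QUADRATIC-KKT (as search problems with rational solutions) of this form: for a suitable choice of an admissible $K$ as a function of $\mathcal C$, the map sending $(\varepsilon',\delta',\mathcal C)$ to $p$, written down as a sum of monomials, is computable in polynomial time; and the map that reads off the first two coordinates is computable in polynomial time and sends every rational KKT point of $p$ to a solution of $(\varepsilon',\delta',\mathcal C)$. -/

import Mathlib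

namespace QPKKT

open Computability

/-! ### Linear arithmetic circuits with two inputs, one output and truncated linear gates -/

/-- Projection of the real line to the interval `[0,1]`. -/
noncomputable def trunc (t : ℝ) : ℝ := max 0 (min t 1)

/-- A truncated linear gate `trunc (a * x_l + b * x_r + c)` reading the variables `l`, `r`
among the first `k` variables of a circuit. -/
structure Gate (k : ℕ) where
  a : ℚ
  b : ℚ
  c : ℚ
  l : Fin k
  r : Fin k

/-- A circuit with two inputs and `m` truncated linear gates, listed in topological order.
Its `m + 2` variables are numbered from `0`: the variables `0` and `1` are the inputs, variable
`k + 2` is computed by gate `k` from earlier variables, and the last variable is the output. -/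
structure Circuit where
  m : ℕ
  gate : (k : Fin m) → Gate (k + 2)

namespace Circuit

/-- The variable computed by gate `k`. -/
def gateVar (C : Circuit) (k : Fin C.m) : Fin (C.m + 2) := ⟨k + 2, by omega⟩

/-- A variable available to gate `k`, as a variable of the circuit. -/
def earlier (C : Circuit) (k : Fin C.m) (j : Fin (k + 2)) : Fin (C.m + 2) := ⟨j, by omega⟩

/-- The value of variable `i` on input `x`, in the circuit whose gate `k` is perturbed to
`trunc (a * x_l + b * x_r + c + π k)`. -/
noncomputable def value (C : Circuit) (π : Fin C.m → ℝ) (x : Fin 2 → ℝ) (i : Fin (C.m + 2)) : ℝ :=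
  if h : (i : ℕ) < 2 then x ⟨i, h⟩
  else
    let k : Fin C.m := ⟨i - 2, by omega⟩
    trunc ((C.gate k).a * C.value π x (C.earlier k (C.gate k).l)
      + (C.gate k).b * C.value π x (C.earlier k (C.gate k).r) + (C.gate k).c + π k)
termination_by (i : ℕ)
decreasing_by
  · have := (C.gate ⟨i - 2, by omega⟩).l.isLt
    simp only [earlier] at *
    omega
  · have := (C.gate ⟨i - 2, by omega⟩).r.isLt
    simp only [earlier] at *
    omega

/-- The function `f^π : ℝ² → ℝ` represented by the perturbed circuit `C^π`. -/
noncomputable def perturbed (C : Circuit) (π : Fin C.m → ℝ) (x : Fin 2 → ℝ) : ℝ :=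
  C.value π x (Fin.last (C.m + 1))

/-- The `δ`-generalized circuit gradient of `C` at `y`: the convex hull of the gradients at `y`
of all `f^π` with `π ∈ [-δ,δ]^m` that are differentiable at `y`. -/
def generalizedGradient (C : Circuit) (δ : ℝ) (y : Fin 2 → ℝ) : Set (Fin 2 → ℝ) :=
  convexHull ℝ {u | ∃ π : Fin C.m → ℝ, (∀ k, π k ∈ Set.Icc (-δ) δ) ∧
    DifferentiableAt ℝ (C.perturbed π) y ∧
    u = fun i => fderiv ℝ (C.perturbed π) y (Pi.single i 1)}

/-- The coefficient `a_{kj}` of variable `j` in gate `k`. If both inputs of the gate are the same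
variable, its two coefficients add up. -/
def coeff (C : Circuit) (k : Fin C.m) (j : Fin (k + 2)) : ℚ :=
  (if j = (C.gate k).l then (C.gate k).a else 0) + (if j = (C.gate k).r then (C.gate k).b else 0)

/-- `K ≥ 1` bounds `∑ j, |a_{kj}| + |c_k|` for all gates `k`. -/
def IsGateBound (C : Circuit) (K : ℚ) : Prop :=
  1 ≤ K ∧ ∀ k : Fin C.m, ∑ j, |C.coeff k j| + |(C.gate k).c| ≤ K

end Circuit

/-! ### Quadratic polynomials and their KKT points -/

/-- `x` is a KKT point of `min p(x)` subject to `0 ≤ x_i ≤ 1` for all `i`. -/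
def IsKKTPoint {N : ℕ} (p : MvPolynomial (Fin N) ℚ) (x : Fin N → ℝ) : Prop :=
  (∀ i, x i ∈ Set.Icc (0 : ℝ) 1) ∧
  ∀ i, (0 < x i → MvPolynomial.aeval x (MvPolynomial.pderiv i p) ≤ 0) ∧
    (x i < 1 → 0 ≤ MvPolynomial.aeval x (MvPolynomial.pderiv i p))

/-- A monomial of degree at most two, with its coefficient, in `N` variables. -/
inductive QTerm (N : ℕ) where
  | const (q : ℚ)
  | linear (q : ℚ) (i : Fin N)
  | quadratic (q : ℚ) (i j : Fin N)

/-- The polynomial that a term stands for. -/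
noncomputable def QTerm.toPoly {N : ℕ} : QTerm N → MvPolynomial (Fin N) ℚ
  | .const q => MvPolynomial.C q
  | .linear q i => MvPolynomial.C q * MvPolynomial.X i
  | .quadratic q i j => MvPolynomial.C q * MvPolynomial.X i * MvPolynomial.X j

/-- A quadratic polynomial in `N` variables, written down as a sum of monomials. -/
structure Quadratic where
  N : ℕ
  terms : List (QTerm N)

/-- The polynomial that is written down. -/
noncomputable def Quadratic.toPoly (p : Quadratic) : MvPolynomial (Fin p.N) ℚ :=
  (p.terms.map QTerm.toPoly).sum

/-! ### Instances of 2D-LINEAR-KKT -/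

/-- An instance of 2D-LINEAR-KKT. -/
structure LinearInstance where
  ε : ℚ
  δ : ℚ
  circuit : Circuit
  ε_pos : 0 < ε
  δ_pos : 0 < δ

/-- `y ∈ [0,1]²` satisfies the `ε`-KKT conditions with respect to the `δ`-generalized circuit
gradient. -/
def LinearInstance.IsSolution (I : LinearInstance) (y : Fin 2 → ℝ) : Prop :=
  (∀ i, y i ∈ Set.Icc (0 : ℝ) 1) ∧
  ∃ u ∈ I.circuit.generalizedGradient I.δ y,
    ∀ i, (0 < y i → u i ≤ I.ε) ∧ (y i < 1 → -(I.ε : ℝ) ≤ u i)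

/-! ### The quadratic program of a circuit

With `n = m + 2` circuit variables, there are `3 * n - 4 = 3 * m + 2` variables, in the order
`y_1, …, y_n, z_3⁺, z_3⁻, …, z_n⁺, z_n⁻`. Gate `k` computes the `(k + 3)`-rd circuit variable when
these are counted from one, so that its weight is `δ ^ (k + 3)`. -/

namespace Circuit

open MvPolynomial

/-- The index of the variable `y_i`. -/
def yIdx (C : Circuit) (i : Fin (C.m + 2)) : Fin (3 * C.m + 2) := ⟨i, by omega⟩

/-- The index of the variable `z⁺` of gate `k`. -/
def zPosIdx (C : Circuit) (k : Fin C.m) : Fin (3 * C.m + 2) := ⟨C.m + 2 + 2 * k, by omega⟩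

/-- The index of the variable `z⁻` of gate `k`. -/
def zNegIdx (C : Circuit) (k : Fin C.m) : Fin (3 * C.m + 2) := ⟨C.m + 2 + 2 * k + 1, by omega⟩

/-- The polynomial `q` of gate `k`. -/
noncomputable def gatePoly (C : Circuit) (K : ℚ) (k : Fin C.m) :
    MvPolynomial (Fin (3 * C.m + 2)) ℚ :=
  let y := X (C.yIdx (C.gateVar k))
  let zp := X (C.zPosIdx k)
  let zn := X (C.zNegIdx k)
  (y + MvPolynomial.C K * zp - MvPolynomial.C K * zn
      - ∑ j, MvPolynomial.C (C.coeff k j) * X (C.yIdx (C.earlier k j))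
      - MvPolynomial.C (C.gate k).c) ^ 2
    + MvPolynomial.C (2 * K ^ 2) * zp * zn
    + MvPolynomial.C (2 * K) * zp * (1 - y)
    + MvPolynomial.C (2 * K) * zn * y

/-- The polynomial `δ ^ (n + 1) * y_n + ∑ i, δ ^ i * q_i`. -/
noncomputable def qpPoly (C : Circuit) (K δ : ℚ) : MvPolynomial (Fin (3 * C.m + 2)) ℚ :=
  MvPolynomial.C (δ ^ (C.m + 3)) * X (C.yIdx (Fin.last (C.m + 1)))
    + ∑ k : Fin C.m, MvPolynomial.C (δ ^ ((k : ℕ) + 3)) * C.gatePoly K k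

end Circuit

/-- The parameter `min {δ / 8K², 1 / 32K²}` of the quadratic program of an instance. -/
def LinearInstance.qpDelta (I : LinearInstance) (K : ℚ) : ℚ :=
  min (I.δ / (8 * K ^ 2)) (1 / (32 * K ^ 2))

/-- The objective of the quadratic program constructed from an instance and a gate bound `K`. -/
noncomputable def LinearInstance.qp (I : LinearInstance) (K : ℚ) :
    MvPolynomial (Fin (3 * I.circuit.m + 2)) ℚ :=
  I.circuit.qpPoly K (I.qpDelta K)

/-! ### Encodings over a finite alphabet -/

/-- Binary expansion, least significant bit first, followed by a comma. -/
def encNat (n : ℕ) : List Γ' := (encodeNat n).map Γ'.bit ++ [Γ'.comma]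

/-- Unary expansion, followed by a comma. -/
def encUnary (n : ℕ) : List Γ' := List.replicate n (Γ'.bit true) ++ [Γ'.comma]

/-- Sign bit (`true` for negative numbers), then the absolute value in binary. -/
def encInt (z : ℤ) : List Γ' := Γ'.bit (decide (z < 0)) :: encNat z.natAbs

/-- Numerator and denominator of the irreducible fraction, in binary. -/
def encRat (q : ℚ) : List Γ' := encInt q.num ++ encNat q.den

/-- A finite sequence of encoded objects: each is preceded by `bra`, and `ket` marks the end. -/
def encSeq : List (List Γ') → List Γ'
  | [] => [Γ'.ket]
  | w :: ws => Γ'.bra :: (w ++ encSeq ws)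

def encGate {k : ℕ} (g : Gate k) : List Γ' :=
  encRat g.a ++ (encRat g.b ++ (encRat g.c ++ (encNat g.l ++ encNat g.r)))

def encCircuit (C : Circuit) : List Γ' := encSeq (List.ofFn fun k => encGate (C.gate k))

def encLinearInstance (I : LinearInstance) : List Γ' :=
  encRat I.ε ++ (encRat I.δ ++ encCircuit I.circuit)

def encQTerm {N : ℕ} : QTerm N → List Γ'
  | .const q => encRat q ++ encSeq []
  | .linear q i => encRat q ++ encSeq [encNat i]
  | .quadratic q i j => encRat q ++ encSeq [encNat i, encNat j]

/-- The number of variables in unary (so that points have polynomial size), then the terms. -/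
def encQuadratic (p : Quadratic) : List Γ' := encUnary p.N ++ encSeq (p.terms.map encQTerm)

/-- A rational vector. -/
def encVector (v : List ℚ) : List Γ' := encSeq (v.map encRat)

/-! #### The encodings are injective -/

/-- No code word is a proper prefix of another one, and equal code words have equal sources. -/
def PrefixCode {α : Type} (e : α → List Γ') : Prop :=
  ∀ x y s t, e x ++ s = e y ++ t → x = y ∧ s = t

theorem PrefixCode.injective {α : Type} {e : α → List Γ'} (h : PrefixCode e) :
    Function.Injective e := fun x y hxy => (h x y [] [] (by simp [hxy])).1

theorem prefixCode_bits : ∀ (l l' : List Bool) (s t : List Γ'),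
    l.map Γ'.bit ++ Γ'.comma :: s = l'.map Γ'.bit ++ Γ'.comma :: t → l = l' ∧ s = t
  | [], [], s, t, h => by simpa using h
  | [], b :: l', s, t, h => by simp at h
  | b :: l, [], s, t, h => by simp at h
  | b :: l, b' :: l', s, t, h => by
    simp only [List.map_cons, List.cons_append, List.cons.injEq, Γ'.bit.injEq] at h
    obtain ⟨h1, h2⟩ := prefixCode_bits l l' s t h.2
    exact ⟨by rw [h.1, h1], h2⟩

theorem prefixCode_encNat : PrefixCode encNat := by
  intro x y s t h
  simp only [encNat, List.append_assoc, List.singleton_append] at h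
  obtain ⟨h1, h2⟩ := prefixCode_bits _ _ _ _ h
  exact ⟨encodingNatBool.encode_injective h1, h2⟩

theorem prefixCode_encUnary : PrefixCode encUnary := by
  intro x y s t h
  simp only [encUnary, List.append_assoc, List.singleton_append, ← List.map_replicate] at h
  obtain ⟨h1, h2⟩ := prefixCode_bits _ _ _ _ h
  exact ⟨by simpa using congrArg List.length h1, h2⟩

theorem prefixCode_encInt : PrefixCode encInt := by
  intro x y s t h
  simp only [encInt, List.cons_append, List.cons.injEq, Γ'.bit.injEq, decide_eq_decide] at h
  obtain ⟨h1, h2⟩ := prefixCode_encNat _ _ _ _ h.2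
  exact ⟨by omega, h2⟩

theorem prefixCode_encRat : PrefixCode encRat := by
  intro x y s t h
  simp only [encRat, List.append_assoc] at h
  obtain ⟨h1, h2⟩ := prefixCode_encInt _ _ _ _ h
  obtain ⟨h3, h4⟩ := prefixCode_encNat _ _ _ _ h2
  exact ⟨Rat.ext h1 h3, h4⟩

theorem prefixCode_encSeq {α : Type} {e : α → List Γ'} (he : PrefixCode e) :
    PrefixCode fun l : List α => encSeq (l.map e) := by
  intro l
  induction l with
  | nil => intro l' s t h; cases l' <;> simp_all [encSeq]
  | cons a l ih =>
    intro l' s t h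
    cases l' with
    | nil => simp [encSeq] at h
    | cons a' l' =>
      simp only [List.map_cons, encSeq, List.cons_append, List.append_assoc, List.cons.injEq,
        true_and] at h
      obtain ⟨h1, h2⟩ := he _ _ _ _ h
      obtain ⟨h3, h4⟩ := ih _ _ _ h2
      exact ⟨by rw [h1, h3], h4⟩

theorem prefixCode_encVector : PrefixCode encVector := prefixCode_encSeq prefixCode_encRat

/-- A gate with its input variables as plain numbers. -/
def Gate.raw {k : ℕ} (g : Gate k) : ℚ × ℚ × ℚ × ℕ × ℕ := (g.a, g.b, g.c, g.l, g.r)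

def encRaw (g : ℚ × ℚ × ℚ × ℕ × ℕ) : List Γ' :=
  encRat g.1 ++ (encRat g.2.1 ++ (encRat g.2.2.1 ++ (encNat g.2.2.2.1 ++ encNat g.2.2.2.2)))

theorem prefixCode_encRaw : PrefixCode encRaw := by
  rintro ⟨a, b, c, l, r⟩ ⟨a', b', c', l', r'⟩ s t h
  simp only [encRaw, List.append_assoc] at h
  obtain ⟨h1, h⟩ := prefixCode_encRat _ _ _ _ h
  obtain ⟨h2, h⟩ := prefixCode_encRat _ _ _ _ h
  obtain ⟨h3, h⟩ := prefixCode_encRat _ _ _ _ h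
  obtain ⟨h4, h⟩ := prefixCode_encNat _ _ _ _ h
  obtain ⟨h5, h⟩ := prefixCode_encNat _ _ _ _ h
  exact ⟨by rw [h1, h2, h3, h4, h5], h⟩

theorem prefixCode_encCircuit : PrefixCode encCircuit := by
  rintro ⟨m, g⟩ ⟨m', g'⟩ s t h
  have hm : ∀ C : Circuit,
      encCircuit C = encSeq ((List.ofFn fun k => (C.gate k).raw).map encRaw) := fun C => by
    rw [encCircuit, List.map_ofFn]; rfl
  simp only [hm] at h
  obtain ⟨h1, h2⟩ := prefixCode_encSeq prefixCode_encRaw _ _ _ _ h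
  refine ⟨?_, h2⟩
  obtain rfl : m = m' := by simpa using congrArg List.length h1
  have h3 := List.ofFn_injective h1
  congr 1
  funext k
  have h4 := congrFun h3 k
  rcases hk : g k with ⟨a, b, c, l, r⟩
  rcases hk' : g' k with ⟨a', b', c', l', r'⟩
  simp only [Gate.raw, hk, hk', Prod.mk.injEq] at h4
  obtain ⟨h5, h6, h7, h8, h9⟩ := h4
  rw [h5, h6, h7, Fin.ext h8, Fin.ext h9]

theorem prefixCode_encLinearInstance : PrefixCode encLinearInstance := by
  rintro ⟨ε, δ, C, _, _⟩ ⟨ε', δ', C', _, _⟩ s t h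
  simp only [encLinearInstance, List.append_assoc] at h
  obtain ⟨h1, h⟩ := prefixCode_encRat _ _ _ _ h
  obtain ⟨h2, h⟩ := prefixCode_encRat _ _ _ _ h
  obtain ⟨h3, h4⟩ := prefixCode_encCircuit _ _ _ _ h
  subst h1 h2 h3
  exact ⟨rfl, h4⟩

theorem prefixCode_encQTerm {N : ℕ} : PrefixCode (encQTerm (N := N)) := by
  have hq : ∀ x : QTerm N, ∃ q : ℚ, ∃ l : List (Fin N),
      encQTerm x = encRat q ++ encSeq (l.map fun i : Fin N => encNat i) ∧
      x = match l with
        | [] => .const q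
        | [i] => .linear q i
        | i :: j :: _ => .quadratic q i j := by
    rintro (q | ⟨q, i⟩ | ⟨q, i, j⟩)
    · exact ⟨q, [], rfl, rfl⟩
    · exact ⟨q, [i], rfl, rfl⟩
    · exact ⟨q, [i, j], rfl, rfl⟩
  have hfin : PrefixCode fun i : Fin N => encNat i := fun i j s t h =>
    let ⟨h1, h2⟩ := prefixCode_encNat _ _ _ _ h
    ⟨Fin.ext h1, h2⟩
  intro x y s t h
  obtain ⟨q, l, hx, rfl⟩ := hq x
  obtain ⟨q', l', hy, rfl⟩ := hq y
  rw [hx, hy, List.append_assoc, List.append_assoc] at h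
  obtain ⟨h1, h⟩ := prefixCode_encRat _ _ _ _ h
  obtain ⟨h2, h3⟩ := prefixCode_encSeq hfin _ _ _ _ h
  subst h1 h2
  exact ⟨rfl, h3⟩

theorem prefixCode_encQuadratic : PrefixCode encQuadratic := by
  rintro ⟨N, l⟩ ⟨N', l'⟩ s t h
  simp only [encQuadratic, List.append_assoc] at h
  obtain ⟨h1, h⟩ := prefixCode_encUnary _ _ _ _ h
  subst h1
  obtain ⟨h2, h3⟩ := prefixCode_encSeq prefixCode_encQTerm _ _ _ _ h
  subst h2
  exact ⟨rfl, h3⟩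

/-! ### Search problems and polynomial-time reductions -/

/-- A search problem: given an instance, find a solution. Instances and solutions are finite
objects, written down as words over a finite alphabet. -/
structure SearchProblem where
  Inst : Type
  Sol : Type
  IsSol : Inst → Sol → Prop
  encInst : Inst → List Γ'
  encSol : Sol → List Γ'
  encInst_injective : Function.Injective encInst
  encSol_injective : Function.Injective encSol

/-- The maps `f`, `g` form a polynomial-time reduction from `P` to `Q`: `f` maps instances of `P`
to instances of `Q`, `g` maps an instance `I` of `P` and a solution of `f I` to a solution of `I`,
and both maps are computed by Turing machines in polynomial time. -/
def IsPolyTimeReduction (P Q : SearchProblem) (f : P.Inst → Q.Inst)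
    (g : P.Inst × Q.Sol → P.Sol) : Prop :=
  Nonempty (Turing.TM2ComputableInPolyTime P.encInst Q.encInst f) ∧
  Nonempty (Turing.TM2ComputableInPolyTime
    (fun x : P.Inst × Q.Sol => (P.encInst x.1).map (Sum.inl : Γ' → Γ' ⊕ Γ')
      ++ (Q.encSol x.2).map Sum.inr) P.encSol g) ∧
  ∀ I s, Q.IsSol (f I) s → P.IsSol I (g (I, s))

/-- The real vector of length `N` given by a list of rationals (used for lists of length `N`). -/
noncomputable def toPoint (N : ℕ) (s : List ℚ) : Fin N → ℝ := fun i => ((s.getD i 0 : ℚ) : ℝ)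

/-- 2D-LINEAR-KKT: given `ε, δ > 0` and a circuit, find a point satisfying the `ε`-KKT conditions
with respect to the `δ`-generalized circuit gradient. -/
def linearKKT : SearchProblem where
  Inst := LinearInstance
  Sol := List ℚ
  IsSol I s := s.length = 2 ∧ I.IsSolution (toPoint 2 s)
  encInst := encLinearInstance
  encSol := encVector
  encInst_injective := prefixCode_encLinearInstance.injective
  encSol_injective := prefixCode_encVector.injective

/-- QUADRATIC-KKT: given a quadratic polynomial in `N` variables, find a KKT point of its
minimization over `[0,1]^N`. -/
def quadraticKKT : SearchProblem where
  Inst := Quadratic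
  Sol := List ℚ
  IsSol p s := s.length = p.N ∧ IsKKTPoint p.toPoly (toPoint p.N s)
  encInst := encQuadratic
  encSol := encVector
  encInst_injective := prefixCode_encQuadratic.injective
  encSol_injective := prefixCode_encVector.injective

end QPKKT

/-!
# From two-dimensional linear circuits to quadratic programs

**KKT points give generalized gradients.** Let `(y, z)` be a KKT point of the quadratic program, and
let `t_k` be the affine form inside gate `k`, evaluated at `y`. The conditions for `z⁺` and `z⁻` say
that `K z⁺ = max 0 (t_k - 1)` and `K z⁻ = max 0 (-t_k)` (`Circuit.excess_of_isKKTPoint`), so that the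
term squared in `q_k` is `y_k - trunc t_k`. The condition for the variable `y_k` of a gate then says
that `y_k = trunc (t_k + e_k)` (`Circuit.gate_of_isKKTPoint`), where `e_k` collects the
contributions of later gates and of the output. Since the weights `δ ^ k` decrease quickly,
`|e_k| ≤ 2 K δ` (`Circuit.abs_gateError_le`).

Write `trunc (t_k + e_k) - trunc t_k = s_k e_k` with a slope `s_k ∈ [0,1]`. Up to powers of `δ`, the
`e_k` are then determined by the equations of backward differentiation (backpropagation) through a
circuit in which the truncation of gate `k` is replaced by a linear map of slope `s_k`. Forward
differentiation through that circuit gives the same result (`Circuit.forward_last_eq`). Hence the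
partial derivatives of the program with respect to the two inputs, divided by `δ ^ (n + 1)`, are the
gradient `D(s)` of the output.

The map `D` is affine in each `s_k` separately, so `D(s)` lies in the convex hull of the values of `D`
at slopes `σ_k ∈ {0, 1}`, where only those values of `σ_k` are needed that the truncation attains as
its derivative at some `w_k` with `|w_k - t_k| ≤ 2 K δ` (`exists_slope`,
`multiaffine_mem_convexHull`). A perturbation of the circuit by at most `δ'` makes all `w_k` the
arguments of the truncations at the given inputs, and then `D(σ)` is the gradient of the perturbed
circuit (`Circuit.exists_perturbation`). So the KKT conditions for the inputs are the
conditions on a solution of the instance, even with `0` in place of `ε'`.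

**The reduction takes polynomial time.** Turing machines are obtained from structured programs on
stacks (`StackProg.Prog`), which are compiled to machines with several stacks
(`StackProg.Exec.evalsToInTime`). Data are binary trees in prefix notation on a stack. The predicate
`StackProg.PT` says that a program computes a function on such data in polynomial time; it is closed
under composition, pairing, distinction of cases and left folds with states of polynomial
size (`StackProg.PT.foldl_of_sz_le`), and this yields binary arithmetic and the operations on lists.

For the gate bound `K`, the product over all gates of `|num a| + |num b| + |num c| + 1` is taken.
Rational coefficients have to be written as irreducible fractions. Greatest common divisors are
avoided: a coefficient `± n / d` is written as the sum of `± 2 ^ j / d` over the binary digits `1` of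
`n`, in separate monomials, so that only powers of two have to be cancelled
(`StackProg.Mono.split_reduced`, `StackProg.sumPoly_split`).
-/

namespace QPKKT

open Computability

/-! ### The truncation -/

theorem trunc_of_mem {t : ℝ} (h0 : 0 ≤ t) (h1 : t ≤ 1) : trunc t = t := by
  rw [trunc, min_eq_left h1, max_eq_right h0]

theorem trunc_of_nonpos {t : ℝ} (h : t ≤ 0) : trunc t = 0 :=
  max_eq_left ((min_le_left _ _).trans h)

theorem trunc_of_one_le {t : ℝ} (h : 1 ≤ t) : trunc t = 1 := by
  rw [trunc, min_eq_right h, max_eq_right zero_le_one]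

theorem trunc_mem (t : ℝ) : trunc t ∈ Set.Icc (0 : ℝ) 1 :=
  ⟨le_max_left _ _, max_le zero_le_one (min_le_right _ _)⟩

theorem trunc_mono {s t : ℝ} (h : s ≤ t) : trunc s ≤ trunc t :=
  max_le_max le_rfl (min_le_min h le_rfl)

theorem trunc_sub_trunc_le {s t : ℝ} (h : s ≤ t) : trunc t - trunc s ≤ t - s := by
  rw [sub_le_iff_le_add]
  refine max_le ?_ ?_
  · linarith [(trunc_mem s).1]
  · rcases le_total s 1 with h1 | h1
    · have h2 : s ≤ trunc s := by
        rw [trunc, min_eq_left h1]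
        exact le_max_right _ _
      linarith [min_le_left t 1]
    · linarith [trunc_of_one_le h1, min_le_right t 1]

theorem abs_trunc_sub_trunc_le (s t : ℝ) : |trunc s - trunc t| ≤ |s - t| := by
  rcases le_total s t with h | h
  · rw [abs_sub_comm, abs_of_nonneg (sub_nonneg.2 (trunc_mono h)), abs_sub_comm s t,
      abs_of_nonneg (sub_nonneg.2 h)]
    exact trunc_sub_trunc_le h
  · rw [abs_of_nonneg (sub_nonneg.2 (trunc_mono h)), abs_of_nonneg (sub_nonneg.2 h)]
    exact trunc_sub_trunc_le h

theorem trunc_add_excess (t : ℝ) : trunc t + max 0 (t - 1) - max 0 (-t) = t := by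
  rcases le_total t 0 with h0 | h0
  · rw [trunc_of_nonpos h0, max_eq_left (by linarith), max_eq_right (by linarith)]
    ring
  · rcases le_total t 1 with h1 | h1
    · rw [trunc_of_mem h0 h1, max_eq_left (by linarith), max_eq_left (by linarith)]
      ring
    · rw [trunc_of_one_le h1, max_eq_right (by linarith), max_eq_left (by linarith)]
      ring

/-- The KKT conditions for the square of `y - t` characterize the truncation. -/
theorem eq_trunc {y t : ℝ} (hy : y ∈ Set.Icc (0 : ℝ) 1) (h0 : 0 < y → y ≤ t) (h1 : y < 1 → t ≤ y) :
    y = trunc t := by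
  rcases hy.1.eq_or_lt with h | h
  · rw [trunc_of_nonpos (by rw [h]; exact h1 (by linarith))]
    exact h.symm
  · rcases hy.2.eq_or_lt with h' | h'
    · rw [trunc_of_one_le (h' ▸ h0 h), h']
    · rw [← le_antisymm (h0 h) (h1 h'), trunc_of_mem hy.1 hy.2]

theorem hasDerivAt_trunc {w : ℝ} (h0 : w ≠ 0) (h1 : w ≠ 1) :
    HasDerivAt trunc (if 0 < w ∧ w < 1 then 1 else 0) w := by
  rcases lt_or_gt_of_ne h0 with h | h
  · rw [if_neg fun h' => h.not_gt h'.1]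
    refine (hasDerivAt_const w (0 : ℝ)).congr_of_eventuallyEq ?_
    filter_upwards [gt_mem_nhds h] with t ht using trunc_of_nonpos ht.le
  · rcases lt_or_gt_of_ne h1 with h' | h'
    · rw [if_pos ⟨h, h'⟩]
      refine (hasDerivAt_id w).congr_of_eventuallyEq ?_
      filter_upwards [lt_mem_nhds h, gt_mem_nhds h'] with t ht ht' using trunc_of_mem ht.le ht'.le
    · rw [if_neg fun h'' => h'.not_gt h''.2]
      refine (hasDerivAt_const w (1 : ℝ)).congr_of_eventuallyEq ?_
      filter_upwards [lt_mem_nhds h'] with t ht using trunc_of_one_le ht.le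

/-- The slope `s` of a chord of the truncation is a mean of the slopes that the truncation has at
nearby points where it is differentiable. For a degenerate chord, the slope at a point close to
`t` is taken. -/
theorem exists_slope {t e B : ℝ} (he : |e| ≤ B) (hB : 0 < B) :
    ∃ s ∈ Set.Icc (0 : ℝ) 1, trunc (t + e) - trunc t = s * e ∧
      (s ≠ 0 → ∃ w, |w - t| ≤ B ∧ 0 < w ∧ w < 1) ∧
      (s ≠ 1 → ∃ w, |w - t| ≤ B ∧ (w < 0 ∨ 1 < w)) := by
  obtain ⟨he1, he2⟩ := abs_le.1 he
  by_cases h0 : e = 0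
  · subst h0
    by_cases ht : 0 < t ∧ t < 1
    · exact ⟨1, by simp, by simp, fun _ => ⟨t, by simpa using hB.le, ht⟩, fun h => absurd rfl h⟩
    · refine ⟨0, by simp, by simp, fun h => absurd rfl h, fun _ => ?_⟩
      rcases le_or_gt t 0 with h | h
      · exact ⟨t - B, by rw [sub_sub_cancel_left, abs_neg, abs_of_pos hB], .inl (by linarith)⟩
      · exact ⟨t + B, by rw [add_sub_cancel_left, abs_of_pos hB],
          .inr (by linarith [not_lt.1 fun h' => ht ⟨h, h'⟩])⟩
  · refine ⟨(trunc (t + e) - trunc t) / e, ?_, by field_simp, fun hs => ?_, fun hs => ?_⟩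
    · rcases lt_or_gt_of_ne h0 with h | h
      · have h1 := trunc_mono (show t + e ≤ t by linarith)
        have h2 := trunc_sub_trunc_le (show t + e ≤ t by linarith)
        exact ⟨div_nonneg_of_nonpos (by linarith) h.le, by rw [div_le_one_of_neg h]; linarith⟩
      · have h1 := trunc_mono (show t ≤ t + e by linarith)
        have h2 := trunc_sub_trunc_le (show t ≤ t + e by linarith)
        exact ⟨div_nonneg (by linarith) h.le, by rw [div_le_one h]; linarith⟩
    -- A positive slope: the chord meets `(0,1)`.
    · have hne : trunc (t + e) ≠ trunc t := fun h => hs (by rw [h, sub_self, zero_div])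
      have key : ∀ lo hi : ℝ, lo < hi → trunc lo ≠ trunc hi → ∃ w, lo ≤ w ∧ w ≤ hi ∧ 0 < w ∧ w < 1 := by
        intro lo hi hlt hne
        have h1 : lo < 1 := lt_of_not_ge fun h => hne (by
          rw [trunc_of_one_le h, trunc_of_one_le (h.trans hlt.le)])
        have h2 : 0 < hi := lt_of_not_ge fun h => hne (by
          rw [trunc_of_nonpos h, trunc_of_nonpos (hlt.le.trans h)])
        obtain ⟨w, hw1, hw2⟩ := exists_between (max_lt (lt_min hlt h1) (lt_min h2 one_pos))
        rw [max_lt_iff] at hw1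
        rw [lt_min_iff] at hw2
        exact ⟨w, hw1.1.le, hw2.1.le, hw1.2, hw2.2⟩
      rcases lt_or_gt_of_ne h0 with h | h
      · obtain ⟨w, h1, h2, h3⟩ := key (t + e) t (by linarith) hne
        exact ⟨w, abs_le.2 ⟨by linarith, by linarith⟩, h3⟩
      · obtain ⟨w, h1, h2, h3⟩ := key t (t + e) (by linarith) hne.symm
        exact ⟨w, abs_le.2 ⟨by linarith, by linarith⟩, h3⟩
    -- A slope less than one: an end of the chord lies outside `[0,1]`.
    · by_contra! hcon
      have h1 := hcon t (by simpa using hB.le)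
      have h2 := hcon (t + e) (by simpa using he)
      rw [trunc_of_mem h1.1 h1.2, trunc_of_mem h2.1 h2.2, add_sub_cancel_left, div_self h0] at hs
      exact hs rfl

/-! ### Multiaffine maps and convex hulls -/

/-- A map that is affine in each variable separately maps a product of convex hulls to the convex
hull of the image of the product. -/
theorem multiaffine_mem_convexHull {ι E : Type*} [Fintype ι] [DecidableEq ι] [AddCommGroup E]
    [Module ℝ E] {F : (ι → ℝ) → E}
    (hF : ∀ σ k, ∃ c d : E, ∀ v, F (Function.update σ k v) = c + v • d) {S : ι → Set ℝ} {s : ι → ℝ}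
    (hs : ∀ k, s k ∈ convexHull ℝ (S k)) : F s ∈ convexHull ℝ (F '' {σ | ∀ k, σ k ∈ S k}) := by
  -- `J` contains the coordinates that may lie in the convex hulls.
  have key : ∀ (J : Finset ι) (σ : ι → ℝ), (∀ k ∈ J, σ k ∈ convexHull ℝ (S k)) →
      (∀ k ∉ J, σ k ∈ S k) → F σ ∈ convexHull ℝ (F '' {σ | ∀ k, σ k ∈ S k}) := by
    intro J
    induction J using Finset.induction_on with
    | empty => exact fun σ _ h => subset_convexHull ℝ _ ⟨σ, fun k => h k (Finset.notMem_empty k), rfl⟩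
    | insert k J hk ih =>
      intro σ h1 h2
      obtain ⟨c, d, hcd⟩ := hF σ k
      have hconv : Convex ℝ {v : ℝ | c + v • d ∈ convexHull ℝ (F '' {σ | ∀ k, σ k ∈ S k})} := by
        intro v hv w hw a b ha hb hab
        have h := convex_convexHull ℝ (F '' {σ | ∀ k, σ k ∈ S k}) hv hw ha hb hab
        have heq : a • (c + v • d) + b • (c + w • d) = c + (a • v + b • w) • d := by
          rw [smul_add, smul_add, add_smul, smul_assoc, smul_assoc,
            show a • c + a • v • d + (b • c + b • w • d) = (a + b) • c + (a • v • d + b • w • d) by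
              rw [add_smul]; abel, hab, one_smul]
        rwa [heq] at h
      have hsub : S k ⊆ {v : ℝ | c + v • d ∈ convexHull ℝ (F '' {σ | ∀ k, σ k ∈ S k})} := by
        intro v hv
        rw [Set.mem_ofPred_eq, ← hcd]
        refine ih _ (fun j hj => ?_) fun j hj => ?_
        · rw [Function.update_of_ne (ne_of_mem_of_not_mem hj hk)]
          exact h1 j (Finset.mem_insert_of_mem hj)
        · by_cases hjk : j = k
          · subst hjk
            rwa [Function.update_self]
          · rw [Function.update_of_ne hjk]
            exact h2 j fun h => (Finset.mem_insert.1 h).elim hjk hj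
      have h := convexHull_min hsub hconv (h1 k (Finset.mem_insert_self k J))
      rwa [Set.mem_ofPred_eq, ← hcd, Function.update_eq_self] at h
  exact key Finset.univ s (fun k _ => hs k) fun k hk => absurd (Finset.mem_univ k) hk

namespace Circuit

variable (C : Circuit)

/-! ### Gates evaluated at arbitrary values of the variables -/

/-- The coefficient of the variable `i` in gate `k`, also for variables not available to the gate. -/
noncomputable def weight (k : Fin C.m) (i : Fin (C.m + 2)) : ℝ :=
  (if i = C.earlier k (C.gate k).l then ((C.gate k).a : ℝ) else 0) +
    (if i = C.earlier k (C.gate k).r then ((C.gate k).b : ℝ) else 0)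

/-- The affine form inside gate `k`, for arbitrary values of the variables. -/
noncomputable def form (k : Fin C.m) (y : Fin (C.m + 2) → ℝ) : ℝ :=
  (C.gate k).a * y (C.earlier k (C.gate k).l) + (C.gate k).b * y (C.earlier k (C.gate k).r) +
    (C.gate k).c

variable {C}

theorem weight_earlier (k : Fin C.m) (j : Fin (k + 2)) :
    C.weight k (C.earlier k j) = C.coeff k j := by
  have h : ∀ j', C.earlier k j = C.earlier k j' ↔ j = j' := fun j' => by
    simp [earlier, Fin.ext_iff]
  simp only [weight, coeff, h, Rat.cast_add, apply_ite (Rat.cast : ℚ → ℝ), Rat.cast_zero]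

theorem weight_of_le {k : Fin C.m} {i : Fin (C.m + 2)} (h : (k : ℕ) + 2 ≤ i) : C.weight k i = 0 := by
  have h' : ∀ j, i ≠ C.earlier k j := by
    intro j hj
    have := congrArg Fin.val hj
    simp only [earlier] at this
    omega
  rw [weight, if_neg (h' _), if_neg (h' _), add_zero]

theorem abs_weight_le {K : ℚ} (hK : C.IsGateBound K) (k : Fin C.m) (i : Fin (C.m + 2)) :
    |C.weight k i| ≤ K := by
  have hK1 : (1 : ℝ) ≤ K := by exact_mod_cast hK.1
  rcases lt_or_ge (i : ℕ) (k + 2) with h | h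
  · have h1 : i = C.earlier k ⟨i, h⟩ := rfl
    rw [h1, weight_earlier]
    have h2 := hK.2 k
    have h3 := Finset.single_le_sum (f := fun j => |C.coeff k j|) (fun j _ => abs_nonneg _)
      (Finset.mem_univ (⟨i, h⟩ : Fin (k + 2)))
    have h4 : |C.coeff k ⟨i, h⟩| ≤ K := by
      linarith [abs_nonneg (C.gate k).c]
    exact_mod_cast h4
  · rw [weight_of_le h, abs_zero]
    linarith

theorem sum_weight_smul {E : Type*} [AddCommMonoid E] [Module ℝ E] (k : Fin C.m)
    (D : Fin (C.m + 2) → E) : ∑ i, C.weight k i • D i =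
      ((C.gate k).a : ℝ) • D (C.earlier k (C.gate k).l) +
        ((C.gate k).b : ℝ) • D (C.earlier k (C.gate k).r) := by
  simp only [weight, add_smul, Finset.sum_add_distrib, ite_smul, zero_smul, Finset.sum_ite_eq',
    Finset.mem_univ, if_true]

theorem sum_coeff_mul (k : Fin C.m) (y : Fin (C.m + 2) → ℝ) :
    ∑ j, (C.coeff k j : ℝ) * y (C.earlier k j) =
      (C.gate k).a * y (C.earlier k (C.gate k).l) + (C.gate k).b * y (C.earlier k (C.gate k).r) := by
  simp only [coeff, Rat.cast_add, apply_ite (Rat.cast : ℚ → ℝ), Rat.cast_zero, add_mul,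
    Finset.sum_add_distrib, ite_mul, zero_mul, Finset.sum_ite_eq', Finset.mem_univ, if_true]

theorem abs_form_sub_le {K : ℚ} (hK : C.IsGateBound K) (k : Fin C.m) {y v : Fin (C.m + 2) → ℝ}
    {r : ℝ} (hr : ∀ i, |y i - v i| ≤ r) : |C.form k y - C.form k v| ≤ K * r := by
  have hr0 : 0 ≤ r := (abs_nonneg _).trans (hr 0)
  have h1 : C.form k y - C.form k v =
      ∑ j, (C.coeff k j : ℝ) * (y (C.earlier k j) - v (C.earlier k j)) := by
    simp only [mul_sub, Finset.sum_sub_distrib, sum_coeff_mul, form]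
    ring
  have h2 : (∑ j, |(C.coeff k j : ℝ)|) ≤ K := by
    have h3 : ∑ j, |C.coeff k j| ≤ K := by linarith [hK.2 k, abs_nonneg (C.gate k).c]
    exact_mod_cast h3
  calc |C.form k y - C.form k v|
      ≤ ∑ j, |(C.coeff k j : ℝ) * (y (C.earlier k j) - v (C.earlier k j))| := by
        rw [h1]
        exact Finset.abs_sum_le_sum_abs _ _
    _ ≤ ∑ j, |(C.coeff k j : ℝ)| * r := Finset.sum_le_sum fun j _ => by
        rw [abs_mul]
        exact mul_le_mul_of_nonneg_left (hr _) (abs_nonneg _)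
    _ ≤ K * r := by
        rw [← Finset.sum_mul]
        exact mul_le_mul_of_nonneg_right h2 hr0

theorem abs_form_le {K : ℚ} (hK : C.IsGateBound K) (k : Fin C.m) {y : Fin (C.m + 2) → ℝ}
    (hy : ∀ i, |y i| ≤ 1) : |C.form k y| ≤ K := by
  have h2 : (∑ j, |(C.coeff k j : ℝ)|) + |((C.gate k).c : ℝ)| ≤ K := by exact_mod_cast hK.2 k
  rw [form, ← sum_coeff_mul]
  refine (abs_add_le _ _).trans (le_trans (add_le_add_left ?_ _) h2)
  refine (Finset.abs_sum_le_sum_abs _ _).trans (Finset.sum_le_sum fun j _ => ?_)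
  rw [abs_mul]
  exact mul_le_of_le_one_right (abs_nonneg _) (hy _)

/-- Induction along the topological order of the variables. -/
theorem var_induction {P : Fin (C.m + 2) → Prop} (h0 : P 0) (h1 : P 1)
    (h : ∀ k, P (C.earlier k (C.gate k).l) → P (C.earlier k (C.gate k).r) → P (C.gateVar k)) (i) :
    P i := by
  have key : ∀ (n : ℕ) (hn : n < C.m + 2), P ⟨n, hn⟩ := by
    intro n
    induction n using Nat.strong_induction_on with
    | _ n ih =>
      intro hn
      rcases n with _ | _ | n
      · exact h0
      · exact h1
      · have h2 := (C.gate ⟨n, by omega⟩).l.isLt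
        have h3 := (C.gate ⟨n, by omega⟩).r.isLt
        exact h ⟨n, by omega⟩ (ih _ h2 _) (ih _ h3 _)
  exact key i i.isLt

/-! ### Values of a perturbed circuit -/

theorem value_zero (π x) : C.value π x 0 = x 0 := by
  rw [value]
  rfl

theorem value_one (π x) : C.value π x 1 = x 1 := by
  rw [value, dif_pos (by simp)]
  rfl

theorem value_gateVar (π x) (k : Fin C.m) :
    C.value π x (C.gateVar k) = trunc (C.form k (C.value π x) + π k) := by
  rw [value, dif_neg (by simp [gateVar])]
  rfl

/-! ### Forward and backward differentiation -/

/-- The derivative of the variable `i` with respect to the inputs when the truncation in gate `k`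
has slope `σ k`: forward differentiation. -/
noncomputable def forward (C : Circuit) (σ : Fin C.m → ℝ) (i : Fin (C.m + 2)) :
    (Fin 2 → ℝ) →L[ℝ] ℝ :=
  if h : (i : ℕ) < 2 then ContinuousLinearMap.proj ⟨i, h⟩
  else
    let k : Fin C.m := ⟨i - 2, by omega⟩
    σ k • (((C.gate k).a : ℝ) • C.forward σ (C.earlier k (C.gate k).l) +
      ((C.gate k).b : ℝ) • C.forward σ (C.earlier k (C.gate k).r))
termination_by (i : ℕ)
decreasing_by
  · have := (C.gate ⟨i - 2, by omega⟩).l.isLt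
    simp only [earlier] at *
    omega
  · have := (C.gate ⟨i - 2, by omega⟩).r.isLt
    simp only [earlier] at *
    omega

theorem forward_zero (σ) : C.forward σ 0 = ContinuousLinearMap.proj 0 := by
  rw [forward]
  rfl

theorem forward_one (σ) : C.forward σ 1 = ContinuousLinearMap.proj 1 := by
  rw [forward, dif_pos (by simp)]
  rfl

theorem forward_gateVar (σ) (k : Fin C.m) : C.forward σ (C.gateVar k) =
    σ k • (((C.gate k).a : ℝ) • C.forward σ (C.earlier k (C.gate k).l) +
      ((C.gate k).b : ℝ) • C.forward σ (C.earlier k (C.gate k).r)) := by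
  rw [forward, dif_neg (by simp [gateVar])]
  rfl

theorem forward_update_of_lt (σ : Fin C.m → ℝ) (k : Fin C.m) (v : ℝ) (i : Fin (C.m + 2)) :
    (i : ℕ) < k + 2 → C.forward (Function.update σ k v) i = C.forward σ i := by
  induction i using var_induction with
  | h0 => intro _; rw [forward_zero, forward_zero]
  | h1 => intro _; rw [forward_one, forward_one]
  | h j hl hr =>
    intro hj
    simp only [gateVar] at hj
    have h2 := (C.gate j).l.isLt
    have h3 := (C.gate j).r.isLt
    rw [forward_gateVar, forward_gateVar, hl (by simp only [earlier]; omega),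
      hr (by simp only [earlier]; omega), Function.update_of_ne (by intro h; subst h; omega)]

/-- The forward derivatives are affine in the slope of each gate. -/
theorem forward_update (σ : Fin C.m → ℝ) (k : Fin C.m) (i : Fin (C.m + 2)) :
    ∃ c d, ∀ v, C.forward (Function.update σ k v) i = c + v • d := by
  induction i using var_induction with
  | h0 => exact ⟨ContinuousLinearMap.proj 0, 0, fun v => by rw [forward_zero, smul_zero, add_zero]⟩
  | h1 => exact ⟨ContinuousLinearMap.proj 1, 0, fun v => by rw [forward_one, smul_zero, add_zero]⟩
  | h j hl hr =>
    by_cases hjk : j = k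
    · subst hjk
      refine ⟨0, ((C.gate j).a : ℝ) • C.forward σ (C.earlier j (C.gate j).l) +
        ((C.gate j).b : ℝ) • C.forward σ (C.earlier j (C.gate j).r), fun v => ?_⟩
      rw [forward_gateVar, forward_update_of_lt _ _ _ _ (C.gate j).l.isLt,
        forward_update_of_lt _ _ _ _ (C.gate j).r.isLt, Function.update_self, zero_add]
    · obtain ⟨c, d, h⟩ := hl
      obtain ⟨c', d', h'⟩ := hr
      refine ⟨σ j • (((C.gate j).a : ℝ) • c + ((C.gate j).b : ℝ) • c'),
        σ j • (((C.gate j).a : ℝ) • d + ((C.gate j).b : ℝ) • d'), fun v => ?_⟩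
      rw [forward_gateVar, h, h', Function.update_of_ne hjk]
      module

theorem sum_var {E : Type*} [AddCommMonoid E] (f : Fin (C.m + 2) → E) :
    ∑ i, f i = f 0 + f 1 + ∑ k, f (C.gateVar k) := by
  rw [Fin.sum_univ_succ, Fin.sum_univ_succ, ← add_assoc]
  rfl

/-- Forward and backward differentiation agree: if `L` satisfies the equations of backward
differentiation, then the derivative of the output with respect to the inputs is given by the values
of `L` at the inputs. -/
theorem forward_last_eq {σ : Fin C.m → ℝ} {L : Fin (C.m + 2) → ℝ}
    (hL : ∀ i, L i = (if i = Fin.last (C.m + 1) then 1 else 0) +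
      ∑ k, σ k * L (C.gateVar k) * C.weight k i) :
    C.forward σ (Fin.last (C.m + 1)) =
      L 0 • ContinuousLinearMap.proj 0 + L 1 • ContinuousLinearMap.proj 1 := by
  have h1 : ∑ i, L i • C.forward σ i = C.forward σ (Fin.last (C.m + 1)) +
      ∑ k, L (C.gateVar k) • C.forward σ (C.gateVar k) := by
    have h2 : ∀ i, L i • C.forward σ i = (if i = Fin.last (C.m + 1) then C.forward σ i else 0) +
        ∑ k, (σ k * L (C.gateVar k)) • C.weight k i • C.forward σ i := by
      intro i
      rw [hL i, add_smul, ite_smul, one_smul, zero_smul, Finset.sum_smul]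
      simp only [mul_smul]
    rw [Finset.sum_congr rfl fun i _ => h2 i, Finset.sum_add_distrib, Finset.sum_ite_eq',
      if_pos (Finset.mem_univ _), Finset.sum_comm]
    congr 1
    refine Finset.sum_congr rfl fun k _ => ?_
    rw [← Finset.smul_sum, sum_weight_smul, forward_gateVar, smul_smul, mul_comm]
  rw [sum_var, forward_zero, forward_one] at h1
  exact (add_right_cancel h1).symm

/-- A perturbed circuit is differentiable where no gate is evaluated at a kink of its truncation. -/
theorem hasFDerivAt_value {π : Fin C.m → ℝ} {x : Fin 2 → ℝ}
    (h : ∀ k, C.form k (C.value π x) + π k ≠ 0 ∧ C.form k (C.value π x) + π k ≠ 1) (i) :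
    HasFDerivAt (fun x => C.value π x i) (C.forward (fun k =>
      if 0 < C.form k (C.value π x) + π k ∧ C.form k (C.value π x) + π k < 1 then 1 else 0) i) x := by
  induction i using var_induction with
  | h0 =>
    simp only [value_zero, forward_zero]
    exact (ContinuousLinearMap.proj 0 : (Fin 2 → ℝ) →L[ℝ] ℝ).hasFDerivAt
  | h1 =>
    simp only [value_one, forward_one]
    exact (ContinuousLinearMap.proj 1 : (Fin 2 → ℝ) →L[ℝ] ℝ).hasFDerivAt
  | h k hl hr =>
    simp only [value_gateVar]
    rw [forward_gateVar]
    have hform := (((hl.const_mul ((C.gate k).a : ℝ)).add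
      (hr.const_mul ((C.gate k).b : ℝ))).add_const ((C.gate k).c : ℝ)).add_const (π k)
    exact HasDerivAt.comp_hasFDerivAt (h₂ := trunc)
      (f := fun x => C.form k (C.value π x) + π k) x (hasDerivAt_trunc (h k).1 (h k).2) hform

end Circuit

namespace Circuit

variable {C : Circuit}

/-! ### Generalized gradients from nearby slopes -/

/-- If every gate is satisfied up to a small error, then any values `w` close to the forms of the
gates and different from the kinks `0` and `1` are the arguments of the truncations in a slightly
perturbed circuit, which is differentiable at the inputs. -/
theorem exists_perturbation {K : ℚ} (hK : C.IsGateBound K) {y : Fin (C.m + 2) → ℝ}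
    {e w : Fin C.m → ℝ} {B δ : ℝ} (he : ∀ k, |e k| ≤ B)
    (hy : ∀ k, y (C.gateVar k) = trunc (C.form k y + e k))
    (hw : ∀ k, |w k - C.form k y| ≤ B ∧ w k ≠ 0 ∧ w k ≠ 1) (hB : 0 ≤ B) (hδ : 3 * K * B ≤ δ) :
    ∃ π : Fin C.m → ℝ, (∀ k, π k ∈ Set.Icc (-δ) δ) ∧
      HasFDerivAt (C.perturbed π) (C.forward (fun k => if 0 < w k ∧ w k < 1 then 1 else 0)
        (Fin.last (C.m + 1))) ![y 0, y 1] := by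
  have hK1 : (1 : ℝ) ≤ K := by exact_mod_cast hK.1
  -- `v` is the assignment computed by the circuit when gate `k` truncates `w k`.
  obtain ⟨v, hv0, hv1, hv⟩ : ∃ v : Fin (C.m + 2) → ℝ, v 0 = y 0 ∧ v 1 = y 1 ∧
      ∀ k, v (C.gateVar k) = trunc (w k) :=
    ⟨Fin.cons (y 0) (Fin.cons (y 1) fun k => trunc (w k)), rfl, rfl, fun k => rfl⟩
  have hval : ∀ i, C.value (fun k => w k - C.form k v) ![y 0, y 1] i = v i := by
    intro i
    induction i using var_induction with
    | h0 => rw [value_zero, hv0]; rfl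
    | h1 => rw [value_one, hv1]; rfl
    | h k hl hr => rw [value_gateVar, hv, form, hl, hr, ← form, add_sub_cancel]
  have hval' : C.value (fun k => w k - C.form k v) ![y 0, y 1] = v := funext hval
  have hdist : ∀ i, |y i - v i| ≤ 2 * B := by
    intro i
    induction i using var_induction with
    | h0 => rw [hv0, sub_self, abs_zero]; linarith
    | h1 => rw [hv1, sub_self, abs_zero]; linarith
    | h k _ _ =>
      rw [hy, hv]
      refine (abs_trunc_sub_trunc_le _ _).trans ?_
      have h1 := abs_le.1 (hw k).1
      have h2 := abs_le.1 (he k)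
      exact abs_le.2 ⟨by linarith, by linarith⟩
  refine ⟨fun k => w k - C.form k v, fun k => ?_, ?_⟩
  · have h1 := abs_le.1 (abs_form_sub_le hK k hdist)
    have h2 := abs_le.1 (hw k).1
    have h3 : B ≤ K * B := le_mul_of_one_le_left hB hK1
    exact ⟨by linarith, by linarith⟩
  · have h := hasFDerivAt_value (π := fun k => w k - C.form k v) (x := ![y 0, y 1])
      (fun k => by rw [hval', add_sub_cancel]; exact (hw k).2) (Fin.last (C.m + 1))
    simp only [hval', add_sub_cancel] at h
    exact h

/-- If all gates are satisfied up to errors `e`, and `L` solves the equations of backward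
differentiation for the slopes of the chords that belong to these errors, then the values of `L` at
the inputs form a generalized gradient. -/
theorem mem_generalizedGradient {K : ℚ} (hK : C.IsGateBound K) {y L : Fin (C.m + 2) → ℝ}
    {e s : Fin C.m → ℝ} {B δ : ℝ} (he : ∀ k, |e k| ≤ B)
    (hy : ∀ k, y (C.gateVar k) = trunc (C.form k y + e k)) (hB : 0 ≤ B) (hδ : 3 * K * B ≤ δ)
    (hs : ∀ k, s k ∈ Set.Icc (0 : ℝ) 1)
    (hs0 : ∀ k, s k ≠ 0 → ∃ w, |w - C.form k y| ≤ B ∧ 0 < w ∧ w < 1)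
    (hs1 : ∀ k, s k ≠ 1 → ∃ w, |w - C.form k y| ≤ B ∧ (w < 0 ∨ 1 < w))
    (hL : ∀ i, L i = (if i = Fin.last (C.m + 1) then 1 else 0) +
      ∑ k, s k * L (C.gateVar k) * C.weight k i) :
    (![L 0, L 1] : Fin 2 → ℝ) ∈ C.generalizedGradient δ ![y 0, y 1] := by
  have hmem : ∀ k, s k ∈ convexHull ℝ {σ : ℝ | ∃ w, (|w - C.form k y| ≤ B ∧ w ≠ 0 ∧ w ≠ 1) ∧
      σ = if 0 < w ∧ w < 1 then 1 else 0} := by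
    intro k
    have hone : s k ≠ 0 → (1 : ℝ) ∈ {σ : ℝ | ∃ w, (|w - C.form k y| ≤ B ∧ w ≠ 0 ∧ w ≠ 1) ∧
        σ = if 0 < w ∧ w < 1 then 1 else 0} := fun h => by
      obtain ⟨w, h1, h2, h3⟩ := hs0 k h
      exact ⟨w, ⟨h1, h2.ne', h3.ne⟩, by rw [if_pos ⟨h2, h3⟩]⟩
    have hzero : s k ≠ 1 → (0 : ℝ) ∈ {σ : ℝ | ∃ w, (|w - C.form k y| ≤ B ∧ w ≠ 0 ∧ w ≠ 1) ∧
        σ = if 0 < w ∧ w < 1 then 1 else 0} := fun h => by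
      obtain ⟨w, h1, h2⟩ := hs1 k h
      refine ⟨w, ⟨h1, fun h => ?_, fun h => ?_⟩, ?_⟩
      · rcases h2 with h2 | h2 <;> linarith
      · rcases h2 with h2 | h2 <;> linarith
      · rw [if_neg]
        rintro ⟨h3, h4⟩
        rcases h2 with h2 | h2 <;> linarith
    by_cases h0 : s k = 0
    · rw [h0]
      exact subset_convexHull ℝ _ (hzero (by rw [h0]; exact zero_ne_one))
    by_cases h1 : s k = 1
    · rw [h1]
      exact subset_convexHull ℝ _ (hone h0)
    have h := convex_convexHull ℝ _ (subset_convexHull ℝ _ (hzero h1))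
      (subset_convexHull ℝ _ (hone h0)) (sub_nonneg.2 (hs k).2) (hs k).1 (sub_add_cancel _ _)
    rwa [smul_zero, zero_add, smul_eq_mul, mul_one] at h
  have haff : ∀ (σ : Fin C.m → ℝ) (k : Fin C.m), ∃ c d : Fin 2 → ℝ, ∀ v,
      (fun i => C.forward (Function.update σ k v) (Fin.last (C.m + 1)) (Pi.single i 1)) =
        c + v • d := by
    intro σ k
    obtain ⟨c, d, h⟩ := forward_update σ k (Fin.last (C.m + 1))
    refine ⟨fun i => c (Pi.single i 1), fun i => d (Pi.single i 1), fun v => funext fun i => ?_⟩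
    rw [h]
    rfl
  have hhull := multiaffine_mem_convexHull
    (F := fun σ i => C.forward σ (Fin.last (C.m + 1)) (Pi.single i 1)) haff hmem
  have hgrad : (fun i => C.forward s (Fin.last (C.m + 1)) (Pi.single i 1)) =
      (![L 0, L 1] : Fin 2 → ℝ) := by
    funext i
    rw [forward_last_eq hL]
    fin_cases i <;> simp
  simp only [hgrad] at hhull
  refine convexHull_mono ?_ hhull
  rintro _ ⟨σ, hσ, rfl⟩
  choose w hw hσw using hσ
  obtain ⟨π, hπ, hderiv⟩ := exists_perturbation hK he hy hw hB hδ
  refine ⟨π, hπ, hderiv.differentiableAt, ?_⟩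
  rw [hderiv.fderiv, ← funext hσw]

/-! ### Partial derivatives of the quadratic program -/

open MvPolynomial

theorem yIdx_inj {i j : Fin (C.m + 2)} : C.yIdx i = C.yIdx j ↔ i = j := by
  simp [yIdx, Fin.ext_iff]

theorem zPosIdx_inj {k l : Fin C.m} : C.zPosIdx k = C.zPosIdx l ↔ k = l := by
  simp [zPosIdx, Fin.ext_iff]

theorem zNegIdx_inj {k l : Fin C.m} : C.zNegIdx k = C.zNegIdx l ↔ k = l := by
  simp [zNegIdx, Fin.ext_iff]

theorem yIdx_ne_zPosIdx (i : Fin (C.m + 2)) (k : Fin C.m) : C.yIdx i ≠ C.zPosIdx k := by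
  simp only [yIdx, zPosIdx, ne_eq, Fin.mk.injEq]
  omega

theorem yIdx_ne_zNegIdx (i : Fin (C.m + 2)) (k : Fin C.m) : C.yIdx i ≠ C.zNegIdx k := by
  simp only [yIdx, zNegIdx, ne_eq, Fin.mk.injEq]
  omega

theorem zPosIdx_ne_zNegIdx (k l : Fin C.m) : C.zPosIdx k ≠ C.zNegIdx l := by
  simp only [zPosIdx, zNegIdx, ne_eq, Fin.mk.injEq]
  omega

theorem gateVar_inj {k l : Fin C.m} : C.gateVar k = C.gateVar l ↔ k = l := by
  simp [gateVar, Fin.ext_iff]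

/-- The difference between the two sides of the equation that defines gate `k`. -/
noncomputable def slack (C : Circuit) (K : ℚ) (x : Fin (3 * C.m + 2) → ℝ) (k : Fin C.m) : ℝ :=
  x (C.yIdx (C.gateVar k)) + K * x (C.zPosIdx k) - K * x (C.zNegIdx k) -
    C.form k fun i => x (C.yIdx i)

theorem aeval_pderiv_X (x : Fin (3 * C.m + 2) → ℝ) (i j : Fin (3 * C.m + 2)) :
    aeval x (pderiv i (X j : MvPolynomial _ ℚ)) = if j = i then (1 : ℝ) else 0 := by
  rw [pderiv_X, Pi.single_apply, apply_ite (aeval x), map_one, map_zero]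

theorem aeval_pderiv_gatePoly (K : ℚ) (x : Fin (3 * C.m + 2) → ℝ) (k : Fin C.m)
    (i : Fin (3 * C.m + 2)) : aeval x (pderiv i (C.gatePoly K k)) =
      2 * C.slack K x k * ((if C.yIdx (C.gateVar k) = i then 1 else 0) +
          K * (if C.zPosIdx k = i then 1 else 0) - K * (if C.zNegIdx k = i then 1 else 0) -
          ∑ j, (C.coeff k j : ℝ) * if C.yIdx (C.earlier k j) = i then 1 else 0) +
        2 * K ^ 2 * ((if C.zPosIdx k = i then 1 else 0) * x (C.zNegIdx k) +
          x (C.zPosIdx k) * if C.zNegIdx k = i then 1 else 0) +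
        2 * K * ((if C.zPosIdx k = i then 1 else 0) * (1 - x (C.yIdx (C.gateVar k))) -
          x (C.zPosIdx k) * if C.yIdx (C.gateVar k) = i then 1 else 0) +
        2 * K * ((if C.zNegIdx k = i then 1 else 0) * x (C.yIdx (C.gateVar k)) +
          x (C.zNegIdx k) * if C.yIdx (C.gateVar k) = i then 1 else 0) := by
  have hform : C.form k (fun i => x (C.yIdx i)) =
      ∑ j, (C.coeff k j : ℝ) * x (C.yIdx (C.earlier k j)) + (C.gate k).c := by
    rw [form, sum_coeff_mul k fun i => x (C.yIdx i)]
  simp only [← aeval_pderiv_X x i, slack, hform, gatePoly]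
  simp only [sq, map_add, map_sub, map_sum, Derivation.leibniz, pderiv_C, smul_eq_mul, map_mul,
    aeval_X, aeval_C, eq_ratCast, mul_zero, add_zero, sub_zero, map_one, pderiv_one,
    map_zero, Rat.cast_ofNat]
  ring

theorem sum_coeff_ite (k : Fin C.m) (i : Fin (C.m + 2)) :
    (∑ j, (C.coeff k j : ℝ) * if C.yIdx (C.earlier k j) = C.yIdx i then 1 else 0) =
      C.weight k i := by
  rw [sum_coeff_mul k fun j => if C.yIdx j = C.yIdx i then 1 else 0]
  simp only [yIdx_inj, mul_ite, mul_one, mul_zero, weight, eq_comm]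

theorem aeval_pderiv_qpPoly (K δ : ℚ) (x : Fin (3 * C.m + 2) → ℝ) (i : Fin (3 * C.m + 2)) :
    aeval x (pderiv i (C.qpPoly K δ)) =
      (δ : ℝ) ^ (C.m + 3) * (if C.yIdx (Fin.last (C.m + 1)) = i then 1 else 0) +
        ∑ k : Fin C.m, (δ : ℝ) ^ ((k : ℕ) + 3) * aeval x (pderiv i (C.gatePoly K k)) := by
  simp only [qpPoly, map_add, map_sum, Derivation.leibniz, pderiv_C, smul_eq_mul, map_mul, aeval_C,
    mul_zero, add_zero, aeval_pderiv_X, eq_ratCast, Rat.cast_pow]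

theorem aeval_pderiv_zPosIdx (K δ : ℚ) (x : Fin (3 * C.m + 2) → ℝ) (k : Fin C.m) :
    aeval x (pderiv (C.zPosIdx k) (C.qpPoly K δ)) = 2 * K * (δ : ℝ) ^ ((k : ℕ) + 3) *
      (K * x (C.zPosIdx k) - (C.form k (fun i => x (C.yIdx i)) - 1)) := by
  rw [aeval_pderiv_qpPoly, Finset.sum_eq_single_of_mem k (Finset.mem_univ k)]
  · simp only [aeval_pderiv_gatePoly, yIdx_ne_zPosIdx, (zPosIdx_ne_zNegIdx _ _).symm, if_true,
      if_false, mul_zero, Finset.sum_const_zero, slack]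
    ring
  · intro l _ hl
    simp only [aeval_pderiv_gatePoly, yIdx_ne_zPosIdx, (zPosIdx_ne_zNegIdx _ _).symm, zPosIdx_inj,
      hl, if_false, mul_zero, Finset.sum_const_zero]
    ring

theorem aeval_pderiv_zNegIdx (K δ : ℚ) (x : Fin (3 * C.m + 2) → ℝ) (k : Fin C.m) :
    aeval x (pderiv (C.zNegIdx k) (C.qpPoly K δ)) = 2 * K * (δ : ℝ) ^ ((k : ℕ) + 3) *
      (K * x (C.zNegIdx k) + C.form k fun i => x (C.yIdx i)) := by
  rw [aeval_pderiv_qpPoly, Finset.sum_eq_single_of_mem k (Finset.mem_univ k)]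
  · simp only [aeval_pderiv_gatePoly, yIdx_ne_zNegIdx, zPosIdx_ne_zNegIdx, if_true,
      if_false, mul_zero, Finset.sum_const_zero, slack]
    ring
  · intro l _ hl
    simp only [aeval_pderiv_gatePoly, yIdx_ne_zNegIdx, zPosIdx_ne_zNegIdx, zNegIdx_inj,
      hl, if_false, mul_zero, Finset.sum_const_zero]
    ring

theorem aeval_pderiv_yIdx (K δ : ℚ) (x : Fin (3 * C.m + 2) → ℝ) (i : Fin (C.m + 2)) :
    aeval x (pderiv (C.yIdx i) (C.qpPoly K δ)) =
      ((δ : ℝ) ^ (C.m + 3) * (if i = Fin.last (C.m + 1) then 1 else 0) -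
        ∑ k : Fin C.m, 2 * (δ : ℝ) ^ ((k : ℕ) + 3) * C.slack K x k * C.weight k i) +
      ∑ k : Fin C.m, if C.gateVar k = i then 2 * (δ : ℝ) ^ ((k : ℕ) + 3) *
        (C.slack K x k - K * x (C.zPosIdx k) + K * x (C.zNegIdx k)) else 0 := by
  rw [aeval_pderiv_qpPoly, sub_add, ← Finset.sum_sub_distrib, sub_eq_add_neg,
    ← Finset.sum_neg_distrib]
  congr 1
  · simp only [yIdx_inj, eq_comm]
  · refine Finset.sum_congr rfl fun k _ => ?_
    rw [aeval_pderiv_gatePoly, sum_coeff_ite]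
    simp only [yIdx_inj, (yIdx_ne_zPosIdx _ _).symm, (yIdx_ne_zNegIdx _ _).symm, if_false]
    split_ifs <;> ring

end Circuit

/-! ### KKT points of the quadratic program -/

/-- The geometric series behind the choice of the weights: later gates weigh less. -/
theorem sum_pow_later_le {m : ℕ} {δ : ℝ} (h0 : 0 < δ) (h1 : δ ≤ 1 / 32) (k : Fin m) :
    (∑ l : Fin m, if k < l then δ ^ (l : ℕ) else 0) ≤ 32 / 31 * δ ^ ((k : ℕ) + 1) := by
  have h2 : (∑ l : Fin m, if k < l then δ ^ (l : ℕ) else 0) =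
      ∑ l ∈ Finset.Ico ((k : ℕ) + 1) m, δ ^ l := by
    simp only [Fin.lt_def]
    rw [Fin.sum_univ_eq_sum_range (fun l => if (k : ℕ) < l then δ ^ l else 0) m,
      ← Finset.sum_filter]
    refine Finset.sum_congr ?_ fun _ _ => rfl
    ext l
    simp only [Finset.mem_filter, Finset.mem_range, Finset.mem_Ico]
    omega
  rw [h2]
  refine (geom_sum_Ico_le_of_lt_one h0.le (by linarith)).trans ?_
  rw [div_le_iff₀ (by linarith)]
  have h3 : 0 < δ ^ ((k : ℕ) + 1) := pow_pos h0 _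
  nlinarith

theorem LinearInstance.qpDelta_spec (I : LinearInstance) {K : ℚ} (hK : 1 ≤ K) :
    0 < (I.qpDelta K : ℝ) ∧ (I.qpDelta K : ℝ) ≤ 1 / 32 ∧
      8 * (K : ℝ) ^ 2 * (I.qpDelta K : ℝ) ≤ I.δ := by
  have hK2 : 1 ≤ K ^ 2 := one_le_pow₀ hK
  have h1 : 0 < I.qpDelta K := lt_min (div_pos I.δ_pos (by positivity)) (by positivity)
  have h2 : I.qpDelta K ≤ 1 / 32 := (min_le_right _ _).trans (by
    rw [div_le_div_iff₀ (by positivity) (by norm_num)]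
    linarith)
  have h3 : 8 * K ^ 2 * I.qpDelta K ≤ I.δ := by
    have h := (le_div_iff₀ (by positivity)).1 (min_le_left (I.δ / (8 * K ^ 2)) (1 / (32 * K ^ 2)))
    rw [mul_comm]
    exact h
  refine ⟨by exact_mod_cast h1, ?_, by exact_mod_cast h3⟩
  have h4 : ((I.qpDelta K : ℚ) : ℝ) ≤ ((1 / 32 : ℚ) : ℝ) := by exact_mod_cast h2
  simpa using h4

namespace Circuit

variable {C : Circuit} {K δ : ℚ} {x : Fin (3 * C.m + 2) → ℝ}

/-- At a KKT point, the auxiliary variables of a gate are the amounts by which its form exceeds `1`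
or falls below `0`. -/
theorem excess_of_isKKTPoint (hK : C.IsGateBound K) (hδ : 0 < δ) (hx : IsKKTPoint (C.qpPoly K δ) x)
    (k : Fin C.m) : K * x (C.zPosIdx k) = max 0 (C.form k (fun i => x (C.yIdx i)) - 1) ∧
      K * x (C.zNegIdx k) = max 0 (-C.form k fun i => x (C.yIdx i)) := by
  have hK1 : (1 : ℝ) ≤ K := by exact_mod_cast hK.1
  have hc : (0 : ℝ) < 2 * K * (δ : ℝ) ^ ((k : ℕ) + 3) := by
    have : (0 : ℝ) < δ := by exact_mod_cast hδ
    positivity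
  have hform := abs_le.1 (abs_form_le hK k (y := fun i => x (C.yIdx i)) fun i => by
    rw [abs_of_nonneg (hx.1 _).1]
    exact (hx.1 _).2)
  have h1 := hx.1 (C.zPosIdx k)
  have h2 := hx.1 (C.zNegIdx k)
  obtain ⟨h3, h4⟩ := hx.2 (C.zPosIdx k)
  obtain ⟨h5, h6⟩ := hx.2 (C.zNegIdx k)
  rw [aeval_pderiv_zPosIdx] at h3
  rw [aeval_pderiv_zPosIdx, mul_nonneg_iff_of_pos_left hc] at h4
  rw [aeval_pderiv_zNegIdx] at h5
  rw [aeval_pderiv_zNegIdx, mul_nonneg_iff_of_pos_left hc] at h6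
  generalize C.form k (fun i => x (C.yIdx i)) = t at *
  generalize x (C.zPosIdx k) = p at *
  generalize x (C.zNegIdx k) = q at *
  have key : ∀ p s : ℝ, p ∈ Set.Icc (0 : ℝ) 1 → s ≤ K → (0 < p → K * p ≤ s) → (p < 1 → s ≤ K * p) →
      K * p = max 0 s := by
    intro p s hp hs h h'
    have h4 : s ≤ K * p := by
      rcases hp.2.eq_or_lt with h1 | h1
      · rw [h1, mul_one]
        exact hs
      · exact h' h1
    rcases hp.1.eq_or_lt with h0 | h0
    · rw [← h0, mul_zero] at h4 ⊢
      rw [max_eq_left h4]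
    · rw [le_antisymm (h h0) h4, max_eq_right]
      exact (mul_nonneg (by linarith) h0.le).trans (h h0)
  refine ⟨key p (t - 1) h1 (by linarith) (fun h => ?_) fun h => ?_,
    key q (-t) h2 (by linarith) (fun h => ?_) fun h => ?_⟩
  · linarith [nonpos_of_mul_nonpos_right (h3 h) hc]
  · linarith [h4 h]
  · linarith [nonpos_of_mul_nonpos_right (h5 h) hc]
  · linarith [h6 h]

/-- At a KKT point, the slack of a gate is the distance of its variable to the correct value. -/
theorem slack_of_isKKTPoint (hK : C.IsGateBound K) (hδ : 0 < δ) (hx : IsKKTPoint (C.qpPoly K δ) x)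
    (k : Fin C.m) : C.slack K x k =
      x (C.yIdx (C.gateVar k)) - trunc (C.form k fun i => x (C.yIdx i)) := by
  obtain ⟨h1, h2⟩ := excess_of_isKKTPoint hK hδ hx k
  rw [slack, h1, h2]
  linarith [trunc_add_excess (C.form k fun i => x (C.yIdx i))]

/-- The partial derivative of the quadratic program with respect to the variable `y_i`, without the
contribution of the gate that computes `y_i`, and divided by the weight `δ ^ (n + 1)` of the
output. -/
noncomputable def multiplier (C : Circuit) (K δ : ℚ) (x : Fin (3 * C.m + 2) → ℝ)
    (i : Fin (C.m + 2)) : ℝ :=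
  ((δ : ℝ) ^ (C.m + 3) * (if i = Fin.last (C.m + 1) then 1 else 0) -
    ∑ k : Fin C.m, 2 * (δ : ℝ) ^ ((k : ℕ) + 3) * C.slack K x k * C.weight k i) /
      (δ : ℝ) ^ (C.m + 3)

/-- The error by which the multiplier of the variable computed by a gate displaces its form. -/
noncomputable def gateError (C : Circuit) (K δ : ℚ) (x : Fin (3 * C.m + 2) → ℝ) (k : Fin C.m) : ℝ :=
  -((δ : ℝ) ^ (C.m + 3) * C.multiplier K δ x (C.gateVar k)) / (2 * (δ : ℝ) ^ ((k : ℕ) + 3))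

theorem pow_mul_multiplier (hδ : 0 < δ) (i : Fin (C.m + 2)) :
    (δ : ℝ) ^ (C.m + 3) * C.multiplier K δ x i =
      (δ : ℝ) ^ (C.m + 3) * (if i = Fin.last (C.m + 1) then 1 else 0) -
        ∑ k : Fin C.m, 2 * (δ : ℝ) ^ ((k : ℕ) + 3) * C.slack K x k * C.weight k i :=
  mul_div_cancel₀ _ (pow_pos (Rat.cast_pos.2 hδ) _).ne'

theorem pow_mul_gateError (hδ : 0 < δ) (k : Fin C.m) :
    2 * (δ : ℝ) ^ ((k : ℕ) + 3) * C.gateError K δ x k =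
      -((δ : ℝ) ^ (C.m + 3) * C.multiplier K δ x (C.gateVar k)) :=
  mul_div_cancel₀ _ (mul_pos two_pos (pow_pos (Rat.cast_pos.2 hδ) _)).ne'

/-- At a KKT point, every gate is satisfied up to its error. -/
theorem gate_of_isKKTPoint (hK : C.IsGateBound K) (hδ : 0 < δ) (hx : IsKKTPoint (C.qpPoly K δ) x)
    (k : Fin C.m) : x (C.yIdx (C.gateVar k)) =
      trunc ((C.form k fun i => x (C.yIdx i)) + C.gateError K δ x k) := by
  have hd : MvPolynomial.aeval x (MvPolynomial.pderiv (C.yIdx (C.gateVar k)) (C.qpPoly K δ)) =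
      2 * (δ : ℝ) ^ ((k : ℕ) + 3) * (x (C.yIdx (C.gateVar k)) -
        ((C.form k fun i => x (C.yIdx i)) + C.gateError K δ x k)) := by
    have h := trunc_add_excess (C.form k fun i => x (C.yIdx i))
    rw [aeval_pderiv_yIdx, ← pow_mul_multiplier hδ]
    simp only [gateVar_inj, Finset.sum_ite_eq', Finset.mem_univ, if_true]
    rw [(excess_of_isKKTPoint hK hδ hx k).1, (excess_of_isKKTPoint hK hδ hx k).2,
      slack_of_isKKTPoint hK hδ hx]
    linear_combination (-2 * (δ : ℝ) ^ ((k : ℕ) + 3)) * h +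
      pow_mul_gateError (K := K) (x := x) hδ k
  obtain ⟨h1, h2⟩ := hx.2 (C.yIdx (C.gateVar k))
  rw [hd] at h1 h2
  have hc : 0 < 2 * (δ : ℝ) ^ ((k : ℕ) + 3) := mul_pos two_pos (pow_pos (Rat.cast_pos.2 hδ) _)
  exact eq_trunc (hx.1 _) (fun h => sub_nonpos.1 (nonpos_of_mul_nonpos_right (h1 h) hc))
    fun h => sub_nonneg.1 ((mul_nonneg_iff_of_pos_left hc).1 (h2 h))

/-- The errors are small since the weights of the gates decrease quickly. -/
theorem abs_gateError_le (hK : C.IsGateBound K) (hδ : 0 < δ) (hδ1 : (δ : ℝ) ≤ 1 / 32)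
    (hx : IsKKTPoint (C.qpPoly K δ) x) (k : Fin C.m) : |C.gateError K δ x k| ≤ 2 * K * δ := by
  have hK1 : (1 : ℝ) ≤ K := by exact_mod_cast hK.1
  have hδ0 : (0 : ℝ) < δ := by exact_mod_cast hδ
  have hpow : ∀ n : ℕ, 0 < (δ : ℝ) ^ n := fun n => pow_pos hδ0 n
  have h1 : |∑ l : Fin C.m, 2 * (δ : ℝ) ^ ((l : ℕ) + 3) * C.slack K x l *
      C.weight l (C.gateVar k)| ≤
        2 * (δ : ℝ) ^ 3 * K * ∑ l : Fin C.m, if k < l then (δ : ℝ) ^ (l : ℕ) else 0 := by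
    rw [Finset.mul_sum]
    refine (Finset.abs_sum_le_sum_abs _ _).trans (Finset.sum_le_sum fun l _ => ?_)
    split_ifs with hkl
    · have h2 : |C.slack K x l| ≤ 1 := by
        rw [slack_of_isKKTPoint hK hδ hx]
        have h3 := hx.1 (C.yIdx (C.gateVar l))
        have h4 := trunc_mem (C.form l fun i => x (C.yIdx i))
        exact abs_le.2 ⟨by linarith [h3.1, h4.2], by linarith [h3.2, h4.1]⟩
      have h5 := abs_weight_le hK l (C.gateVar k)
      rw [abs_mul, abs_mul, abs_of_pos (mul_pos two_pos (hpow _))]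
      calc 2 * (δ : ℝ) ^ ((l : ℕ) + 3) * |C.slack K x l| * |C.weight l (C.gateVar k)|
          ≤ 2 * (δ : ℝ) ^ ((l : ℕ) + 3) * 1 * K := by
            have := hpow ((l : ℕ) + 3)
            gcongr
        _ = 2 * (δ : ℝ) ^ 3 * K * (δ : ℝ) ^ (l : ℕ) := by ring
    · rw [weight_of_le, mul_zero, abs_zero, mul_zero]
      have := Fin.le_def.1 (not_lt.1 hkl)
      simp only [gateVar]
      omega
  have h2 := mul_le_mul_of_nonneg_left (sum_pow_later_le hδ0 hδ1 k)
    (show 0 ≤ 2 * (δ : ℝ) ^ 3 * K by positivity)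
  have h3 : (δ : ℝ) ^ (C.m + 3) * (if C.gateVar k = Fin.last (C.m + 1) then 1 else 0) ≤
      (δ : ℝ) ^ ((k : ℕ) + 4) := by
    have : (δ : ℝ) ^ (C.m + 3) ≤ (δ : ℝ) ^ ((k : ℕ) + 4) :=
      pow_le_pow_of_le_one hδ0.le (by linarith) (by omega)
    split_ifs
    · rwa [mul_one]
    · rw [mul_zero]
      exact (hpow _).le
  have h4 : 0 ≤ (δ : ℝ) ^ (C.m + 3) * (if C.gateVar k = Fin.last (C.m + 1) then (1 : ℝ) else 0) :=
    mul_nonneg (hpow _).le (by split_ifs <;> norm_num)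
  refine le_of_mul_le_mul_left ?_ (mul_pos two_pos (hpow ((k : ℕ) + 3)))
  have h6 : 2 * (δ : ℝ) ^ ((k : ℕ) + 3) * |C.gateError K δ x k| =
      |2 * (δ : ℝ) ^ ((k : ℕ) + 3) * C.gateError K δ x k| := by
    rw [abs_mul, abs_of_pos (mul_pos two_pos (hpow _))]
  rw [h6, pow_mul_gateError hδ, abs_neg, pow_mul_multiplier hδ]
  refine (abs_sub _ _).trans ?_
  rw [abs_of_nonneg h4]
  -- The later gates contribute `64/31` and the output at most `1`, which is less than `4`.
  have h8 : (δ : ℝ) ^ ((k : ℕ) + 4) ≤ K * (δ : ℝ) ^ ((k : ℕ) + 4) :=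
    le_mul_of_one_le_left (hpow _).le hK1
  have h9 : 2 * (δ : ℝ) ^ 3 * K * (32 / 31 * (δ : ℝ) ^ ((k : ℕ) + 1)) =
      64 / 31 * (K * (δ : ℝ) ^ ((k : ℕ) + 4)) := by ring
  have h10 : 2 * (δ : ℝ) ^ ((k : ℕ) + 3) * (2 * K * δ) = 4 * (K * (δ : ℝ) ^ ((k : ℕ) + 4)) := by ring
  rw [h10]
  linarith [hpow ((k : ℕ) + 4)]

/-- At a KKT point, the multipliers of the inputs form a generalized gradient. -/
theorem multiplier_mem_generalizedGradient (hK : C.IsGateBound K) (hδ : 0 < δ)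
    (hδ1 : (δ : ℝ) ≤ 1 / 32) {δ' : ℝ} (hδ' : 6 * (K : ℝ) ^ 2 * δ ≤ δ')
    (hx : IsKKTPoint (C.qpPoly K δ) x) :
    (![C.multiplier K δ x 0, C.multiplier K δ x 1] : Fin 2 → ℝ) ∈
      C.generalizedGradient δ' ![x (C.yIdx 0), x (C.yIdx 1)] := by
  have hδ0 : (0 : ℝ) < δ := by exact_mod_cast hδ
  have hK1 : (1 : ℝ) ≤ K := by exact_mod_cast hK.1
  have hB := abs_gateError_le hK hδ hδ1 hx
  have hBpos : 0 < 2 * K * (δ : ℝ) := by positivity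
  choose s hs hse hs0 hs1 using
    fun k => exists_slope (t := C.form k fun i => x (C.yIdx i)) (hB k) hBpos
  refine mem_generalizedGradient (y := fun i => x (C.yIdx i)) hK hB (gate_of_isKKTPoint hK hδ hx)
    hBpos.le (by linarith) hs hs0 hs1 fun i => ?_
  refine mul_left_cancel₀ (pow_pos hδ0 (C.m + 3)).ne' ?_
  rw [pow_mul_multiplier hδ, mul_add, sub_eq_add_neg, ← Finset.sum_neg_distrib, Finset.mul_sum]
  congr 1
  refine Finset.sum_congr rfl fun k _ => ?_
  rw [slack_of_isKKTPoint hK hδ hx, gate_of_isKKTPoint hK hδ hx, hse]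
  linear_combination (-s k * C.weight k i) * pow_mul_gateError (K := K) (x := x) hδ k

/-- No gate computes an input, so that its partial derivative is a multiple of its multiplier. -/
theorem aeval_pderiv_input (hδ : 0 < δ) {i : Fin (C.m + 2)} (hi : (i : ℕ) < 2) :
    MvPolynomial.aeval x (MvPolynomial.pderiv (C.yIdx i) (C.qpPoly K δ)) =
      (δ : ℝ) ^ (C.m + 3) * C.multiplier K δ x i := by
  rw [aeval_pderiv_yIdx, ← pow_mul_multiplier hδ, Finset.sum_eq_zero, add_zero]
  intro k _
  rw [if_neg]
  rintro rfl
  simp only [gateVar] at hi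
  omega

theorem multiplier_of_isKKTPoint (hδ : 0 < δ) (hx : IsKKTPoint (C.qpPoly K δ) x)
    {i : Fin (C.m + 2)} (hi : (i : ℕ) < 2) : (0 < x (C.yIdx i) → C.multiplier K δ x i ≤ 0) ∧
      (x (C.yIdx i) < 1 → 0 ≤ C.multiplier K δ x i) := by
  have hc : 0 < (δ : ℝ) ^ (C.m + 3) := pow_pos (Rat.cast_pos.2 hδ) _
  obtain ⟨h1, h2⟩ := hx.2 (C.yIdx i)
  rw [aeval_pderiv_input hδ hi] at h1 h2
  exact ⟨fun h => nonpos_of_mul_nonpos_right (h1 h) hc,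
    fun h => (mul_nonneg_iff_of_pos_left hc).1 (h2 h)⟩

end Circuit

/-- The first two coordinates of a KKT point of the quadratic program solve the instance. -/
theorem LinearInstance.isSolution_of_isKKTPoint (I : LinearInstance) {K : ℚ}
    (hK : I.circuit.IsGateBound K) {x : Fin (3 * I.circuit.m + 2) → ℝ} (hx : IsKKTPoint (I.qp K) x) :
    I.IsSolution ![x (I.circuit.yIdx 0), x (I.circuit.yIdx 1)] := by
  obtain ⟨hδ0, hδ1, hδ2⟩ := I.qpDelta_spec hK.1
  have hδ : 0 < I.qpDelta K := by exact_mod_cast hδ0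
  have hε : (0 : ℝ) < I.ε := by exact_mod_cast I.ε_pos
  have h6 : 6 * (K : ℝ) ^ 2 * I.qpDelta K ≤ I.δ := by nlinarith [sq_nonneg (K : ℝ)]
  have hkkt : ∀ i : Fin (I.circuit.m + 2), (i : ℕ) < 2 →
      (0 < x (I.circuit.yIdx i) → I.circuit.multiplier K (I.qpDelta K) x i ≤ I.ε) ∧
      (x (I.circuit.yIdx i) < 1 → -(I.ε : ℝ) ≤ I.circuit.multiplier K (I.qpDelta K) x i) := by
    intro i hi
    obtain ⟨h1, h2⟩ := Circuit.multiplier_of_isKKTPoint hδ hx hi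
    exact ⟨fun h => (h1 h).trans hε.le, fun h => (neg_nonpos.2 hε.le).trans (h2 h)⟩
  refine ⟨fun i => ?_, _, Circuit.multiplier_mem_generalizedGradient hK hδ hδ1 h6 hx, fun i => ?_⟩
  · fin_cases i
    · exact hx.1 _
    · exact hx.1 _
  · fin_cases i
    · exact hkkt 0 (by simp)
    · exact hkkt 1 (by simp)

open Turing StateTransition

/-! ### Structured programs on stacks -/

namespace StackProg

/-- The labels of the leaves of the trees that programs work on. -/
abbrev Letter := Γ' ⊕ Γ'

/-- The symbols on the working stacks: trees are written in prefix notation with `node` and `leaf`,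
and `mark` separates the entries of the auxiliary stacks. -/
inductive Sym
  | leaf (a : Letter)
  | node
  | mark
  deriving DecidableEq, Fintype

/-- The stacks of a program: input, output and four working stacks. -/
inductive Stack
  | inp
  | out
  | main
  | left
  | right
  | count
  deriving DecidableEq

instance : Fintype Stack :=
  ⟨{.inp, .out, .main, .left, .right, .count}, fun k => by cases k <;> simp⟩

/-- The alphabet of each stack, if the input is a word over `A`. -/
abbrev Alph (A : Type) : Stack → Type
  | .inp => A
  | .out => Γ'
  | .main => Sym
  | .left => Sym
  | .right => Sym
  | .count => Sym

/-- The contents of all stacks. -/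
structure Mem (A : Type) where
  main : List Sym
  left : List Sym
  right : List Sym
  count : List Sym
  inp : List A
  out : List Γ'

variable {A : Type}

/-- The contents of a given stack. -/
def Mem.get (S : Mem A) : (k : Stack) → List (Alph A k)
  | .inp => S.inp
  | .out => S.out
  | .main => S.main
  | .left => S.left
  | .right => S.right
  | .count => S.count

/-- Replaces the contents of a given stack. -/
def Mem.set (S : Mem A) : (k : Stack) → List (Alph A k) → Mem A
  | .inp, l => { S with inp := l }
  | .out, l => { S with out := l }
  | .main, l => { S with main := l }
  | .left, l => { S with left := l }
  | .right, l => { S with right := l }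
  | .count, l => { S with count := l }

theorem Mem.get_set (S : Mem A) (k : Stack) (l : List (Alph A k)) :
    (S.set k l).get = Function.update S.get k l := by
  funext j
  cases k <;> cases j <;> rfl

/-- The finite register of a program. -/
abbrev Reg := Option Sym

/-- Structured programs with a finite register, operating on the stacks. -/
inductive Prog (A : Type)
  | push (k : Stack) (f : Reg → Alph A k)
  | pop (k : Stack) (f : Reg → Option (Alph A k) → Reg)
  | load (f : Reg → Reg)
  | seq (P Q : Prog A)
  | ite (c : Reg → Bool) (P Q : Prog A)
  | loop (c : Reg → Bool) (P : Prog A)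

/-- `Exec P v S v' S' t`: started with register `v` and stacks `S`, the program `P` ends after at
most `t` steps with register `v'` and stacks `S'`. -/
inductive Exec : Prog A → Reg → Mem A → Reg → Mem A → ℕ → Prop
  | push {k f v S} : Exec (.push k f) v S v (S.set k (f v :: S.get k)) 1
  | pop {k f v S} : Exec (.pop k f) v S (f v (S.get k).head?) (S.set k (S.get k).tail) 1
  | load {f v S} : Exec (.load f) v S (f v) S 1
  | seq {P Q v S v' S' v'' S'' t t'} (h : Exec P v S v' S' t) (h' : Exec Q v' S' v'' S'' t') :
      Exec (.seq P Q) v S v'' S'' (t + t')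
  | ite_true {c P Q v S v' S' t} (hc : c v = true) (h : Exec P v S v' S' t) :
      Exec (.ite c P Q) v S v' S' (t + 1)
  | ite_false {c P Q v S v' S' t} (hc : c v = false) (h : Exec Q v S v' S' t) :
      Exec (.ite c P Q) v S v' S' (t + 1)
  | loop_false {c P v S} (hc : c v = false) : Exec (.loop c P) v S v S 1
  | loop_true {c P v S v' S' v'' S'' t t'} (hc : c v = true) (h : Exec P v S v' S' t)
      (h' : Exec (.loop c P) v' S' v'' S'' t') : Exec (.loop c P) v S v'' S'' (t + t' + 1)
  | mono {P v S v' S' t t'} (h : Exec P v S v' S' t) (ht : t ≤ t') : Exec P v S v' S' t'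

/-- One step pushes at most one symbol, so that a time bound is also a bound for the output. -/
theorem Exec.length_main_le {P : Prog A} {v S v' S' t} (h : Exec P v S v' S' t) :
    S'.main.length ≤ S.main.length + t := by
  induction h with
  | @push k f v S => cases k <;> simp [Mem.set, Mem.get]
  | @pop k f v S => cases k <;> simp [Mem.set, Mem.get]; omega
  | _ => omega

/-! ### Compilation to Turing machines -/

namespace Prog

/-- The labels of the compiled program. -/
def Lab : Prog A → Type
  | push _ _ => Unit
  | pop _ _ => Unit
  | load _ => Unit
  | seq P Q => P.Lab ⊕ Q.Lab
  | ite _ P Q => Option (P.Lab ⊕ Q.Lab)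
  | loop _ P => Option P.Lab

instance fintypeLab : (P : Prog A) → Fintype P.Lab
  | push _ _ => inferInstanceAs (Fintype Unit)
  | pop _ _ => inferInstanceAs (Fintype Unit)
  | load _ => inferInstanceAs (Fintype Unit)
  | seq P Q => by
    have := fintypeLab P
    have := fintypeLab Q
    exact inferInstanceAs (Fintype (P.Lab ⊕ Q.Lab))
  | ite _ P Q => by
    have := fintypeLab P
    have := fintypeLab Q
    exact inferInstanceAs (Fintype (Option (P.Lab ⊕ Q.Lab)))
  | loop _ P => by
    have := fintypeLab P
    exact inferInstanceAs (Fintype (Option P.Lab))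

/-- The label where the compiled program starts. -/
def entry : (P : Prog A) → P.Lab
  | push _ _ => ()
  | pop _ _ => ()
  | load _ => ()
  | seq P _ => Sum.inl P.entry
  | ite _ _ _ => none
  | loop _ _ => none

/-- The compiled program, whose labels are embedded into `Λ` by `emb`, and which jumps to `ex` when
it ends. -/
def code {Λ : Type} : (P : Prog A) → (P.Lab → Λ) → Λ → P.Lab → TM2.Stmt (Alph A) Λ Reg
  | push k f, _, ex, _ => .push k f (.goto fun _ => ex)
  | pop k f, _, ex, _ => .pop k f (.goto fun _ => ex)
  | load f, _, ex, _ => .load f (.goto fun _ => ex)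
  | seq P Q, emb, _, .inl l => P.code (fun l => emb (.inl l)) (emb (.inr Q.entry)) l
  | seq _ Q, emb, ex, .inr l => Q.code (fun l => emb (.inr l)) ex l
  | ite c P Q, emb, _, none =>
    .branch c (.goto fun _ => emb (some (.inl P.entry))) (.goto fun _ => emb (some (.inr Q.entry)))
  | ite _ P _, emb, ex, some (.inl l) => P.code (fun l => emb (some (.inl l))) ex l
  | ite _ _ Q, emb, ex, some (.inr l) => Q.code (fun l => emb (some (.inr l))) ex l
  | loop c P, emb, ex, none =>
    .branch c (.goto fun _ => emb (some P.entry)) (.goto fun _ => ex)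
  | loop _ P, emb, _, some l => P.code (fun l => emb (some l)) (emb none) l

end Prog

theorem evalsToInTime_step {σ : Type*} {f : σ → Option σ} {a b : σ} (h : f a = some b) :
    Nonempty (EvalsToInTime f a (some b) 1) :=
  ⟨⟨⟨1, by simpa [flip] using h⟩, le_rfl⟩⟩

theorem evalsToInTime_trans {σ : Type*} {f : σ → Option σ} {a b : σ} {c : Option σ} {m n k : ℕ}
    (h : Nonempty (EvalsToInTime f a (some b) m)) (h' : Nonempty (EvalsToInTime f b c n))
    (hk : m + n ≤ k) : Nonempty (EvalsToInTime f a c k) := by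
  obtain ⟨h⟩ := h
  obtain ⟨h'⟩ := h'
  have h'' := EvalsToInTime.trans f m n a b c h h'
  exact ⟨⟨h''.toEvalsTo, h''.steps_le_m.trans (by omega)⟩⟩

/-- The compiled program does what the program does, in the same time. -/
theorem Exec.evalsToInTime {P : Prog A} {v S v' S' t} (h : Exec P v S v' S' t) {Λ : Type}
    (M : Λ → TM2.Stmt (Alph A) Λ Reg) (emb : P.Lab → Λ) (ex : Λ)
    (hM : ∀ l, M (emb l) = P.code emb ex l) :
    Nonempty (EvalsToInTime (TM2.step M) ⟨some (emb P.entry), v, S.get⟩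
      (some ⟨some ex, v', S'.get⟩) t) := by
  induction h generalizing ex with
  | push =>
    apply evalsToInTime_step
    simp [hM, Prog.code, Mem.get_set]
  | pop =>
    apply evalsToInTime_step
    simp [hM, Prog.code, Mem.get_set]
  | load =>
    apply evalsToInTime_step
    simp [hM, Prog.code]
  | @seq P Q _ _ _ _ _ _ _ _ _ _ ih ih' =>
    exact evalsToInTime_trans (ih (fun l => emb (.inl l)) (emb (.inr Q.entry)) fun l => hM (.inl l))
      (ih' (fun l => emb (.inr l)) ex fun l => hM (.inr l)) le_rfl
  | @ite_true c P Q v S _ _ _ hc _ ih =>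
    refine evalsToInTime_trans (evalsToInTime_step
      (b := ⟨some (emb (some (.inl P.entry))), v, S.get⟩) ?_)
      (ih (fun l => emb (some (.inl l))) ex fun l => hM (some (.inl l))) (by omega)
    rw [Prog.entry, TM2.step, hM none]
    simp [Prog.code, hc]
  | @ite_false c P Q v S _ _ _ hc _ ih =>
    refine evalsToInTime_trans (evalsToInTime_step
      (b := ⟨some (emb (some (.inr Q.entry))), v, S.get⟩) ?_)
      (ih (fun l => emb (some (.inr l))) ex fun l => hM (some (.inr l))) (by omega)
    rw [Prog.entry, TM2.step, hM none]
    simp [Prog.code, hc]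
  | loop_false hc =>
    apply evalsToInTime_step
    rw [Prog.entry, TM2.step, hM none]
    simp [Prog.code, hc]
  | @loop_true c P v S _ _ _ _ _ _ hc _ _ ih ih' =>
    refine evalsToInTime_trans (evalsToInTime_step
      (b := ⟨some (emb (some P.entry)), v, S.get⟩) ?_)
      (evalsToInTime_trans (ih (fun l => emb (some l)) (emb none) fun l => hM (some l))
        (ih' emb ex hM) le_rfl) (by omega)
    rw [Prog.entry, TM2.step, hM none]
    simp [Prog.code, hc]
  | mono _ ht ih => exact evalsToInTime_trans ⟨.refl _ _⟩ (ih emb ex hM) (by omega)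

/-- The Turing machine of a program. The register is empty at the start. -/
def Prog.toTM [Fintype A] (P : Prog A) : FinTM2 where
  K := Stack
  k₀ := .inp
  k₁ := .out
  Γ := Alph A
  Λ := Option P.Lab
  main := some P.entry
  σ := Reg
  initialState := none
  Γk₀Fin := inferInstanceAs (Fintype A)
  m
    | none => .halt
    | some l => P.code some none l

/-- The memory with all stacks empty but the input and output stacks. -/
def Mem.io (x : List A) (y : List Γ') : Mem A := ⟨[], [], [], [], x, y⟩

/-- A program that moves from the code word of `x` on the input stack to the code word of `f x` on
the output stack, in polynomially many steps, yields a Turing machine for `f`. -/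
theorem computable_of_exec [Fintype A] {α β : Type} {ea : α → List A} {eb : β → List Γ'}
    {f : α → β} (P : Prog A) (p : Polynomial ℕ)
    (h : ∀ x, Exec P none (.io (ea x) []) none (.io [] (eb (f x))) (p.eval (ea x).length)) :
    Nonempty (TM2ComputableInPolyTime ea eb f) := by
  refine ⟨⟨⟨P.toTM, Equiv.refl A, Equiv.refl Γ'⟩, p + 1, fun x => Classical.choice ?_⟩⟩
  have h1 := (h x).evalsToInTime P.toTM.m some none (fun _ => rfl)
  have hinit : initList P.toTM ((ea x).map (Equiv.refl A).invFun) =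
      ⟨some (some P.entry), none, (Mem.io (ea x) []).get⟩ := by
    refine congrArg (TM2.Cfg.mk (some (some P.entry)) (none : Reg)) (funext fun k => ?_)
    cases k <;> first | rfl | exact List.map_id _
  have hhalt : haltList P.toTM ((eb (f x)).map (Equiv.refl Γ').invFun) =
      ⟨none, none, (Mem.io [] (eb (f x))).get⟩ := by
    refine congrArg (TM2.Cfg.mk none (none : Reg)) (funext fun k => ?_)
    cases k <;> first | rfl | exact List.map_id _
  have h2 : Nonempty (EvalsToInTime P.toTM.step
      (initList P.toTM ((ea x).map (Equiv.refl A).invFun))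
      (some (haltList P.toTM ((eb (f x)).map (Equiv.refl Γ').invFun)))
      ((p + 1).eval (ea x).length)) := by
    rw [hinit, hhalt]
    exact evalsToInTime_trans h1 (evalsToInTime_step rfl) (by simp)
  exact h2

end StackProg

namespace StackProg

/-! ### Trees on stacks -/

/-- Binary trees with labelled leaves: the data that programs work on. -/
inductive Tree
  | leaf (a : Letter)
  | node (x y : Tree)

namespace Tree

/-- Prefix notation of a tree. -/
def code : Tree → List Sym
  | leaf a => [.leaf a]
  | node x y => .node :: (x.code ++ y.code)

/-- The number of nodes and leaves. -/
def size : Tree → ℕ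
  | leaf _ => 1
  | node x y => x.size + y.size + 1

@[simp] theorem length_code (x : Tree) : x.code.length = x.size := by
  induction x with
  | leaf => rfl
  | node x y hx hy => simp [code, size, hx, hy]

theorem mark_notMem_code (x : Tree) : Sym.mark ∉ x.code := by
  induction x <;> simp_all [code]

theorem size_pos (x : Tree) : 0 < x.size := by
  cases x <;> simp [size]

end Tree

variable {A : Type}

namespace Prog

/-- Pushes a fixed symbol on the main stack. -/
def pushMain (s : Sym) : Prog A := .push .main fun _ => s

/-- Pushes the symbol in the register on the main stack. -/
def pushReg : Prog A := .push .main fun v => v.getD .mark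

/-- Pops the main stack into the register. -/
def popReg : Prog A := .pop .main fun _ s => s

/-- Clears the register. -/
def clear : Prog A := .load fun _ => none

/-- Moves one symbol of a tree from the main stack to both auxiliary stacks, and updates the
stack that holds one `node` for every further subtree to be read. -/
def readSym : Prog A :=
  .seq popReg <| .seq (.push .left fun v => v.getD .mark) <|
    .seq (.push .right fun v => v.getD .mark) <|
    .seq (.ite (fun v => v == some .node)
      (.seq (.push .count fun _ => .node) (.push .count fun _ => .node)) (.load id)) <|
    .pop .count fun _ s => s

/-- Moves a tree from the main stack to both auxiliary stacks, reversing its code. -/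
def read : Prog A :=
  .seq (.push .left fun _ => .mark) <| .seq (.push .right fun _ => .mark) <|
    .seq (.push .count fun _ => .mark) <| .seq (.load fun _ => some .node) <|
    .seq (.loop (fun v => v == some .node) readSym) clear

/-- Moves the symbols above the first mark on the left stack back to the main stack. -/
def pourLeft : Prog A :=
  .seq (.pop .left fun _ s => s) <|
    .seq (.loop (fun v => v != some .mark) (.seq pushReg (.pop .left fun _ s => s))) clear

/-- Moves the symbols above the first mark on the right stack back to the main stack. -/
def pourRight : Prog A :=
  .seq (.pop .right fun _ s => s) <|
    .seq (.loop (fun v => v != some .mark) (.seq pushReg (.pop .right fun _ s => s))) clear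

/-- Deletes the symbols above the first mark on the left stack, and the mark. -/
def dropLeft : Prog A :=
  .seq (.pop .left fun _ s => s) <|
    .seq (.loop (fun v => v != some .mark) (.pop .left fun _ s => s)) clear

/-- Deletes the symbols above the first mark on the right stack, and the mark. -/
def dropRight : Prog A :=
  .seq (.pop .right fun _ s => s) <|
    .seq (.loop (fun v => v != some .mark) (.pop .right fun _ s => s)) clear

end Prog

open Prog

theorem exec_readSym_leaf (a : Letter) (m l r c : List Sym) (i : List A) (o : List Γ') (v : Reg) :
    Exec readSym v ⟨.leaf a :: m, l, r, c, i, o⟩ c.head?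
      ⟨m, .leaf a :: l, .leaf a :: r, c.tail, i, o⟩ 6 :=
  .seq .pop (.seq .push (.seq .push (.seq (.ite_false (by rfl) .load) .pop)))

theorem exec_readSym_node (m l r c : List Sym) (i : List A) (o : List Γ') (v : Reg) :
    Exec readSym v ⟨.node :: m, l, r, c, i, o⟩ (some .node)
      ⟨m, .node :: l, .node :: r, .node :: c, i, o⟩ 7 :=
  .seq .pop (.seq .push (.seq .push (.seq (.ite_true (by rfl) (.seq .push .push)) .pop)))

/-- The loop of `read` started on a tree `x`: the `node` in the register announces that a subtree is
to be read, and after `x` the loop goes on with the symbol that is popped from `c`. -/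
theorem exec_readSym_loop (x : Tree) {m l r c i o v' t} {S' : Mem A}
    (h : Exec (.loop (fun v => v == some .node) readSym) c.head?
      ⟨m, x.code.reverse ++ l, x.code.reverse ++ r, c.tail, i, o⟩ v' S' t) :
    Exec (.loop (fun v => v == some .node) readSym) (some .node)
      ⟨x.code ++ m, l, r, c, i, o⟩ v' S' (8 * x.size + t) := by
  induction x generalizing m l r c t with
  | leaf a =>
    exact .mono (.loop_true (by simp) (exec_readSym_leaf a m l r c i o _) h)
      (by simp only [Tree.size]; omega)
  | node x y hx hy =>
    simp only [Tree.code, List.reverse_cons, List.reverse_append, List.append_assoc,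
      List.cons_append, List.nil_append] at h ⊢
    exact .mono (.loop_true (by simp) (exec_readSym_node (x.code ++ (y.code ++ m)) l r c i o _)
      (hx (c := .node :: c) (hy h))) (by simp only [Tree.size]; omega)

theorem exec_read (x : Tree) (m l r c : List Sym) (i : List A) (o : List Γ') :
    Exec read none ⟨x.code ++ m, l, r, c, i, o⟩ none
      ⟨m, x.code.reverse ++ .mark :: l, x.code.reverse ++ .mark :: r, c, i, o⟩
      (8 * x.size + 6) := by
  -- Without further subtrees, the loop pops the mark and stops.
  refine .mono (.seq .push (.seq .push (.seq .push (.seq .load (.seq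
    (exec_readSym_loop (c := .mark :: c) x (.loop_false ?_)) .load))))) ?_
  · simp
  · omega

theorem exec_pourLeft {w : List Sym} (hw : .mark ∉ w) (m l r c : List Sym) (i : List A)
    (o : List Γ') : Exec pourLeft none ⟨m, w ++ .mark :: l, r, c, i, o⟩ none
      ⟨w.reverse ++ m, l, r, c, i, o⟩ (3 * w.length + 3) := by
  have h : Exec (.loop (fun v => v != some .mark) (.seq pushReg (.pop .left fun _ s => s)))
      (w ++ .mark :: l).head? ⟨m, (w ++ .mark :: l).tail, r, c, i, o⟩
      (some .mark) ⟨w.reverse ++ m, l, r, c, i, o⟩ (3 * w.length + 1) := by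
    induction w generalizing m with
    | nil => exact .loop_false (by simp)
    | cons a w ih =>
      simp only [List.mem_cons, not_or] at hw
      refine .mono (.loop_true ?_ (.seq .push .pop) ?_) (t := 2 + (3 * w.length + 1) + 1) ?_
      · simp [Ne.symm hw.1]
      · rw [List.reverse_cons, List.append_assoc]
        exact ih hw.2 (a :: m)
      · simp; omega
  exact .mono (.seq .pop (.seq h .load)) (by omega)

theorem exec_pourRight {w : List Sym} (hw : .mark ∉ w) (m l r c : List Sym) (i : List A)
    (o : List Γ') : Exec pourRight none ⟨m, l, w ++ .mark :: r, c, i, o⟩ none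
      ⟨w.reverse ++ m, l, r, c, i, o⟩ (3 * w.length + 3) := by
  have h : Exec (.loop (fun v => v != some .mark) (.seq pushReg (.pop .right fun _ s => s)))
      (w ++ .mark :: r).head? ⟨m, l, (w ++ .mark :: r).tail, c, i, o⟩
      (some .mark) ⟨w.reverse ++ m, l, r, c, i, o⟩ (3 * w.length + 1) := by
    induction w generalizing m with
    | nil => exact .loop_false (by simp)
    | cons a w ih =>
      simp only [List.mem_cons, not_or] at hw
      refine .mono (.loop_true ?_ (.seq .push .pop) ?_) (t := 2 + (3 * w.length + 1) + 1) ?_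
      · simp [Ne.symm hw.1]
      · rw [List.reverse_cons, List.append_assoc]
        exact ih hw.2 (a :: m)
      · simp; omega
  exact .mono (.seq .pop (.seq h .load)) (by omega)

theorem exec_dropLeft {w : List Sym} (hw : .mark ∉ w) (m l r c : List Sym) (i : List A)
    (o : List Γ') : Exec dropLeft none ⟨m, w ++ .mark :: l, r, c, i, o⟩ none
      ⟨m, l, r, c, i, o⟩ (3 * w.length + 3) := by
  have h : Exec (.loop (fun v => v != some .mark) (.pop .left fun _ s => s))
      (w ++ .mark :: l).head? ⟨m, (w ++ .mark :: l).tail, r, c, i, o⟩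
      (some .mark) ⟨m, l, r, c, i, o⟩ (3 * w.length + 1) := by
    induction w with
    | nil => exact .loop_false (by simp)
    | cons a w ih =>
      simp only [List.mem_cons, not_or] at hw
      refine .mono (.loop_true ?_ .pop ?_) (t := 1 + (3 * w.length + 1) + 1) ?_
      · simp [Ne.symm hw.1]
      · exact ih hw.2
      · simp; omega
  exact .mono (.seq .pop (.seq h .load)) (by omega)

theorem exec_dropRight {w : List Sym} (hw : .mark ∉ w) (m l r c : List Sym) (i : List A)
    (o : List Γ') : Exec dropRight none ⟨m, l, w ++ .mark :: r, c, i, o⟩ none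
      ⟨m, l, r, c, i, o⟩ (3 * w.length + 3) := by
  have h : Exec (.loop (fun v => v != some .mark) (.pop .right fun _ s => s))
      (w ++ .mark :: r).head? ⟨m, l, (w ++ .mark :: r).tail, c, i, o⟩
      (some .mark) ⟨m, l, r, c, i, o⟩ (3 * w.length + 1) := by
    induction w with
    | nil => exact .loop_false (by simp)
    | cons a w ih =>
      simp only [List.mem_cons, not_or] at hw
      refine .mono (.loop_true ?_ .pop ?_) (t := 1 + (3 * w.length + 1) + 1) ?_
      · simp [Ne.symm hw.1]
      · exact ih hw.2
      · simp; omega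
  exact .mono (.seq .pop (.seq h .load)) (by omega)

namespace Prog

/-- In at most `t` steps, the program replaces the word `u` on top of the main stack by `w`. All
other stacks have the same contents before and after, whatever it is. -/
def Maps (P : Prog A) (u w : List Sym) (t : ℕ) : Prop :=
  ∀ m l r c i o, Exec P none ⟨u ++ m, l, r, c, i, o⟩ none ⟨w ++ m, l, r, c, i, o⟩ t

theorem Maps.seq {P Q : Prog A} {u v w s t} (h : P.Maps u v s) (h' : Q.Maps v w t) :
    (Prog.seq P Q).Maps u w (s + t) := fun m l r c i o =>
  .seq (h m l r c i o) (h' m l r c i o)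

theorem Maps.mono {P : Prog A} {u w s t} (h : P.Maps u w s) (hst : s ≤ t) : P.Maps u w t :=
  fun m l r c i o => .mono (h m l r c i o) hst

theorem Maps.append {P : Prog A} {u w s} (h : P.Maps u w s) (v : List Sym) :
    P.Maps (u ++ v) (w ++ v) s := fun m l r c i o => by
  simpa using h (v ++ m) l r c i o

theorem maps_pushMain (s : Sym) : (pushMain s : Prog A).Maps [] [s] 1 :=
  fun _ _ _ _ _ _ => .push

/-- Deletes the symbol on top of the main stack. -/
def popMain : Prog A := .pop .main fun _ _ => none

/-- Deletes the tree on top of the main stack. -/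
def drop : Prog A := .seq read (.seq dropLeft dropRight)

theorem maps_drop (x : Tree) : (drop : Prog A).Maps x.code [] (14 * x.size + 12) :=
  fun m l r c i o => .mono (.seq (exec_read x m l r c i o)
    (.seq (exec_dropLeft (by simpa using x.mark_notMem_code) _ _ _ _ _ _)
      (exec_dropRight (by simpa using x.mark_notMem_code) _ _ _ _ _ _))) (by simp; omega)

/-- Duplicates the tree on top of the main stack. -/
def dup : Prog A := .seq read (.seq pourLeft pourRight)

theorem maps_dup (x : Tree) : (dup : Prog A).Maps x.code (x.code ++ x.code) (14 * x.size + 12) :=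
  fun m l r c i o => by
    have hx : Sym.mark ∉ x.code.reverse := by simpa using x.mark_notMem_code
    have h := Exec.seq (exec_read x m l r c i o) (.seq (exec_pourLeft hx m l _ c i o)
      (exec_pourRight hx _ l r c i o))
    simp only [List.reverse_reverse, List.length_reverse, Tree.length_code,
      ← List.append_assoc] at h
    exact h.mono (by omega)

/-- Exchanges the two topmost trees on the main stack. -/
def swap : Prog A :=
  .seq read (.seq dropRight (.seq read (.seq dropLeft (.seq pourLeft pourRight))))

theorem maps_swap (x y : Tree) : (swap : Prog A).Maps (x.code ++ y.code) (y.code ++ x.code)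
    (14 * (x.size + y.size) + 24) := fun m l r c i o => by
  have hx : Sym.mark ∉ x.code.reverse := by simpa using x.mark_notMem_code
  have hy : Sym.mark ∉ y.code.reverse := by simpa using y.mark_notMem_code
  have h := Exec.seq (exec_read x (y.code ++ m) l r c i o) (.seq (exec_dropRight hx _ _ r c i o)
    (.seq (exec_read y m _ r c i o) (.seq (exec_dropLeft hy _ _ _ c i o)
      (.seq (exec_pourLeft hx _ l _ c i o) (exec_pourRight hy _ l r c i o)))))
  simp only [List.reverse_reverse, List.length_reverse, Tree.length_code,
    ← List.append_assoc] at h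
  exact h.mono (by omega)

end Prog
end StackProg

namespace StackProg

/-! ### Polynomial-time functions on encoded data -/

/-- A representation of the elements of `α` by trees. -/
class Enc (α : Type) where
  /-- The tree that represents an element. -/
  tr : α → Tree

open Enc

variable {α β γ δ σ : Type} [Enc α] [Enc β] [Enc γ] [Enc δ] [Enc σ]

/-- The size of the representation. -/
def sz (x : α) : ℕ := (tr x).size

/-- A function is polynomial-time computable if some program replaces the code of any argument on
top of the main stack by the code of its value, in time polynomial in the size of the argument. The
program must work whatever the input alphabet `A` of the machine is. -/
@[fun_prop]
def PT (f : α → β) : Prop :=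
  ∀ A : Type, ∃ (P : Prog A) (p : Polynomial ℕ),
    ∀ x, P.Maps (tr x).code (tr (f x)).code (p.eval (sz x))

theorem eval_mono (p : Polynomial ℕ) {m n : ℕ} (h : m ≤ n) : p.eval m ≤ p.eval n := by
  rw [Polynomial.eval_eq_sum, Polynomial.eval_eq_sum]
  exact Finset.sum_le_sum fun i _ => Nat.mul_le_mul_left _ (Nat.pow_le_pow_left h i)

theorem PT.sz_le {f : α → β} (hf : PT f) : ∃ q : Polynomial ℕ, ∀ x, sz (f x) ≤ q.eval (sz x) := by
  obtain ⟨P, p, h⟩ := hf Γ'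
  refine ⟨.X + p, fun x => ?_⟩
  have := (h x [] [] [] [] [] []).length_main_le
  simpa [sz] using this

/-- A program that computes `f` also computes any `g` that acts on representing trees as `f` does. -/
theorem PT.of_tr_eq {f : α → β} {g : γ → δ} (hf : PT f) (e : γ → α) (he : ∀ x, tr (e x) = tr x)
    (h : ∀ x, tr (g x) = tr (f (e x))) : PT g := fun A => by
  obtain ⟨P, p, hP⟩ := hf A
  refine ⟨P, p, fun x => ?_⟩
  have := hP (e x)
  rwa [sz, he, ← h] at this

@[fun_prop]
theorem PT.id : PT (fun x : α => x) := fun _ =>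
  ⟨.clear, 1, fun _ _ _ _ _ _ _ => .mono .load (by simp)⟩

theorem PT.comp {g : β → γ} {f : α → β} (hg : PT g) (hf : PT f) : PT fun x => g (f x) := fun A => by
  obtain ⟨q, hq⟩ := hf.sz_le
  obtain ⟨P, p, hP⟩ := hf A
  obtain ⟨P', p', hP'⟩ := hg A
  refine ⟨.seq P P', p + p'.comp q, fun x => ((hP x).seq (hP' (f x))).mono ?_⟩
  simpa using eval_mono p' (hq x)

attribute [fun_prop] PT.comp

instance : Enc Tree := ⟨fun x => x⟩

instance : Enc (α × β) := ⟨fun x => .node (tr x.1) (tr x.2)⟩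

@[simp] theorem sz_prod (x : α × β) : sz x = sz x.1 + sz x.2 + 1 := rfl

theorem sz_mk (a : α) (b : β) : sz (a, b) = sz a + sz b + 1 := rfl

@[fun_prop]
theorem PT.prodMk {f : α → β} {g : α → γ} (hf : PT f) (hg : PT g) :
    PT fun x => (f x, g x) := fun A => by
  obtain ⟨q, hq⟩ := hf.sz_le
  obtain ⟨r, hr⟩ := hg.sz_le
  obtain ⟨P, p, hP⟩ := hf A
  obtain ⟨P', p', hP'⟩ := hg A
  refine ⟨.seq .dup (.seq P (.seq .swap (.seq P' (.seq .swap (.pushMain .node))))),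
    14 * .X + 12 + p + (14 * (q + .X) + 24) + p' + (14 * (q + r) + 24) + 1, fun x => ?_⟩
  refine ((Prog.maps_dup _).seq (((hP x).append _).seq ((Prog.maps_swap _ _).seq
    (((hP' x).append _).seq ((Prog.maps_swap _ _).seq
      ((Prog.maps_pushMain .node).append _)))))).mono ?_
  have h1 := hq x
  have h2 := hr x
  simp only [sz] at h1 h2 ⊢
  simp
  omega

/-- Pushes a word on the main stack. -/
def Prog.pushWord {A : Type} : List Sym → Prog A
  | [] => .clear
  | s :: w => .seq (pushWord w) (.pushMain s)

theorem Prog.maps_pushWord {A : Type} (w : List Sym) :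
    (pushWord w : Prog A).Maps [] w (w.length + 1) := by
  induction w with
  | nil => exact fun _ _ _ _ _ _ => .load
  | cons s w ih => exact ih.seq ((maps_pushMain s).append w)

@[fun_prop]
theorem PT.const (y : β) : PT fun _ : α => y := fun A =>
  ⟨.seq .drop (.pushWord (tr y).code), 14 * .X + 12 + (Polynomial.C (sz y) + 1), fun x =>
    ((Prog.maps_drop _).seq (Prog.maps_pushWord _)).mono (by simp [sz])⟩

/-- The left subtree (of a leaf, the leaf itself). -/
def Tree.fst : Tree → Tree
  | leaf a => leaf a
  | node x _ => x

/-- The right subtree (of a leaf, the leaf itself). -/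
def Tree.snd : Tree → Tree
  | leaf a => leaf a
  | node _ y => y

/-- Replaces the tree on top of the main stack by its left subtree. -/
def Prog.fst {A : Type} : Prog A :=
  .seq .popReg (.ite (fun v => v == some .node) (.seq .clear (.seq .swap .drop))
    (.seq .pushReg .clear))

/-- Replaces the tree on top of the main stack by its right subtree. -/
def Prog.snd {A : Type} : Prog A :=
  .seq .popReg (.ite (fun v => v == some .node) (.seq .clear .drop) (.seq .pushReg .clear))

theorem PT.treeFst : PT Tree.fst := fun A => by
  refine ⟨.fst, 28 * .X + 40, fun x m l r c i o => ?_⟩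
  cases x with
  | leaf a => exact .mono (.seq .pop (.ite_false (by rfl) (.seq .push .load))) (by simp)
  | node x y =>
    have h := ((Prog.maps_swap (A := A) x y).seq ((Prog.maps_drop y).append x.code)) m l r c i o
    exact .mono (.seq .pop (.ite_true (by rfl) (.seq .load h)))
      (by simp [sz, tr, Tree.size]; omega)

theorem PT.treeSnd : PT Tree.snd := fun A => by
  refine ⟨.snd, 14 * .X + 40, fun x m l r c i o => ?_⟩
  cases x with
  | leaf a => exact .mono (.seq .pop (.ite_false (by rfl) (.seq .push .load))) (by simp)
  | node x y =>
    have h := ((Prog.maps_drop x).append (A := A) y.code) m l r c i o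
    exact .mono (.seq .pop (.ite_true (by rfl) (.seq .load h)))
      (by simp [sz, tr, Tree.size]; omega)

theorem PT.prodFst : PT (Prod.fst : α × β → α) :=
  PT.of_tr_eq PT.treeFst tr (fun _ => rfl) fun _ => rfl

theorem PT.prodSnd : PT (Prod.snd : α × β → β) :=
  PT.of_tr_eq PT.treeSnd tr (fun _ => rfl) fun _ => rfl

@[fun_prop]
theorem PT.fst {f : α → β × γ} (hf : PT f) : PT fun x => (f x).1 := PT.prodFst.comp hf

@[fun_prop]
theorem PT.snd {f : α → β × γ} (hf : PT f) : PT fun x => (f x).2 := PT.prodSnd.comp hf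

/-- The first symbol of the code of a tree. -/
def Tree.head : Tree → Sym
  | leaf a => .leaf a
  | node _ _ => .node

theorem Tree.exists_code (x : Tree) : ∃ w, x.code = x.head :: w := by
  cases x <;> exact ⟨_, rfl⟩

/-- Runs `P` or `Q`, depending on the first symbol of the left subtree. -/
def Prog.branch {A : Type} (c : Sym → Bool) (P Q : Prog A) : Prog A :=
  .seq .popReg (.seq .popReg (.seq .pushReg (.seq (.pushMain .node)
    (.ite (fun v => c (v.getD .mark)) (.seq .clear P) (.seq .clear Q)))))

/-- A distinction of cases by the first symbol of the code of the first component. -/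
theorem PT.branch (c : Sym → Bool) {f g : α × β → γ} (hf : PT f) (hg : PT g) :
    PT fun x => if c (tr x.1).head then f x else g x := fun A => by
  obtain ⟨P, p, hP⟩ := hf A
  obtain ⟨Q, q, hQ⟩ := hg A
  refine ⟨.branch c P Q, p + q + 6, fun x m l r d i o => ?_⟩
  obtain ⟨w, hw⟩ := (tr x.1).exists_code
  have hx : (tr x).code = .node :: (tr x.1).head :: (w ++ (tr x.2).code) := by
    change Sym.node :: ((tr x.1).code ++ (tr x.2).code) = _
    rw [hw]
    rfl
  have h1 := hP x m l r d i o
  have h2 := hQ x m l r d i o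
  rw [hx] at h1 h2 ⊢
  cases h : c (tr x.1).head with
  | true =>
    beta_reduce
    rw [if_pos h]
    exact .mono (.seq .pop (.seq .pop (.seq .push (.seq .push (.ite_true h
      (.seq .load h1)))))) (by simp; omega)
  | false =>
    beta_reduce
    rw [if_neg (by simp [h])]
    exact .mono (.seq .pop (.seq .pop (.seq .push (.seq .push (.ite_false h
      (.seq .load h2)))))) (by simp; omega)

/-- A distinction of cases by the first symbol of the code. -/
theorem PT.ite_head (c : Sym → Bool) {f g : α → γ} (hf : PT f) (hg : PT g) :
    PT fun x => if c (tr x).head then f x else g x :=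
  (PT.branch c (hf.comp PT.prodFst) (hg.comp PT.prodFst)).comp (PT.id.prodMk PT.id)

instance : Enc Letter := ⟨.leaf⟩

instance : Enc Γ' := ⟨fun a => .leaf (.inl a)⟩

instance : Enc Bool := ⟨fun b => .leaf (.inl (.bit b))⟩

@[simp] theorem sz_bool (b : Bool) : sz b = 1 := rfl

@[simp] theorem sz_letter (b : Letter) : sz b = 1 := rfl

/-- Functions on a finite type whose elements are leaves: finitely many cases are distinguished. -/
theorem PT.of_letter [Fintype α] [DecidableEq α] (e : α → Letter) (he : Function.Injective e)
    (htr : ∀ x, tr x = .leaf (e x)) (f : α → β) : PT f := by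
  rcases isEmpty_or_nonempty α with h | ⟨⟨d⟩⟩
  · exact fun A => ⟨.clear, 0, fun x => h.elim x⟩
  have h : ∀ l : List α, PT fun x => if x ∈ l then f x else f d := by
    intro l
    induction l with
    | nil => simpa using PT.const (f d)
    | cons a l ih =>
      convert PT.ite_head (fun s => s == .leaf (e a)) (PT.const (f a)) ih using 2 with x
      by_cases hx : x = a
      · simp [hx, htr, Tree.head]
      · simp [hx, htr, Tree.head, he.eq_iff]
  simpa using h Finset.univ.toList

theorem PT.of_letter_sum (f : Letter → β) : PT f :=
  PT.of_letter (fun x => x) Function.injective_id (fun _ => rfl) f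

theorem PT.of_symbol (f : Γ' → β) : PT f := PT.of_letter .inl Sum.inl_injective (fun _ => rfl) f

theorem PT.of_bool (f : Bool → β) : PT f :=
  PT.of_letter (fun b => .inl (.bit b)) (fun a b h => by simpa using h) (fun _ => rfl) f

@[fun_prop]
theorem PT.symbol_bit {f : α → Bool} (hf : PT f) : PT fun x => Γ'.bit (f x) :=
  (PT.of_bool Γ'.bit).comp hf

@[fun_prop]
theorem PT.ite_bool {b : α → Bool} {f g : α → β} (hb : PT b) (hf : PT f) (hg : PT g) :
    PT fun x => if b x = true then f x else g x := by
  convert (PT.branch (fun s => s == .leaf (.inl (.bit true))) (hf.comp PT.prodSnd)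
    (hg.comp PT.prodSnd)).comp (hb.prodMk PT.id) using 2 with x
  cases b x <;> simp [tr, Tree.head]

@[fun_prop]
theorem PT.bnot {f : α → Bool} (hf : PT f) : PT fun x => !f x := (PT.of_bool not).comp hf

@[fun_prop]
theorem PT.band {f g : α → Bool} (hf : PT f) (hg : PT g) : PT fun x => f x && g x := by
  convert PT.ite_bool hf hg (PT.const false) using 2 with x
  cases f x <;> simp

@[fun_prop]
theorem PT.bor {f g : α → Bool} (hf : PT f) (hg : PT g) : PT fun x => f x || g x := by
  convert PT.ite_bool hf (PT.const true) hg using 2 with x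
  cases f x <;> simp

@[fun_prop]
theorem PT.bxor {f g : α → Bool} (hf : PT f) (hg : PT g) : PT fun x => f x ^^ g x := by
  convert PT.ite_bool hf hg.bnot hg using 2 with x
  cases f x <;> simp

/-! ### Lists -/

/-- The tree of a list: its elements are the left subtrees along the rightmost path. -/
def treeOfList : List α → Tree
  | [] => .leaf (.inl .blank)
  | a :: l => .node (tr a) (treeOfList l)

instance : Enc (List α) := ⟨treeOfList⟩

@[simp] theorem sz_nil : sz ([] : List α) = 1 := rfl

@[simp] theorem sz_cons (a : α) (l : List α) : sz (a :: l) = sz a + sz l + 1 := rfl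

theorem sz_pos (a : α) : 0 < sz a := Tree.size_pos _

theorem length_lt_sz (l : List α) : l.length < sz l := by
  induction l with
  | nil => simp
  | cons a l ih => simp; omega

theorem sz_lt_of_mem {a : α} {l : List α} (h : a ∈ l) : sz a < sz l := by
  induction l with
  | nil => simp at h
  | cons b l ih =>
    rcases List.mem_cons.1 h with rfl | h
    · simp
    · have := ih h
      simp; omega

theorem sz_append (l l' : List α) : sz (l ++ l') + 1 = sz l + sz l' := by
  induction l with
  | nil => simp; omega
  | cons a l ih => simp; omega

theorem sz_reverse (l : List α) : sz l.reverse = sz l := by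
  induction l with
  | nil => simp
  | cons a l ih =>
    have := sz_append l.reverse [a]
    simp at this ⊢
    omega

@[fun_prop]
theorem PT.cons {f : α → β} {g : α → List β} (hf : PT f) (hg : PT g) : PT fun x => f x :: g x :=
  PT.of_tr_eq (hf.prodMk hg) (fun x => x) (fun _ => rfl) fun _ => rfl

@[fun_prop]
theorem PT.tail {f : α → List β} (hf : PT f) : PT fun x => (f x).tail := by
  refine PT.comp (PT.of_tr_eq PT.treeSnd tr (fun _ => rfl) fun l => ?_) hf
  cases l <;> rfl

@[fun_prop]
theorem PT.isEmpty {f : α → List β} (hf : PT f) : PT fun x => (f x).isEmpty := by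
  refine PT.comp ?_ hf
  convert PT.ite_head (α := List β) (fun s => s == .node) (PT.const false) (PT.const true)
    using 2 with l
  cases l <;> rfl

theorem PT.headD {f : α → List β} (d : β) (hf : PT f) : PT fun x => (f x).headD d := by
  refine PT.comp (g := fun l : List β => l.headD d) ?_ hf
  refine PT.of_tr_eq (PT.ite_bool (PT.isEmpty PT.id) (PT.const (tr d))
    (PT.treeFst.comp (PT.of_tr_eq PT.id (fun l : List β => l) (fun _ => rfl) (g := tr)
      fun _ => rfl))) (fun l => l) (fun _ => rfl) fun l => ?_
  cases l <;> rfl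

attribute [fun_prop] PT.headD

/-- Replaces a list and an initial state on top of the main stack by the result of the left fold,
where `P` replaces an element and a state by the next state. -/
def Prog.fold {A : Type} (P : Prog A) : Prog A :=
  .seq .popMain (.seq .popReg (.seq (.loop (fun v => v == some .node)
    (.seq .clear (.seq .swap (.seq .read (.seq .dropRight (.seq (.pushMain .node)
      (.seq P (.seq .pourLeft .popReg)))))))) .clear))

/-- The program for a left fold is fast as long as `B` bounds the sizes of the list and of all
intermediate states. -/
theorem Prog.maps_fold {A : Type} {P : Prog A} {p : Polynomial ℕ} {g : α × σ → σ}
    (hP : ∀ x, P.Maps (tr x).code (tr (g x)).code (p.eval (sz x))) (l : List α) (s : σ) (B : ℕ)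
    (hl : sz l ≤ B) (hB : ∀ l', l' <+: l → sz (l'.foldl (fun s a => g (a, s)) s) ≤ B) :
    P.fold.Maps (tr (l, s)).code (tr (l.foldl (fun s a => g (a, s)) s)).code
      (B * (p.eval (2 * B + 1) + 42 * B + 50) + 4) := by
  intro m L r c i o
  have key : Exec (.loop (fun v => v == some .node)
    (.seq .clear (.seq .swap (.seq .read (.seq .dropRight (.seq (.pushMain .node)
      (.seq P (.seq .pourLeft .popReg)))))))) ((tr l).code ++ ((tr s).code ++ m)).head?
      ⟨((tr l).code ++ ((tr s).code ++ m)).tail, L, r, c, i, o⟩ (some (.leaf (.inl .blank)))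
      ⟨(tr (l.foldl (fun s a => g (a, s)) s)).code ++ m, L, r, c, i, o⟩
      (l.length * (p.eval (2 * B + 1) + 42 * B + 50) + 1) := by
    induction l generalizing s with
    | nil => exact .mono (.loop_false (by rfl)) (by simp)
    | cons a l ih =>
      have h := ih (g (a, s)) (by simp at hl; omega) fun l' h' => by
        simpa using hB (a :: l') (by simpa using h')
      have hs : sz s ≤ B := hB [] (by simp)
      simp only [sz_cons] at hl
      have hsw := Prog.maps_swap (A := A) (tr a) (tr l) ((tr s).code ++ m) L r c i o
      rw [List.append_assoc, List.append_assoc] at hsw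
      have hmark : Sym.mark ∉ (tr l).code.reverse := by simpa using (tr l).mark_notMem_code
      have hg := hP (a, s) m ((tr l).code.reverse ++ .mark :: L) r c i o
      have hpour := exec_pourLeft hmark ((tr (g (a, s))).code ++ m) L r c i o
      rw [List.reverse_reverse] at hpour
      have hlist : (tr (a :: l)).code ++ ((tr s).code ++ m) =
          .node :: ((tr a).code ++ ((tr l).code ++ ((tr s).code ++ m))) := by
        simp [tr, treeOfList, Tree.code]
      have hpair : (tr (a, s)).code ++ m = .node :: ((tr a).code ++ ((tr s).code ++ m)) := by
        simp [tr, Tree.code]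
      rw [hpair] at hg
      rw [hlist]
      refine .mono (.loop_true (by rfl) (.seq .load (.seq hsw (.seq (exec_read _ _ _ _ _ _ _)
        (.seq (exec_dropRight hmark _ _ _ _ _ _) (.seq .push (.seq hg (.seq hpour .pop))))))) h) ?_
      have := eval_mono p (show sz (a, s) ≤ 2 * B + 1 by simp; omega)
      simp only [List.length_reverse, Tree.length_code, List.length_cons, ← sz.eq_1]
      rw [Nat.add_one_mul l.length]
      omega
  have hpair : (tr (l, s)).code ++ m = .node :: ((tr l).code ++ ((tr s).code ++ m)) := by
    simp [tr, Tree.code]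
  rw [hpair]
  refine .mono (.seq .pop (.seq .pop (.seq key .load))) ?_
  have := Nat.mul_le_mul_right (p.eval (2 * B + 1) + 42 * B + 50) ((length_lt_sz l).le.trans hl)
  omega

/-- A left fold is polynomial-time computable if its step is, and if all intermediate states have
polynomial size. -/
theorem PT.foldl_of_sz_le {l : γ → List α} {s : γ → σ} {g : γ → σ → α → σ} (hl : PT l) (hs : PT s)
    (hg : PT fun x : γ × σ × α => g x.1 x.2.1 x.2.2)
    (hB : ∃ q : Polynomial ℕ, ∀ x l', l' <+: l x → sz (l'.foldl (g x) (s x)) ≤ q.eval (sz x)) :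
    PT fun x => (l x).foldl (g x) (s x) := by
  -- The parameter `x` is carried along as a part of the state.
  have hg' : PT fun x : α × γ × σ => (x.2.1, g x.2.1 x.2.2 x.1) :=
    (PT.prodFst.comp PT.prodSnd).prodMk (hg.comp (f := fun x : α × γ × σ => (x.2.1, x.2.2, x.1))
      (by fun_prop))
  have hfold : ∀ (x : γ) (t : σ) (l : List α),
      l.foldl (fun (s : γ × σ) a => (s.1, g s.1 s.2 a)) (x, t) = (x, l.foldl (g x) t) := by
    intro x t l
    induction l generalizing t with
    | nil => rfl
    | cons a l ih => exact ih _
  have hpair : PT fun x => (x, (l x).foldl (g x) (s x)) := by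
    intro A
    obtain ⟨q, hq⟩ := hB
    obtain ⟨P, p, hP⟩ := hg' A
    have hi : PT fun x => (l x, x, s x) := by fun_prop
    obtain ⟨P', p', hP'⟩ := hi A
    obtain ⟨r, hr⟩ := hl.sz_le
    refine ⟨.seq P' P.fold, p' + ((q + r + .X + 1) * (p.comp (2 * (q + r + .X + 1) + 1) +
      42 * (q + r + .X + 1) + 50) + 4), fun x => ?_⟩
    have h := Prog.maps_fold hP (l x) (x, s x) (q.eval (sz x) + r.eval (sz x) + sz x + 1)
      (by have := hr x; omega) fun l' hl' => by
        rw [hfold]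
        have := hq x l' hl'
        simp
        omega
    rw [hfold] at h
    exact ((hP' x).seq h).mono (by simp)
  exact hpair.snd

end StackProg

namespace StackProg

open Enc

set_option linter.unusedSectionVars false

variable {α β γ δ σ : Type} [Enc α] [Enc β] [Enc γ] [Enc δ] [Enc σ]

/-! ### Folds with states of polynomial size -/

theorem sz_foldl_le (g : σ → α → σ) (D : ℕ) (l : List α) (s : σ)
    (h : ∀ s, ∀ a ∈ l, sz (g s a) ≤ sz s + D) : sz (l.foldl g s) ≤ sz s + l.length * D := by
  induction l generalizing s with
  | nil => simp
  | cons a l ih =>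
    have h1 := ih (g s a) fun s b hb => h s b (List.mem_cons_of_mem _ hb)
    have h2 := h s a List.mem_cons_self
    rw [List.foldl_cons, List.length_cons, Nat.add_one_mul]
    omega

/-- The states of a left fold have polynomial size if every step adds an amount to the size that is
bounded in terms of the parameter and the list element (and not of the state). -/
theorem sz_foldl_bound {l : γ → List α} {s : γ → σ} {g : γ → σ → α → σ} (hl : PT l) (hs : PT s)
    (hg : ∃ q : Polynomial ℕ, ∀ x s a, sz (g x s a) ≤ sz s + q.eval (sz x + sz a)) :
    ∃ q : Polynomial ℕ, ∀ x l', l' <+: l x → sz (l'.foldl (g x) (s x)) ≤ q.eval (sz x) := by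
  obtain ⟨r, hr⟩ := hl.sz_le
  obtain ⟨i, hi⟩ := hs.sz_le
  obtain ⟨q, hq⟩ := hg
  refine ⟨i + r * q.comp (.X + r), fun x l' hl' => ?_⟩
  refine (sz_foldl_le (g x) (q.eval (sz x + r.eval (sz x))) l' (s x) fun t a ha =>
    (hq x t a).trans (Nat.add_le_add_left (eval_mono q (Nat.add_le_add_left
      ((sz_lt_of_mem (hl'.subset ha)).le.trans (hr x)) _)) _)).trans ?_
  have h1 := hi x
  have h2 : l'.length ≤ r.eval (sz x) :=
    hl'.length_le.trans ((length_lt_sz _).le.trans (hr x))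
  have := Nat.mul_le_mul_right (q.eval (sz x + r.eval (sz x))) h2
  simp
  omega

theorem PT.foldl {l : γ → List α} {s : γ → σ} {g : γ → σ → α → σ} (hl : PT l) (hs : PT s)
    (hg : PT fun x : γ × σ × α => g x.1 x.2.1 x.2.2)
    (h : ∃ q : Polynomial ℕ, ∀ x s a, sz (g x s a) ≤ sz s + q.eval (sz x + sz a)) :
    PT fun x => (l x).foldl (g x) (s x) :=
  PT.foldl_of_sz_le hl hs hg (sz_foldl_bound hl hs h)

theorem foldl_cons_eq (l l' : List α) : l.foldl (fun s a => a :: s) l' = l.reverse ++ l' := by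
  induction l generalizing l' with
  | nil => rfl
  | cons a l ih => simp [ih]

@[fun_prop]
theorem PT.reverse_append {f g : γ → List α} (hf : PT f) (hg : PT g) :
    PT fun x => (f x).reverse ++ g x := by
  simp only [← foldl_cons_eq]
  exact PT.foldl hf hg (by fun_prop) ⟨.X + 1, fun x s a => by simp; omega⟩

@[fun_prop]
theorem PT.reverse {f : γ → List α} (hf : PT f) : PT fun x => (f x).reverse := by
  simpa using hf.reverse_append (PT.const [])

@[fun_prop]
theorem PT.append {f g : γ → List α} (hf : PT f) (hg : PT g) : PT fun x => f x ++ g x := by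
  simpa using hf.reverse.reverse_append hg

/-- The concatenation of the words `e s a` emitted at the states `s` and list elements `a` during a
left fold with step `g`. -/
def emits {α β σ : Type} (g : σ → α → σ) (e : σ → α → List β) : σ → List α → List β
  | _, [] => []
  | s, a :: l => e s a ++ emits g e (g s a) l

theorem foldl_emits (g : σ → α → σ) (e : σ → α → List β) (s : σ) (l : List α) (w : List β) :
    l.foldl (fun (s : σ × List β) a => (g s.1 a, (e s.1 a).reverse ++ s.2)) (s, w) =
      (l.foldl g s, (emits g e s l).reverse ++ w) := by
  induction l generalizing s w with
  | nil => rfl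
  | cons a l ih => simp [emits, ih]

theorem sz_emits_le (g : σ → α → σ) (e : σ → α → List β) (D : ℕ) (s : σ) (l : List α)
    (h : ∀ l' a, l' ++ [a] <+: l → sz (e (l'.foldl g s) a) ≤ D) :
    sz (emits g e s l) ≤ l.length * D + 1 := by
  induction l generalizing s with
  | nil => simp [emits]
  | cons a l ih =>
    have h1 := ih (g s a) fun l' b hl' => by simpa using h (a :: l') b (by simpa using hl')
    have h2 := h [] a (by simp)
    have h3 := sz_append (e s a) (emits g e (g s a) l)
    rw [emits, List.length_cons, Nat.add_one_mul]
    simp only [List.foldl_nil] at h2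
    omega

/-- Emitting words during a left fold is polynomial-time computable if the states have polynomial
size. The words are collected in reverse order in a second component of the state. -/
theorem PT.emits {l : γ → List α} {s : γ → σ} {g : γ → σ → α → σ} {e : γ → σ → α → List β}
    (hl : PT l) (hs : PT s) (hg : PT fun x : γ × σ × α => g x.1 x.2.1 x.2.2)
    (he : PT fun x : γ × σ × α => e x.1 x.2.1 x.2.2)
    (h : ∃ q : Polynomial ℕ, ∀ x l', l' <+: l x → sz (l'.foldl (g x) (s x)) ≤ q.eval (sz x)) :
    PT fun x => StackProg.emits (g x) (e x) (s x) (l x) := by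
  obtain ⟨r, hr⟩ := hl.sz_le
  obtain ⟨q, hq⟩ := h
  obtain ⟨p, hp⟩ := he.sz_le
  have hg' : PT fun x : γ × (σ × List β) × α => g x.1 x.2.1.1 x.2.2 :=
    hg.comp (f := fun x : γ × (σ × List β) × α => (x.1, x.2.1.1, x.2.2)) (by fun_prop)
  have he' : PT fun x : γ × (σ × List β) × α => e x.1 x.2.1.1 x.2.2 :=
    he.comp (f := fun x : γ × (σ × List β) × α => (x.1, x.2.1.1, x.2.2)) (by fun_prop)
  have key : PT fun x => (l x).foldl
      (fun (t : σ × List β) a => (g x t.1 a, (e x t.1 a).reverse ++ t.2)) (s x, []) := by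
    refine PT.foldl_of_sz_le hl (hs.prodMk (PT.const [])) (hg'.prodMk (he'.reverse_append
      (by fun_prop))) ⟨q + (r * p.comp (.X + q + r + 2) + 1) + 1, fun x l' hl' => ?_⟩
    rw [foldl_emits]
    have h1 := hq x l' hl'
    have h2 : l'.length ≤ r.eval (sz x) :=
      hl'.length_le.trans ((length_lt_sz _).le.trans (hr x))
    have h3 := sz_emits_le (g x) (e x) (p.eval (sz x + q.eval (sz x) + r.eval (sz x) + 2)) (s x) l'
      fun l'' a hl'' => by
        refine (hp (x, l''.foldl (g x) (s x), a)).trans (eval_mono p ?_)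
        have h4 := hq x l'' ((List.prefix_append _ _).trans (hl''.trans hl'))
        have h5 := sz_lt_of_mem (hl'.subset (hl''.subset (by simp : a ∈ l'' ++ [a])))
        have h6 := hr x
        simp
        omega
    have h7 := Nat.mul_le_mul_right (p.eval (sz x + q.eval (sz x) + r.eval (sz x) + 2)) h2
    simp [sz_reverse]
    omega
  have := key.snd.reverse
  simpa [foldl_emits] using this

theorem emits_eq_flatMap {α β σ : Type} (f : α → List β) (s : σ) (l : List α) :
    emits (fun s _ => s) (fun _ a => f a) s l = l.flatMap f := by
  induction l with
  | nil => rfl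
  | cons a l ih => simp [emits, ih]

theorem PT.flatMap {l : γ → List α} {f : γ → α → List β} (hl : PT l)
    (hf : PT fun x : γ × α => f x.1 x.2) : PT fun x => (l x).flatMap (f x) := by
  have := PT.emits (s := fun _ => false) (g := fun _ s _ => s) (e := fun x _ a => f x a) hl
    (PT.const false) (by fun_prop)
    (hf.comp (f := fun x : γ × Bool × α => (x.1, x.2.2)) (by fun_prop))
    (sz_foldl_bound hl (PT.const false) ⟨0, fun x s a => by simp⟩)
  simpa only [emits_eq_flatMap] using this

theorem PT.map {l : γ → List α} {f : γ → α → β} (hl : PT l)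
    (hf : PT fun x : γ × α => f x.1 x.2) : PT fun x => (l x).map (f x) := by
  simpa only [List.map_eq_flatMap] using PT.flatMap (f := fun x a => [f x a]) hl (by fun_prop)

/-! ### Binary arithmetic -/

instance : Enc ℕ := ⟨fun n => tr n.bits⟩

theorem sz_listBool (l : List Bool) : sz l = 2 * l.length + 1 := by
  induction l with
  | nil => rfl
  | cons a l ih => simp [ih]; omega

theorem sz_nat (n : ℕ) : sz n = 2 * n.size + 1 := by
  rw [← Nat.size_eq_bits_len]
  exact sz_listBool _

@[fun_prop]
theorem PT.bits {f : γ → ℕ} (hf : PT f) : PT fun x => (f x).bits :=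
  PT.of_tr_eq hf (fun x => x) (fun _ => rfl) fun _ => rfl

@[fun_prop]
theorem PT.bodd {f : γ → ℕ} (hf : PT f) : PT fun x => (f x).bodd := by
  convert PT.headD false hf.bits using 2 with x
  rw [Nat.bodd_eq_bits_head]
  cases (f x).bits <;> rfl

@[fun_prop]
theorem PT.div2 {f : γ → ℕ} (hf : PT f) : PT fun x => (f x).div2 :=
  PT.of_tr_eq hf.bits.tail (fun x => x) (fun _ => rfl) fun x => by
    change tr (f x).div2.bits = _
    rw [Nat.div2_bits_eq_tail]

theorem bits_isEmpty (n : ℕ) : n.bits.isEmpty = decide (n = 0) := by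
  rw [Bool.eq_iff_iff, List.isEmpty_iff, decide_eq_true_iff, ← List.length_eq_zero_iff,
    Nat.size_eq_bits_len, Nat.size_eq_zero]

@[fun_prop]
theorem PT.decide_eq_zero {f : γ → ℕ} (hf : PT f) : PT fun x => decide (f x = 0) := by
  simpa only [bits_isEmpty] using hf.bits.isEmpty

@[fun_prop]
theorem PT.natBit {f : γ → Bool} {g : γ → ℕ} (hf : PT f) (hg : PT g) :
    PT fun x => Nat.bit (f x) (g x) := by
  refine PT.of_tr_eq (PT.ite_bool (hf.bnot.band hg.decide_eq_zero) (PT.const ([] : List Bool))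
    (hf.cons hg.bits)) (fun x => x) (fun _ => rfl) fun x => ?_
  change tr (Nat.bit (f x) (g x)).bits = _
  congr 1
  by_cases h : g x = 0
  · rw [h]
    cases f x <;> simp
  · rw [Nat.bits_append_bit _ _ fun h' => absurd h' h]
    simp [h]

theorem sz_natBit_le (b : Bool) (n : ℕ) : sz (Nat.bit b n) ≤ sz n + 2 := by
  rw [sz_nat, sz_nat]
  by_cases h : Nat.bit b n = 0
  · rw [h, Nat.size_zero]
    omega
  · rw [Nat.size_bit h]
    omega

/-- The number with binary digits `l`, least significant digit first. -/
def ofBits (l : List Bool) : ℕ := l.foldr Nat.bit 0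

@[simp] theorem ofBits_nil : ofBits [] = 0 := rfl

@[simp] theorem ofBits_cons (b : Bool) (l : List Bool) : ofBits (b :: l) = Nat.bit b (ofBits l) :=
  rfl

theorem ofBits_bits (n : ℕ) : ofBits n.bits = n := by
  induction n using Nat.binaryRec' with
  | zero => simp
  | bit b n h ih => rw [Nat.bits_append_bit _ _ h, ofBits_cons, ih]

theorem PT.foldl_natBit {f : γ → List Bool} {g : γ → ℕ} (hf : PT f) (hg : PT g) :
    PT fun x => (f x).foldl (fun n b => Nat.bit b n) (g x) :=
  PT.foldl hf hg (by fun_prop) ⟨2, fun _ s a => by simpa using sz_natBit_le a s⟩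

@[fun_prop]
theorem PT.ofBits {f : γ → List Bool} (hf : PT f) : PT fun x => StackProg.ofBits (f x) := by
  have h := hf.reverse.foldl_natBit (PT.const 0)
  simp only [List.foldl_reverse] at h
  exact h

theorem size_add_le (m n : ℕ) : (m + n).size ≤ m.size + n.size + 1 := by
  rw [Nat.size_le]
  have h1 := Nat.lt_size_self m
  have h2 := Nat.lt_size_self n
  have h3 : 2 ^ m.size ≤ 2 ^ (m.size + n.size) := Nat.pow_le_pow_right (by norm_num) (by omega)
  have h4 : 2 ^ n.size ≤ 2 ^ (m.size + n.size) := Nat.pow_le_pow_right (by norm_num) (by omega)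
  rw [pow_succ]
  omega

theorem size_mul_le (m n : ℕ) : (m * n).size ≤ m.size + n.size := by
  rw [Nat.size_le, pow_add]
  exact Nat.mul_lt_mul'' (Nat.lt_size_self m) (Nat.lt_size_self n)

theorem sz_add_le (m n : ℕ) : sz (m + n) ≤ sz m + sz n + 1 := by
  have := size_add_le m n
  simp only [sz_nat]
  omega

theorem sz_mul_le (m n : ℕ) : sz (m * n) ≤ sz m + sz n := by
  have := size_mul_le m n
  simp only [sz_nat]
  omega

/-- One step of binary addition. The state consists of the remaining part of the second summand, the
carry, and the digits of the sum so far, with the most significant digit first. -/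
def addStep (s : ℕ × Bool × List Bool) (a : Bool) : ℕ × Bool × List Bool :=
  (s.1.div2, if a ^^ s.1.bodd then s.2.1 else a, (a ^^ s.1.bodd ^^ s.2.1) :: s.2.2)

/-- The invariant of the addition: the digits written so far, continued by the sum of what is left of
both summands and the carry. -/
theorem foldl_addStep (l : List Bool) (s : ℕ × Bool × List Bool) :
    (l.foldl addStep s).2.2.foldl (fun n b => Nat.bit b n)
      ((l.foldl addStep s).1 + (l.foldl addStep s).2.1.toNat) =
    s.2.2.foldl (fun n b => Nat.bit b n) (ofBits l + s.1 + s.2.1.toNat) := by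
  induction l generalizing s with
  | nil => simp
  | cons a l ih =>
    rw [List.foldl_cons, ih]
    obtain ⟨y, c, w⟩ := s
    simp only [addStep, List.foldl_cons, ofBits_cons]
    congr 1
    conv_rhs => rw [← Nat.bodd_add_div2 y]
    cases a <;> cases c <;> cases y.bodd <;> simp [Nat.bit] <;> omega

theorem size_div2 (n : ℕ) : n.div2.size = n.size - 1 := by
  rw [← Nat.size_eq_bits_len, Nat.div2_bits_eq_tail, List.length_tail, Nat.size_eq_bits_len]

theorem sz_div2_le (n : ℕ) : sz n.div2 ≤ sz n := by
  rw [sz_nat, sz_nat, size_div2]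
  omega

theorem foldl_addStep_fst (l : List Bool) (s : ℕ × Bool × List Bool) (h : s.1.size ≤ l.length) :
    (l.foldl addStep s).1 = 0 := by
  induction l generalizing s with
  | nil => simpa [Nat.size_eq_zero] using h
  | cons a l ih =>
    refine ih _ ?_
    have := size_div2 s.1
    simp only [addStep, List.length_cons] at h ⊢
    omega

theorem ofBits_append_replicate (l : List Bool) (n : ℕ) :
    ofBits (l ++ List.replicate n false) = ofBits l := by
  induction l with
  | nil =>
    induction n with
    | zero => rfl
    | succ n ih => simpa [List.replicate_succ] using ih
  | cons b l ih => simp [ih]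

@[fun_prop]
theorem PT.add {f g : γ → ℕ} (hf : PT f) (hg : PT g) : PT fun x => f x + g x := by
  -- The first summand is padded with zeros so that all digits of the second one are read.
  have h : PT fun x => ((f x).bits ++ (g x).bits.map fun _ => false).foldl addStep
      (g x, false, []) := by
    refine PT.foldl (g := fun _ => addStep) (hf.bits.append (PT.map hg.bits (by fun_prop)))
      (by fun_prop) (by unfold addStep; fun_prop) ⟨3, fun x s a => ?_⟩
    have := sz_div2_le s.1
    simp [addStep]
    omega
  convert (h.snd.snd).foldl_natBit (g := fun x => if (((f x).bits ++
    (g x).bits.map fun _ => false).foldl addStep (g x, false, [])).2.1 = true then 1 else 0)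
      (by fun_prop) using 2 with x
  have h1 := foldl_addStep ((f x).bits ++ (g x).bits.map fun _ => false) (g x, false, [])
  rw [foldl_addStep_fst _ _ (by simp [Nat.size_eq_bits_len])] at h1
  simp only [List.map_const', ofBits_append_replicate, ofBits_bits] at h1
  simp only [List.map_const']
  simp only [zero_add, List.foldl_nil, Bool.toNat_false, add_zero] at h1
  rw [← h1]
  congr 1
  cases (List.foldl addStep (g x, false, [])
    ((f x).bits ++ List.replicate (g x).bits.length false)).2.1 <;> rfl

/-- Multiplication by Horner's scheme. -/
theorem foldr_mul (l : List Bool) (n : ℕ) :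
    l.foldr (fun b s => if b = true then Nat.bit false s + n else Nat.bit false s) 0 =
      ofBits l * n := by
  induction l with
  | nil => simp
  | cons b l ih =>
    rw [List.foldr_cons, ih, ofBits_cons]
    cases b <;> simp [Nat.bit] <;> ring

@[fun_prop]
theorem PT.mul {f g : γ → ℕ} (hf : PT f) (hg : PT g) : PT fun x => f x * g x := by
  obtain ⟨q, hq⟩ := hg.sz_le
  have h := PT.foldl (g := fun x s b => if b = true then Nat.bit false s + g x else Nat.bit false s)
    hf.bits.reverse (PT.const 0) (by fun_prop) ⟨q + 3, fun x s b => ?_⟩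
  · simpa only [List.foldl_reverse, foldr_mul, ofBits_bits] using h
  · have h1 := sz_natBit_le false s
    have h2 := sz_add_le (Nat.bit false s) (g x)
    have h3 := hq x
    have h4 := eval_mono q (Nat.le_add_right (sz x) (sz b))
    simp only [Polynomial.eval_add, Polynomial.eval_ofNat]
    split_ifs <;> omega

/-- One step of the comparison of binary numbers. The state consists of the remaining part of the
second number, and whether the digits of the first number so far are at most those of the
second number. -/
def leStep (s : ℕ × Bool) (a : Bool) : ℕ × Bool :=
  (s.1.div2, if a ^^ s.1.bodd then s.1.bodd else s.2)

/-- The invariant of the comparison: the remaining digits decide, and the result so far is used only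
if they agree. -/
theorem foldl_leStep (l : List Bool) (s : ℕ × Bool) :
    (!decide ((l.foldl leStep s).1 = 0) || (l.foldl leStep s).2) =
      (decide (ofBits l < s.1) || (decide (ofBits l = s.1) && s.2)) := by
  induction l generalizing s with
  | nil =>
    obtain ⟨y, b⟩ := s
    rcases Nat.eq_zero_or_pos y with rfl | h
    · simp
    · simp [h, h.ne']
  | cons a l ih =>
    rw [List.foldl_cons, ih]
    have key : ∀ (p y z : ℕ) (a d b : Bool), d.toNat + 2 * z = y →
        ((p < z ∨ p = z ∧ (if a ^^ d then d else b) = true) ↔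
          (Nat.bit a p < y ∨ Nat.bit a p = y ∧ b = true)) := by
      rintro p y z a d b rfl
      cases a <;> cases d <;> cases b <;> simp [Nat.bit] <;> omega
    rw [Bool.eq_iff_iff]
    simp only [Bool.or_eq_true, Bool.and_eq_true, decide_eq_true_eq]
    exact key (ofBits l) s.1 s.1.div2 a s.1.bodd s.2 (Nat.bodd_add_div2 s.1)

@[fun_prop]
theorem PT.decide_le {f g : γ → ℕ} (hf : PT f) (hg : PT g) : PT fun x => decide (f x ≤ g x) := by
  have h : PT fun x => (f x).bits.foldl leStep (g x, true) := by
    refine PT.foldl (g := fun _ => leStep) hf.bits (by fun_prop) (by unfold leStep; fun_prop)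
      ⟨0, fun x s a => ?_⟩
    have := sz_div2_le s.1
    simp [leStep]
    omega
  convert h.fst.decide_eq_zero.bnot.bor h.snd using 2 with x
  rw [foldl_leStep, ofBits_bits, Bool.eq_iff_iff]
  simp
  omega

end StackProg

namespace StackProg

open Enc

/-! ### From words to trees and back -/

section Words

variable {A : Type}

namespace Prog

/-- Replaces the input word by its tree on the main stack. -/
def readInput (e : A → Letter) : Prog A :=
  .seq (.push .left fun _ => .mark) <|
    .seq (.pop .inp fun _ s => s.map fun a => .leaf (e a)) <|
    .seq (.loop (fun v => v.isSome) (.seq (.push .left fun v => v.getD .mark)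
      (.pop .inp fun _ s => s.map fun a => .leaf (e a)))) <|
    .seq (.pushMain (.leaf (.inl .blank))) <|
    .seq (.pop .left fun _ s => s) <|
    .seq (.loop (fun v => v != some .mark) (.seq .pushReg (.seq (.pushMain .node)
      (.pop .left fun _ s => s)))) .clear

/-- The output symbol that a working symbol stands for. -/
def outSym : Reg → Γ'
  | some (.leaf (.inl a)) => a
  | _ => .blank

/-- Moves the word whose tree is on the main stack to the output stack. -/
def writeOutput : Prog A :=
  .seq (.push .left fun _ => .mark) <| .seq .popReg <|
    .seq (.loop (fun v => v == some .node)
      (.seq .popReg (.seq (.push .left fun v => v.getD .mark) .popReg))) <|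
    .seq (.pop .left fun _ s => s) <|
    .seq (.loop (fun v => v != some .mark) (.seq (.push .out outSym)
      (.pop .left fun _ s => s))) .clear

end Prog

theorem exec_readInput (e : A → Letter) (w : List A) :
    Exec (.readInput e) none (.io w []) none ⟨(tr (w.map e)).code, [], [], [], [], []⟩
      (7 * w.length + 10) := by
  have h1 : ∀ (w : List A) (l : List Sym),
      Exec (.loop (fun v => v.isSome) (.seq (.push .left fun v => v.getD .mark)
        (.pop .inp fun _ s => s.map fun a => .leaf (e a))))
        (w.head?.map fun a => .leaf (e a)) ⟨[], l, [], [], w.tail, []⟩ none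
        ⟨[], (w.map fun a => .leaf (e a)).reverse ++ l, [], [], [], []⟩ (3 * w.length + 1) := by
    intro w
    induction w with
    | nil => exact fun l => .loop_false (by rfl)
    | cons a w ih =>
      intro l
      refine .mono (.loop_true (by rfl) (.seq .push .pop) ?_)
        (t := 2 + (3 * w.length + 1) + 1) (by simp; omega)
      rw [List.map_cons, List.reverse_cons, List.append_assoc]
      exact ih _
  have h2 : ∀ w v : List A,
      Exec (.loop (fun v => v != some .mark) (.seq .pushReg (.seq (.pushMain .node)
        (.pop .left fun _ s => s))) : Prog A)
        ((w.map fun a => Sym.leaf (e a)) ++ [Sym.mark]).head?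
        ⟨(tr (v.map e)).code, ((w.map fun a => Sym.leaf (e a)) ++ [Sym.mark]).tail, [], [], [], []⟩
        (some .mark) ⟨(tr ((w.reverse ++ v).map e)).code, [], [], [], [], []⟩
        (4 * w.length + 1) := by
    intro w
    induction w with
    | nil => exact fun v => .loop_false (by rfl)
    | cons a w ih =>
      intro v
      refine .mono (.loop_true (by rfl) (.seq .push (.seq .push .pop)) ?_)
        (t := 3 + (4 * w.length + 1) + 1) (by simp; omega)
      rw [List.reverse_cons, List.append_assoc]
      exact ih (a :: v)
  have h3 := h2 w.reverse []
  simp only [List.map_reverse, List.reverse_reverse, List.append_nil, List.length_reverse] at h3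
  exact .mono (.seq .push (.seq .pop (.seq (h1 w [.mark]) (.seq .push (.seq .pop
    (.seq h3 .load)))))) (by omega)

theorem exec_writeOutput (w : List Γ') :
    Exec .writeOutput none ⟨(tr w).code, [], [], [], [], []⟩ none (.io ([] : List A) w)
      (7 * w.length + 10) := by
  have h1 : ∀ (w : List Γ') (l : List Sym),
      Exec (.loop (fun v => v == some .node)
        (.seq .popReg (.seq (.push .left fun v => v.getD .mark) .popReg)) : Prog A)
        (tr w).code.head? ⟨(tr w).code.tail, l, [], [], [], []⟩ (some (.leaf (.inl .blank)))
        ⟨[], (w.map fun a => .leaf (.inl a)).reverse ++ l, [], [], [], []⟩ (4 * w.length + 1) := by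
    intro w
    induction w with
    | nil => exact fun l => .loop_false (by rfl)
    | cons a w ih =>
      intro l
      refine .mono (.loop_true (by rfl) (.seq .pop (.seq .push .pop)) ?_)
        (t := 3 + (4 * w.length + 1) + 1) (by simp; omega)
      rw [List.map_cons, List.reverse_cons, List.append_assoc]
      exact ih _
  have h2 : ∀ w v : List Γ',
      Exec (.loop (fun v => v != some .mark) (.seq (.push .out Prog.outSym)
        (.pop .left fun _ s => s)) : Prog A)
        ((w.map fun a => Sym.leaf (.inl a)) ++ [Sym.mark]).head?
        ⟨[], ((w.map fun a => Sym.leaf (.inl a)) ++ [Sym.mark]).tail, [], [], [], v⟩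
        (some .mark) ⟨[], [], [], [], [], w.reverse ++ v⟩ (3 * w.length + 1) := by
    intro w
    induction w with
    | nil => exact fun v => .loop_false (by rfl)
    | cons a w ih =>
      intro v
      refine .mono (.loop_true (by rfl) (.seq .push .pop) ?_)
        (t := 2 + (3 * w.length + 1) + 1) (by simp; omega)
      rw [List.reverse_cons, List.append_assoc]
      exact ih (a :: v)
  have h3 := h2 w.reverse []
  simp only [List.map_reverse, List.reverse_reverse, List.append_nil, List.length_reverse] at h3
  exact .mono (.seq .push (.seq .pop (.seq (h1 w [.mark]) (.seq .pop (.seq h3 .load)))))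
    (by omega)

end Words

theorem sz_listLetter (l : List Letter) : sz l = 2 * l.length + 1 := by
  induction l with
  | nil => rfl
  | cons a l ih => simp [ih]; omega

/-- A polynomial-time function on words is computed by a Turing machine in polynomial time. -/
theorem PT.tm2Computable {A : Type} [Fintype A] (e : A → Letter) {F : List Letter → List Γ'}
    (hF : PT F) {α β : Type} {ea : α → List A} {eb : β → List Γ'} {f : α → β}
    (h : ∀ x, F ((ea x).map e) = eb (f x)) : Nonempty (TM2ComputableInPolyTime ea eb f) := by
  obtain ⟨P, p, hP⟩ := hF A
  obtain ⟨q, hq⟩ := hF.sz_le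
  refine computable_of_exec (.seq (.readInput e) (.seq P .writeOutput))
    (7 * .X + 10 + (p.comp (2 * .X + 1) + (7 * q.comp (2 * .X + 1) + 10))) fun x => ?_
  have h1 := hP ((ea x).map e) [] [] [] [] [] []
  rw [List.append_nil, List.append_nil] at h1
  rw [← h]
  refine .mono (.seq (exec_readInput e _) (.seq h1 (exec_writeOutput _))) ?_
  have h2 := (length_lt_sz (F ((ea x).map e))).le.trans (hq _)
  rw [sz_listLetter, List.length_map] at h2 ⊢
  simp
  omega

end StackProg

namespace StackProg

open Enc

variable {ι γ : Type} [Enc ι] [Enc γ]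

/-! ### Monomials with unreduced coefficients -/

/-- A rational number `± n / d`, not necessarily reduced; the sign is `true` for a minus. -/
abbrev Frac := Bool × ℕ × ℕ

/-- A monomial: its coefficient and its list of variables. -/
abbrev Mono (ι : Type) := Frac × List ι

/-- The product of two monomials. -/
def Mono.mul {ι : Type} (s t : Mono ι) : Mono ι :=
  ((s.1.1 ^^ t.1.1, s.1.2.1 * t.1.2.1, s.1.2.2 * t.1.2.2), s.2 ++ t.2)

@[fun_prop]
theorem PT.monoMul {f g : γ → Mono ι} (hf : PT f) (hg : PT g) : PT fun x => (f x).mul (g x) := by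
  unfold Mono.mul
  fun_prop

/-- The step from the reduced form `(p, v)` of `2 ^ j / d` to that of `2 ^ (j + 1) / d`. -/
def splitStep (s : ℕ × ℕ) : ℕ × ℕ :=
  if s.2.bodd = true then (Nat.bit false s.1, s.2) else (s.1, s.2.div2)

/-- Writes a monomial with coefficient `± n / d` as a sum of monomials with coefficients
`± 2 ^ j / d`, where `j` runs over the binary digits `1` of `n`. Every coefficient is reduced: only
powers of two have to be cancelled. -/
def Mono.split {ι : Type} (t : Mono ι) : List (Mono ι) :=
  emits (fun s _ => splitStep s) (fun s b => if b = true then [((t.1.1, s), t.2)] else [])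
    (1, t.1.2.2) t.1.2.1.bits

@[fun_prop]
theorem PT.monoSplit {f : γ → Mono ι} (hf : PT f) : PT fun x => (f x).split := by
  have hs : PT fun x => ((1 : ℕ), (f x).1.2.2) := by fun_prop
  have hl : PT fun x => (f x).1.2.1.bits := by fun_prop
  refine PT.emits (g := fun _ s _ => splitStep s)
    (e := fun x s b => if b = true then [(((f x).1.1, s), (f x).2)] else []) hl hs
    (by unfold splitStep; fun_prop) (by fun_prop) (sz_foldl_bound hl hs ⟨2, fun x s a => ?_⟩)
  have h1 := sz_natBit_le false s.1
  have h2 := sz_div2_le s.2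
  unfold splitStep
  rw [sz_prod s, Polynomial.eval_ofNat]
  split_ifs <;> rw [sz_mk] <;> omega

/-! ### The monomials of the quadratic program -/

/-- The data of a gate in the quadratic program: the coefficients `a`, `b`, `c`, the input variables
`l`, `r`, and the variables `y`, `z⁺`, `z⁻`. -/
abbrev GateData (ι : Type) := (Frac × Frac × Frac) × ι × ι × ι × ι × ι

/-- The monomials of `y + K z⁺ - K z⁻ - a y_l - b y_r - c`. -/
def GateData.residual {ι : Type} (K : ℕ) (g : GateData ι) : List (Mono ι) :=
  [((false, 1, 1), [g.2.2.2.1]), ((false, K, 1), [g.2.2.2.2.1]), ((true, K, 1), [g.2.2.2.2.2]),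
    ((!g.1.1.1, g.1.1.2), [g.2.1]), ((!g.1.2.1.1, g.1.2.1.2), [g.2.2.1]),
    ((!g.1.2.2.1, g.1.2.2.2), [])]

/-- The monomials of the polynomial of a gate. -/
def GateData.monos {ι : Type} (K : ℕ) (g : GateData ι) : List (Mono ι) :=
  ((g.residual K).flatMap fun s => (g.residual K).map fun t => s.mul t) ++
    [((false, 2 * (K * K), 1), [g.2.2.2.2.1, g.2.2.2.2.2]), ((false, 2 * K, 1), [g.2.2.2.2.1]),
      ((true, 2 * K, 1), [g.2.2.2.2.1, g.2.2.2.1]), ((false, 2 * K, 1), [g.2.2.2.2.2, g.2.2.2.1])]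

/-- The monomials of the quadratic program with `δ = u / v`, where `yn` is the output variable. -/
def qpMonos {ι : Type} (K u v : ℕ) (yn : ι) (L : List (GateData ι)) : List (Mono ι) :=
  emits (fun s _ => (s.1 * u, s.2 * v))
      (fun s g => (g.monos K).map fun t => Mono.mul ((false, s), []) t)
      (u * u * u, v * v * v) L ++
    [((false, L.foldl (fun s _ => (s.1 * u, s.2 * v)) (u * u * u, v * v * v)), [yn])]

/-- The monomials of the quadratic program, with reduced coefficients. -/
def qpTerms {ι : Type} (K u v : ℕ) (yn : ι) (L : List (GateData ι)) : List (Mono ι) :=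
  (qpMonos K u v yn L).flatMap Mono.split

@[fun_prop]
theorem PT.residual {K : γ → ℕ} {g : γ → GateData ι} (hK : PT K) (hg : PT g) :
    PT fun x => (g x).residual (K x) := by
  unfold GateData.residual
  fun_prop

@[fun_prop]
theorem PT.monos {K : γ → ℕ} {g : γ → GateData ι} (hK : PT K) (hg : PT g) :
    PT fun x => (g x).monos (K x) := by
  unfold GateData.monos
  refine PT.append (PT.flatMap (by fun_prop) (PT.map (by fun_prop) (by fun_prop))) (by fun_prop)

/-- The monomials of the quadratic program are polynomial-time computable: the powers of `u / v`
grow by a bounded number of digits from gate to gate. -/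
theorem PT.qpTerms {K u v : γ → ℕ} {yn : γ → ι} {L : γ → List (GateData ι)} (hK : PT K) (hu : PT u)
    (hv : PT v) (hyn : PT yn) (hL : PT L) :
    PT fun x => StackProg.qpTerms (K x) (u x) (v x) (yn x) (L x) := by
  have hs : PT fun x => (u x * u x * u x, v x * v x * v x) := by fun_prop
  obtain ⟨p, hp⟩ := hu.sz_le
  obtain ⟨q, hq⟩ := hv.sz_le
  have hstep : ∃ r : Polynomial ℕ, ∀ x (s : ℕ × ℕ) (a : GateData ι),
      sz (s.1 * u x, s.2 * v x) ≤ sz s + r.eval (sz x + sz a) := by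
    refine ⟨p + q, fun x s a => ?_⟩
    have h1 := sz_mul_le s.1 (u x)
    have h2 := sz_mul_le s.2 (v x)
    have h3 := (hp x).trans (eval_mono p (Nat.le_add_right _ (sz a)))
    have h4 := (hq x).trans (eval_mono q (Nat.le_add_right _ (sz a)))
    rw [sz_mk, sz_prod s, Polynomial.eval_add]
    omega
  refine PT.flatMap (PT.append (PT.emits (g := fun x s _ => (s.1 * u x, s.2 * v x))
    (e := fun x s g => (g.monos (K x)).map fun t => Mono.mul ((false, s), []) t) hL hs
    (by fun_prop) (PT.map (by fun_prop) (by fun_prop)) (sz_foldl_bound hL hs hstep)) ?_)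
    (by fun_prop)
  have h := PT.foldl (g := fun x s _ => (s.1 * u x, s.2 * v x)) hL hs (by fun_prop) hstep
  fun_prop

/-! ### The encoding of the quadratic program -/

/-- The code word of a monomial. -/
def Mono.enc (t : Mono ℕ) : List Γ' :=
  Γ'.bit t.1.1 :: (encNat t.1.2.1 ++ encNat t.1.2.2) ++ encSeq (t.2.map encNat)

theorem encodeNat_eq_bits (n : ℕ) : encodeNat n = n.bits := by
  have h : ∀ p : PosNum, encodePosNum p = (p : ℕ).bits := by
    intro p
    induction p with
    | one => simp [encodePosNum]
    | bit0 p ih =>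
      rw [encodePosNum, ih, PosNum.cast_bit0, ← two_mul, Nat.bit0_bits _ (PosNum.cast_pos p).ne']
    | bit1 p ih => rw [encodePosNum, ih, PosNum.cast_bit1, ← two_mul, Nat.bit1_bits]
  have h' : ∀ m : Num, encodeNum m = (m : ℕ).bits := by
    intro m
    cases m with
    | zero => simp [encodeNum]
    | pos p => exact h p
  rw [encodeNat, h', Num.to_of_nat]

theorem encSeq_eq_flatMap (ws : List (List Γ')) :
    encSeq ws = (ws.flatMap fun w => Γ'.bra :: w) ++ [Γ'.ket] := by
  induction ws with
  | nil => rfl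
  | cons w ws ih => simp [encSeq, ih]

@[fun_prop]
theorem PT.encNat {f : γ → ℕ} (hf : PT f) : PT fun x => encNat (f x) := by
  simp only [QPKKT.encNat, encodeNat_eq_bits]
  exact (PT.map (by fun_prop) (by fun_prop)).append (PT.const _)

@[fun_prop]
theorem PT.encSeq {f : γ → List (List Γ')} (hf : PT f) : PT fun x => encSeq (f x) := by
  simp only [encSeq_eq_flatMap]
  exact (PT.flatMap hf (by fun_prop)).append (PT.const _)

@[fun_prop]
theorem PT.monoEnc {f : γ → Mono ℕ} (hf : PT f) : PT fun x => (f x).enc := by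
  unfold Mono.enc
  have : PT fun x => (f x).2.map QPKKT.encNat := PT.map (by fun_prop) (by fun_prop)
  fun_prop

/-! ### From the code word of an instance to the data of its gates -/

/-- Whether a symbol is a binary digit. -/
def isBit : Γ' → Bool
  | .bit _ => true
  | _ => false

/-- The value of a binary digit. -/
def bitVal : Γ' → Bool
  | .bit b => b
  | _ => false

/-- Whether a symbol is a comma. -/
def isComma : Γ' → Bool
  | .comma => true
  | _ => false

@[fun_prop]
theorem PT.symbol_isBit {f : γ → Γ'} (hf : PT f) : PT fun x => isBit (f x) := (PT.of_symbol _).comp hf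

@[fun_prop]
theorem PT.symbol_bitVal {f : γ → Γ'} (hf : PT f) : PT fun x => bitVal (f x) := (PT.of_symbol _).comp hf

@[fun_prop]
theorem PT.symbol_isComma {f : γ → Γ'} (hf : PT f) : PT fun x => isComma (f x) :=
  (PT.of_symbol _).comp hf

/-- The words of binary digits that precede the commas, starting with the reverse of `s`; brackets
are ignored. -/
def tokensFrom (s : List Bool) (w : List Γ') : List (List Bool) :=
  emits (fun s a => if isBit a = true then bitVal a :: s else if isComma a = true then [] else s)
    (fun s a => if isComma a = true then [s.reverse] else []) s w

/-- The words of binary digits that precede the commas. -/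
def tokens (w : List Γ') : List (List Bool) := tokensFrom [] w

@[fun_prop]
theorem PT.tokens {f : γ → List Γ'} (hf : PT f) : PT fun x => tokens (f x) := by
  refine PT.emits (s := fun _ => []) (g := fun _ s a => if isBit a = true then bitVal a :: s else
    if isComma a = true then [] else s) hf (by fun_prop) (by fun_prop) (by fun_prop)
    (sz_foldl_bound hf (by fun_prop) ⟨2, fun x s a => ?_⟩)
  have := sz_pos s
  split_ifs <;> (simp; try omega)

/-- Whether a list has at least seven elements, so that the next element completes a block. -/
def hasSeven (l : List (List Bool)) : Bool := !l.tail.tail.tail.tail.tail.tail.isEmpty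

@[fun_prop]
theorem PT.list_hasSeven {f : γ → List (List Bool)} (hf : PT f) : PT fun x => hasSeven (f x) := by
  unfold StackProg.hasSeven
  fun_prop

/-- Cuts a list into blocks of length eight; each block is reversed. A gate is written as eight words:
numerators and denominators of `a`, `b`, `c`, and its two input variables. -/
def blocks (w : List (List Bool)) : List (List (List Bool)) :=
  emits (fun s a => if hasSeven s = true then [] else a :: s)
    (fun s a => if hasSeven s = true then [a :: s] else []) [] w

@[fun_prop]
theorem PT.blocks {f : γ → List (List Bool)} (hf : PT f) : PT fun x => blocks (f x) := by
  refine PT.emits (s := fun _ => []) (g := fun _ s a => if hasSeven s = true then [] else a :: s)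
    hf (by fun_prop) (by fun_prop) (by fun_prop)
    (sz_foldl_bound hf (by fun_prop) ⟨.X + 1, fun x s a => ?_⟩)
  have := sz_pos s
  split_ifs <;> simp <;> omega

/-- A rational number from the words for its numerator and denominator. The first digit of the
numerator is the sign. -/
def fracOf (n d : List Bool) : Frac := (n.headD false, ofBits n.tail, ofBits d)

@[fun_prop]
theorem PT.fracOf {f g : γ → List Bool} (hf : PT f) (hg : PT g) :
    PT fun x => fracOf (f x) (g x) := by
  unfold StackProg.fracOf
  fun_prop

/-- A gate: its coefficients and its input variables. -/
abbrev RawGate := (Frac × Frac × Frac) × ℕ × ℕ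

/-- The gate given by a reversed block of eight words. -/
def rawGateOf (w : List (List Bool)) : RawGate :=
  ((fracOf (w.tail.tail.tail.tail.tail.tail.tail.headD [])
      (w.tail.tail.tail.tail.tail.tail.headD []),
    fracOf (w.tail.tail.tail.tail.tail.headD []) (w.tail.tail.tail.tail.headD []),
    fracOf (w.tail.tail.tail.headD []) (w.tail.tail.headD [])),
    ofBits (w.tail.headD []), ofBits (w.headD []))

@[fun_prop]
theorem PT.rawGateOf {f : γ → List (List Bool)} (hf : PT f) : PT fun x => rawGateOf (f x) := by
  unfold StackProg.rawGateOf
  fun_prop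

/-- The gate bound that the reduction uses: the product over all gates of one plus the sum of the
absolute values of the numerators of `a`, `b` and `c`. -/
def rawBound (L : List RawGate) : ℕ :=
  L.foldl (fun K g => K * (g.1.1.2.1 + g.1.2.1.2.1 + g.1.2.2.2.1 + 1)) 1

@[fun_prop]
theorem PT.rawBound {f : γ → List RawGate} (hf : PT f) : PT fun x => rawBound (f x) := by
  have h : PT fun g : RawGate => g.1.1.2.1 + g.1.2.1.2.1 + g.1.2.2.2.1 + 1 := by fun_prop
  obtain ⟨q, hq⟩ := h.sz_le
  refine PT.foldl (g := fun _ K (g : RawGate) => K * (g.1.1.2.1 + g.1.2.1.2.1 + g.1.2.2.2.1 + 1))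
    hf (PT.const 1) (by fun_prop) ⟨q, fun x s a => (sz_mul_le _ _).trans
      (Nat.add_le_add_left ((hq a).trans (eval_mono q (Nat.le_add_left _ _))) _)⟩

theorem sz_succ_le (n : ℕ) : sz (n + 1) ≤ sz n + 4 := by
  have h : sz (1 : ℕ) = 3 := rfl
  have := sz_add_le n 1
  omega

/-- The number of elements of a list. -/
def count {α : Type} (L : List α) : ℕ := L.foldl (fun k _ => k + 1) 0

@[fun_prop]
theorem PT.count {f : γ → List ι} (hf : PT f) : PT fun x => count (f x) :=
  PT.foldl (g := fun _ k _ => k + 1) hf (PT.const 0) (by fun_prop)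
    ⟨4, fun x s a => by simpa using sz_succ_le s⟩

/-- The data of the gates, with variables numbered as in the quadratic program of a circuit with `m`
gates. The first gate in the list has number `k`. -/
def gateDataFrom (m k : ℕ) (L : List RawGate) : List (GateData ℕ) :=
  emits (fun k _ => k + 1)
    (fun k g => [(g.1, g.2.1, g.2.2, k + 2, m + 2 + 2 * k, m + 2 + 2 * k + 1)]) k L

theorem PT.gateDataFrom {m : γ → ℕ} {f : γ → List RawGate} (hm : PT m) (hf : PT f) :
    PT fun x => StackProg.gateDataFrom (m x) 0 (f x) :=
  PT.emits (s := fun _ => 0) (g := fun _ k _ => k + 1) hf (PT.const 0) (by fun_prop) (by fun_prop)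
    (sz_foldl_bound hf (PT.const 0) ⟨4, fun x s a => by simpa using sz_succ_le s⟩)

/-- Numerator and denominator of the parameter `min {δ / 8K², 1 / 32K²}`, not reduced. The first term
is the smaller one if and only if `4 δ ≤ 1`. -/
def rawDelta (d : Frac) (K : ℕ) : ℕ × ℕ :=
  if decide (4 * d.2.1 ≤ d.2.2) = true then (d.2.1, d.2.2 * (8 * (K * K))) else (1, 32 * (K * K))

@[fun_prop]
theorem PT.rawDelta {d : γ → Frac} {K : γ → ℕ} (hd : PT d) (hK : PT K) :
    PT fun x => rawDelta (d x) (K x) := by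
  unfold StackProg.rawDelta
  fun_prop

/-- The code word of the quadratic program, from `δ` and the list of gates. -/
def qpWord (d : Frac) (L : List RawGate) : List Γ' :=
  (L.flatMap fun _ => [Γ'.bit true, Γ'.bit true, Γ'.bit true]) ++
    [Γ'.bit true, Γ'.bit true, Γ'.comma] ++
    encSeq ((qpTerms (rawBound L) (rawDelta d (rawBound L)).1 (rawDelta d (rawBound L)).2
      (count L + 1) (gateDataFrom (count L) 0 L)).map Mono.enc)

theorem PT.qpWord {d : γ → Frac} {L : γ → List RawGate} (hd : PT d) (hL : PT L) :
    PT fun x => StackProg.qpWord (d x) (L x) := by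
  have h1 : PT fun x => (L x).flatMap fun _ => [Γ'.bit true, Γ'.bit true, Γ'.bit true] :=
    PT.flatMap hL (by fun_prop)
  have h2 := PT.gateDataFrom hL.count hL
  have h3 := PT.qpTerms (K := fun x => StackProg.rawBound (L x))
    (u := fun x => (StackProg.rawDelta (d x) (StackProg.rawBound (L x))).1)
    (v := fun x => (StackProg.rawDelta (d x) (StackProg.rawBound (L x))).2)
    (yn := fun x => StackProg.count (L x) + 1) (by fun_prop)
    (by fun_prop) (by fun_prop) (by fun_prop) h2
  have h4 := PT.map (f := fun _ t => Mono.enc t) h3 (by fun_prop)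
  unfold StackProg.qpWord
  fun_prop

/-- The reduction on code words. -/
def reduceWord (w : List Γ') : List Γ' :=
  qpWord (fracOf ((tokens w).tail.tail.headD []) ((tokens w).tail.tail.tail.headD []))
    ((blocks (tokens w).tail.tail.tail.tail).map rawGateOf)

theorem PT.reduceWord : PT fun w : List Letter =>
    StackProg.reduceWord (w.map fun a => a.elim (fun c => c) fun c => c) := by
  have h : PT fun w : List Letter => w.map fun a => a.elim (fun c => c) fun c => c :=
    PT.map (f := fun _ (a : Letter) => a.elim (fun c => c) fun c => c) PT.id ((PT.of_letter_sum _).comp (by fun_prop))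
  exact PT.qpWord (by fun_prop) (PT.map (f := fun _ a => StackProg.rawGateOf a) (by fun_prop)
    (by fun_prop))

end StackProg

namespace StackProg

/-! ### Parsing code words -/

theorem tokensFrom_bits (s l : List Bool) (w : List Γ') :
    tokensFrom s (l.map Γ'.bit ++ Γ'.comma :: w) = (s.reverse ++ l) :: tokens w := by
  induction l generalizing s with
  | nil => simp [tokensFrom, tokens, emits, isComma, isBit]
  | cons b l ih =>
    have h := ih (b :: s)
    rw [List.reverse_cons, List.append_assoc] at h
    exact h

theorem tokens_bits (l : List Bool) (w : List Γ') :
    tokens (l.map Γ'.bit ++ Γ'.comma :: w) = l :: tokens w := tokensFrom_bits [] l w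

theorem tokens_bra (w : List Γ') : tokens (Γ'.bra :: w) = tokens w := rfl

/-- The words for the numerator and the denominator of a rational number. -/
def ratTokens (q : ℚ) : List (List Bool) :=
  [decide (q.num < 0) :: q.num.natAbs.bits, q.den.bits]

theorem encNat_eq (n : ℕ) : encNat n = n.bits.map Γ'.bit ++ [Γ'.comma] := by
  rw [encNat, encodeNat_eq_bits]

theorem encRat_eq (q : ℚ) : encRat q =
    (decide (q.num < 0) :: q.num.natAbs.bits).map Γ'.bit ++
      Γ'.comma :: (q.den.bits.map Γ'.bit ++ [Γ'.comma]) := by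
  simp [encRat, encInt, encNat_eq]

theorem tokens_encNat (n : ℕ) (w : List Γ') : tokens (encNat n ++ w) = n.bits :: tokens w := by
  rw [encNat_eq, List.append_assoc]
  exact tokens_bits _ _

theorem tokens_encRat (q : ℚ) (w : List Γ') : tokens (encRat q ++ w) = ratTokens q ++ tokens w := by
  rw [encRat_eq, List.append_assoc, List.cons_append, List.append_assoc, tokens_bits]
  exact congrArg _ (tokens_bits _ _)

theorem tokens_encSeq {α : Type} (e : α → List Γ') (f : α → List (List Bool))
    (h : ∀ a w, tokens (e a ++ w) = f a ++ tokens w) (l : List α) :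
    tokens (encSeq (l.map e)) = l.flatMap f := by
  induction l with
  | nil => rfl
  | cons a l ih => rw [List.map_cons, encSeq, tokens_bra, h, ih, List.flatMap_cons]

/-- A rational number as a fraction. -/
def fracOfRat (q : ℚ) : Frac := (decide (q.num < 0), q.num.natAbs, q.den)

/-- The words for a gate. -/
def gateTokens {k : ℕ} (g : Gate k) : List (List Bool) :=
  ratTokens g.a ++ (ratTokens g.b ++ (ratTokens g.c ++ [(g.l : ℕ).bits, (g.r : ℕ).bits]))

/-- A gate with its coefficients as fractions and its input variables as plain numbers. -/
def rawGate {k : ℕ} (g : Gate k) : RawGate :=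
  ((fracOfRat g.a, fracOfRat g.b, fracOfRat g.c), g.l, g.r)

/-- The gates of a circuit. -/
def rawGates (C : Circuit) : List RawGate := List.ofFn fun k => rawGate (C.gate k)

theorem tokens_encGate {k : ℕ} (g : Gate k) (w : List Γ') :
    tokens (encGate g ++ w) = gateTokens g ++ tokens w := by
  simp only [encGate, gateTokens, List.append_assoc, tokens_encRat, tokens_encNat]
  rfl

theorem blocks_gateTokens {k : ℕ} (g : Gate k) (w : List (List Bool)) :
    blocks (gateTokens g ++ w) = (gateTokens g).reverse :: blocks w := rfl

theorem rawGateOf_gateTokens {k : ℕ} (g : Gate k) :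
    rawGateOf (gateTokens g).reverse = rawGate g := by
  simp [gateTokens, ratTokens, rawGateOf, fracOf, rawGate, fracOfRat, ofBits_bits]

theorem blocks_flatMap_gateTokens (L : List (Σ k, Gate k)) :
    (blocks (L.flatMap fun g => gateTokens g.2)).map rawGateOf = L.map fun g => rawGate g.2 := by
  induction L with
  | nil => rfl
  | cons g L ih =>
    rw [List.flatMap_cons, blocks_gateTokens, List.map_cons, ih, rawGateOf_gateTokens, List.map_cons]

theorem tokens_encLinearInstance (I : LinearInstance) : tokens (encLinearInstance I) =
    ratTokens I.ε ++ (ratTokens I.δ ++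
      (List.ofFn fun k => (⟨_, I.circuit.gate k⟩ : Σ k, Gate k)).flatMap
        fun g => gateTokens g.2) := by
  rw [encLinearInstance, tokens_encRat, tokens_encRat, encCircuit]
  congr 2
  have h : (List.ofFn fun k => encGate (I.circuit.gate k)) =
      (List.ofFn fun k => (⟨_, I.circuit.gate k⟩ : Σ k, Gate k)).map fun g => encGate g.2 := by
    rw [List.map_ofFn]
    rfl
  rw [h]
  exact tokens_encSeq _ _ (fun g w => tokens_encGate g.2 w) _

/-- Parsing recovers `δ` and the gates from the code word of an instance. -/
theorem reduceWord_encLinearInstance (I : LinearInstance) :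
    reduceWord (encLinearInstance I) = qpWord (fracOfRat I.δ) (rawGates I.circuit) := by
  rw [reduceWord, tokens_encLinearInstance]
  have h := blocks_flatMap_gateTokens
    (List.ofFn fun k => (⟨_, I.circuit.gate k⟩ : Σ k, Gate k))
  rw [List.map_ofFn] at h
  refine congrArg₂ qpWord ?_ h
  simp [ratTokens, fracOf, fracOfRat, ofBits_bits]

/-- The code word of a rational number, from the words for its numerator and denominator. -/
def ratWord (n d : List Bool) : List Γ' :=
  n.map Γ'.bit ++ Γ'.comma :: (d.map Γ'.bit ++ [Γ'.comma])

/-- The code word of the first two entries of a vector, from the words of its entries. -/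
def firstTwo (t : List (List Bool)) : List Γ' :=
  (if t.isEmpty = true then [] else Γ'.bra :: ratWord (t.headD []) (t.tail.headD [])) ++
  ((if t.tail.tail.isEmpty = true then [] else
    Γ'.bra :: ratWord (t.tail.tail.headD []) (t.tail.tail.tail.headD [])) ++ [Γ'.ket])

theorem firstTwo_ratTokens (s : List ℚ) :
    firstTwo (s.flatMap ratTokens) = encVector (s.take 2) := by
  rcases s with _ | ⟨q, _ | ⟨r, s⟩⟩ <;>
    simp [firstTwo, encVector, encSeq, encRat_eq, ratWord, ratTokens]

/-- The part of a word over the disjoint union that belongs to the second alphabet. -/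
def secondPart (w : List Letter) : List Γ' := w.flatMap fun a => a.elim (fun _ => []) fun c => [c]

theorem secondPart_append (v w : List Γ') :
    secondPart (v.map Sum.inl ++ w.map Sum.inr) = w := by
  simp [secondPart, List.flatMap_map]

theorem PT.ratWord {γ : Type} [Enc γ] {f g : γ → List Bool} (hf : PT f) (hg : PT g) :
    PT fun x => ratWord (f x) (g x) := by
  have h1 : PT fun x => (f x).map Γ'.bit := PT.map (f := fun _ b => Γ'.bit b) hf (by fun_prop)
  have h2 : PT fun x => (g x).map Γ'.bit := PT.map (f := fun _ b => Γ'.bit b) hg (by fun_prop)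
  unfold StackProg.ratWord
  fun_prop

attribute [fun_prop] PT.ratWord

theorem polyTime_firstTwo : PT fun w : List Letter => firstTwo (tokens (secondPart w)) := by
  have h : PT fun w : List Letter => secondPart w :=
    PT.flatMap (f := fun _ (a : Letter) => a.elim (fun _ => []) fun c => [c]) PT.id
      ((PT.of_letter_sum _).comp (by fun_prop))
  unfold firstTwo
  fun_prop

/-- Reading off the first two coordinates takes polynomial time. -/
theorem take_two_computable : Nonempty (TM2ComputableInPolyTime
    (fun x : LinearInstance × List ℚ => (encLinearInstance x.1).map (Sum.inl : Γ' → Γ' ⊕ Γ')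
      ++ (encVector x.2).map Sum.inr) encVector fun x => x.2.take 2) := by
  refine polyTime_firstTwo.tm2Computable (fun a => a) fun x => ?_
  rw [List.map_id', secondPart_append, ← firstTwo_ratTokens, encVector]
  exact congrArg _ (tokens_encSeq _ _ (fun q w => tokens_encRat q w) _)

end StackProg

namespace StackProg

/-! ### Renaming of variables -/

/-- Everything that is emitted is renamed if the renaming commutes with the step and with the words
emitted. -/
theorem emits_map {α β σ α' β' : Type} {g : σ → α → σ} {e : σ → α → List β} {g' : σ → α' → σ}
    {e' : σ → α' → List β'} (φ : β → β') (ψ : α → α') (hg : ∀ s a, g' s (ψ a) = g s a)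
    (he : ∀ s a, e' s (ψ a) = (e s a).map φ) (s : σ) (l : List α) :
    (emits g e s l).map φ = emits g' e' s (l.map ψ) := by
  induction l generalizing s with
  | nil => rfl
  | cons a l ih => simp [emits, ih, hg, he]

/-- Renames the variables of a monomial. -/
def Mono.map {ι κ : Type} (f : ι → κ) (t : Mono ι) : Mono κ := (t.1, t.2.map f)

/-- Renames the variables of a gate. -/
def GateData.map {ι κ : Type} (f : ι → κ) (g : GateData ι) : GateData κ :=
  (g.1, f g.2.1, f g.2.2.1, f g.2.2.2.1, f g.2.2.2.2.1, f g.2.2.2.2.2)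

theorem Mono.split_map {ι κ : Type} (f : ι → κ) (t : Mono ι) :
    t.split.map (Mono.map f) = (t.map f).split := by
  have h := emits_map (g := fun s (_ : Bool) => splitStep s) (g' := fun s (_ : Bool) => splitStep s)
    (e := fun s b => if b = true then [((t.1.1, s), t.2)] else [])
    (e' := fun s b => if b = true then [(((t.map f).1.1, s), (t.map f).2)] else [])
    (Mono.map f) (fun b => b) (fun _ _ => rfl) (fun s b => by cases b <;> rfl) (1, t.1.2.2)
    t.1.2.1.bits
  rw [List.map_id'] at h
  exact h

theorem Mono.mul_map {ι κ : Type} (f : ι → κ) (s t : Mono ι) :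
    (s.mul t).map f = (s.map f).mul (t.map f) := by
  simp [Mono.mul, Mono.map]

theorem GateData.monos_map {ι κ : Type} (f : ι → κ) (K : ℕ) (g : GateData ι) :
    (g.monos K).map (Mono.map f) = (g.map f).monos K := by
  simp [GateData.monos, GateData.residual, Mono.mul, Mono.map, GateData.map]

theorem qpMonos_map {ι κ : Type} (f : ι → κ) (K u v : ℕ) (yn : ι) (L : List (GateData ι)) :
    (qpMonos K u v yn L).map (Mono.map f) = qpMonos K u v (f yn) (L.map (GateData.map f)) := by
  rw [qpMonos, qpMonos, List.map_append, List.foldl_map]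
  congr 1
  refine emits_map (g := fun s (_ : GateData ι) => (s.1 * u, s.2 * v))
    (g' := fun s (_ : GateData κ) => (s.1 * u, s.2 * v))
    (e := fun s g => (g.monos K).map fun t => Mono.mul ((false, s), []) t)
    (e' := fun s g => (g.monos K).map fun t => Mono.mul ((false, s), []) t)
    (Mono.map f) (GateData.map f) (fun _ _ => rfl) (fun s g => ?_) _ _
  rw [← GateData.monos_map, List.map_map, List.map_map]
  refine List.map_congr_left fun t _ => ?_
  rw [Function.comp_apply, Function.comp_apply, Mono.mul_map]
  rfl

/-- The program works with variables that are plain numbers; the terms of a polynomial in `N` variables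
are obtained from elements of `Fin N` by the same construction. -/
theorem qpTerms_map {ι κ : Type} (f : ι → κ) (K u v : ℕ) (yn : ι) (L : List (GateData ι)) :
    (qpTerms K u v yn L).map (Mono.map f) = qpTerms K u v (f yn) (L.map (GateData.map f)) := by
  rw [qpTerms, qpTerms, ← qpMonos_map, List.map_flatMap, List.flatMap_map]
  simp only [Mono.split_map]

/-! ### Reduced coefficients -/

/-- The rational number that a fraction stands for. -/
def Frac.val (c : Frac) : ℚ := (if c.1 = true then -1 else 1) * ((c.2.1 : ℚ) / c.2.2)

/-- A nonzero fraction in lowest terms. -/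
def Frac.IsReduced (c : Frac) : Prop := 0 < c.2.1 ∧ 0 < c.2.2 ∧ c.2.1.Coprime c.2.2

/-- The code word of a rational number given by a reduced fraction. -/
theorem encRat_val {c : Frac} (h : c.IsReduced) :
    encRat c.val = Γ'.bit c.1 :: (encNat c.2.1 ++ encNat c.2.2) := by
  obtain ⟨s, n, d⟩ := c
  obtain ⟨h1, h2, h3⟩ := h
  simp only at h1 h2 h3
  have hval : Frac.val (s, n, d) = ((if s = true then -(n : ℤ) else n : ℤ) : ℚ) / ((d : ℤ) : ℚ) := by
    cases s <;> simp [Frac.val, neg_div]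
  have hco : Nat.Coprime (if s = true then -(n : ℤ) else n : ℤ).natAbs (d : ℤ).natAbs := by
    cases s <;> simpa using h3
  have hd : (0 : ℤ) < d := by exact_mod_cast h2
  have hnum := Rat.num_div_eq_of_coprime hd hco
  have hden := Rat.den_div_eq_of_coprime hd hco
  rw [← hval] at hnum hden
  have hden' : (Frac.val (s, n, d)).den = d := by exact_mod_cast hden
  rw [encRat, encInt, hnum, hden', List.cons_append]
  cases s <;> simp; omega

/-- Doubling a reduced fraction gives a reduced fraction: if the denominator is even, the two is
cancelled, and otherwise it is prime to the denominator. -/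
theorem splitStep_reduced {s : ℕ × ℕ} (h : 0 < s.1 ∧ 0 < s.2 ∧ s.1.Coprime s.2) :
    0 < (splitStep s).1 ∧ 0 < (splitStep s).2 ∧ (splitStep s).1.Coprime (splitStep s).2 := by
  obtain ⟨p, v⟩ := s
  obtain ⟨hp, hv, hc⟩ := h
  simp only at hp hv hc
  have hv2 := Nat.bodd_add_div2 v
  unfold splitStep
  cases hb : v.bodd with
  | true =>
    have hodd : Nat.Coprime 2 v := by
      rw [Nat.coprime_two_left, Nat.odd_iff]
      rw [hb] at hv2
      simp at hv2
      omega
    simp only [if_true]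
    exact ⟨by simp [Nat.bit]; omega, hv, by simpa [Nat.bit] using Nat.Coprime.mul_left hodd hc⟩
  | false =>
    rw [hb] at hv2
    simp only [Bool.false_eq_true, if_false]
    simp at hv2
    exact ⟨hp, by omega, hc.coprime_dvd_right ⟨2, by omega⟩⟩

theorem Mono.split_reduced {ι : Type} {t : Mono ι} (ht : 0 < t.1.2.2) {t' : Mono ι}
    (h : t' ∈ t.split) : Frac.IsReduced t'.1 ∧ t'.2 = t.2 := by
  have key : ∀ (l : List Bool) (s : ℕ × ℕ), 0 < s.1 ∧ 0 < s.2 ∧ s.1.Coprime s.2 →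
      t' ∈ emits (fun s _ => splitStep s)
        (fun s b => if b = true then [((t.1.1, s), t.2)] else []) s l →
      Frac.IsReduced t'.1 ∧ t'.2 = t.2 := by
    intro l
    induction l with
    | nil => intro s _ h; simp [emits] at h
    | cons b l ih =>
      intro s hs h
      rw [emits, List.mem_append] at h
      rcases h with h | h
      · cases b
        · simp at h
        · simp at h
          rw [h]
          exact ⟨hs, rfl⟩
      · exact ih _ (splitStep_reduced hs) h
  exact key _ (1, t.1.2.2) ⟨one_pos, ht, Nat.coprime_one_left _⟩ h

theorem GateData.mem_monos {ι : Type} {K : ℕ} {g : GateData ι} (ha : 0 < g.1.1.2.2)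
    (hb : 0 < g.1.2.1.2.2) (hc : 0 < g.1.2.2.2.2) {t : Mono ι} (h : t ∈ g.monos K) :
    0 < t.1.2.2 ∧ t.2.length ≤ 2 := by
  have hres : ∀ s ∈ g.residual K, 0 < s.1.2.2 ∧ s.2.length ≤ 1 := by
    intro s hs
    simp only [GateData.residual, List.mem_cons, List.not_mem_nil, or_false] at hs
    rcases hs with rfl | rfl | rfl | rfl | rfl | rfl <;> simp [ha, hb, hc]
  rw [GateData.monos, List.mem_append] at h
  rcases h with h | h
  · obtain ⟨s, hs, h⟩ := List.mem_flatMap.1 h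
    obtain ⟨s', hs', rfl⟩ := List.mem_map.1 h
    refine ⟨Nat.mul_pos (hres s hs).1 (hres s' hs').1, ?_⟩
    have h1 := (hres s hs).2
    have h2 := (hres s' hs').2
    simp only [Mono.mul, List.length_append]
    omega
  · simp only [List.mem_cons, List.not_mem_nil, or_false] at h
    rcases h with rfl | rfl | rfl | rfl <;> simp

theorem mem_emits {α β σ : Type} {g : σ → α → σ} {e : σ → α → List β} {P : σ → Prop}
    {Q : β → Prop} {l : List α} (hg : ∀ s, ∀ a ∈ l, P s → P (g s a))
    (he : ∀ s, ∀ a ∈ l, P s → ∀ b ∈ e s a, Q b) {s : σ} (hs : P s) {b : β}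
    (hb : b ∈ emits g e s l) : Q b := by
  induction l generalizing s with
  | nil => simp [emits] at hb
  | cons a l ih =>
    rw [emits, List.mem_append] at hb
    rcases hb with hb | hb
    · exact he s a List.mem_cons_self hs b hb
    · exact ih (fun s a ha => hg s a (List.mem_cons_of_mem _ ha))
        (fun s a ha => he s a (List.mem_cons_of_mem _ ha)) (hg s a List.mem_cons_self hs) hb

theorem foldl_mul_pos {α : Type} {u v : ℕ} (hv : 0 < v) (L : List α) (s : ℕ × ℕ) (hs : 0 < s.2) :
    0 < (L.foldl (fun s _ => (s.1 * u, s.2 * v)) s).2 := by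
  induction L generalizing s with
  | nil => exact hs
  | cons a L ih => exact ih _ (Nat.mul_pos hs hv)

theorem mem_qpMonos {ι : Type} {K u v : ℕ} (hv : 0 < v) {yn : ι} {L : List (GateData ι)}
    (hL : ∀ g ∈ L, 0 < g.1.1.2.2 ∧ 0 < g.1.2.1.2.2 ∧ 0 < g.1.2.2.2.2) {t : Mono ι}
    (h : t ∈ qpMonos K u v yn L) : 0 < t.1.2.2 ∧ t.2.length ≤ 2 := by
  have hv3 : 0 < v * v * v := Nat.mul_pos (Nat.mul_pos hv hv) hv
  rw [qpMonos, List.mem_append] at h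
  rcases h with h | h
  · refine mem_emits (P := fun s : ℕ × ℕ => 0 < s.2) (Q := fun t => 0 < t.1.2.2 ∧ t.2.length ≤ 2)
      (fun s _ _ hs => Nat.mul_pos hs hv) ?_ (s := (u * u * u, v * v * v)) hv3 h
    intro s g hg hs b hb
    obtain ⟨c, hc, rfl⟩ := List.mem_map.1 hb
    have h1 := GateData.mem_monos (hL g hg).1 (hL g hg).2.1 (hL g hg).2.2 hc
    exact ⟨Nat.mul_pos hs h1.1, by simpa [Mono.mul] using h1.2⟩
  · rw [List.mem_singleton] at h
    rw [h]
    exact ⟨foldl_mul_pos hv _ (u * u * u, v * v * v) hv3, by simp⟩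

theorem mem_qpTerms {ι : Type} {K u v : ℕ} (hv : 0 < v) {yn : ι} {L : List (GateData ι)}
    (hL : ∀ g ∈ L, 0 < g.1.1.2.2 ∧ 0 < g.1.2.1.2.2 ∧ 0 < g.1.2.2.2.2) {t : Mono ι}
    (h : t ∈ qpTerms K u v yn L) : Frac.IsReduced t.1 ∧ t.2.length ≤ 2 := by
  obtain ⟨t', ht', h⟩ := List.mem_flatMap.1 h
  have key := mem_qpMonos hv hL ht'
  obtain ⟨h1, h2⟩ := Mono.split_reduced key.1 h
  exact ⟨h1, h2 ▸ key.2⟩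

/-! ### The polynomial that a list of monomials stands for -/

section Poly

open MvPolynomial

variable {N : ℕ}

/-- A monomial with at most two variables, as a term of a quadratic polynomial. -/
def Mono.toQTerm (t : Mono (Fin N)) : QTerm N :=
  match t.2 with
  | [] => .const (Frac.val t.1)
  | [i] => .linear (Frac.val t.1) i
  | i :: j :: _ => .quadratic (Frac.val t.1) i j

/-- The polynomial of a monomial. -/
noncomputable def Mono.poly (t : Mono (Fin N)) : MvPolynomial (Fin N) ℚ :=
  C (Frac.val t.1) * (t.2.map X).prod

/-- The sum of a list of monomials. -/
noncomputable def sumPoly (L : List (Mono (Fin N))) : MvPolynomial (Fin N) ℚ := (L.map Mono.poly).sum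

theorem encQTerm_toQTerm {t : Mono (Fin N)} (h : Frac.IsReduced t.1) (h2 : t.2.length ≤ 2) :
    encQTerm t.toQTerm = (t.map Fin.val).enc := by
  obtain ⟨c, l⟩ := t
  have hc := encRat_val h
  rcases l with _ | ⟨i, _ | ⟨j, _ | ⟨k, l⟩⟩⟩
  · simp [Mono.toQTerm, encQTerm, Mono.enc, Mono.map, hc]
  · simp [Mono.toQTerm, encQTerm, Mono.enc, Mono.map, hc]
  · simp [Mono.toQTerm, encQTerm, Mono.enc, Mono.map, hc]
  · simp at h2

theorem toPoly_toQTerm {t : Mono (Fin N)} (h2 : t.2.length ≤ 2) : t.toQTerm.toPoly = t.poly := by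
  obtain ⟨c, l⟩ := t
  rcases l with _ | ⟨i, _ | ⟨j, _ | ⟨k, l⟩⟩⟩
  · simp [Mono.toQTerm, QTerm.toPoly, Mono.poly]
  · simp [Mono.toQTerm, QTerm.toPoly, Mono.poly]
  · simp [Mono.toQTerm, QTerm.toPoly, Mono.poly, mul_assoc]
  · simp at h2

theorem Mono.poly_mul (s t : Mono (Fin N)) : (s.mul t).poly = s.poly * t.poly := by
  have h : Frac.val (s.mul t).1 = Frac.val s.1 * Frac.val t.1 := by
    obtain ⟨⟨a, n, d⟩, l⟩ := s
    obtain ⟨⟨a', n', d'⟩, l'⟩ := t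
    cases a <;> cases a' <;> simp [Mono.mul, Frac.val, mul_div_mul_comm]
  rw [Mono.poly, h, Mono.mul, List.map_append, List.prod_append, C_mul, Mono.poly, Mono.poly]
  ring

@[simp] theorem sumPoly_nil : sumPoly ([] : List (Mono (Fin N))) = 0 := rfl

@[simp] theorem sumPoly_cons (t : Mono (Fin N)) (L) : sumPoly (t :: L) = t.poly + sumPoly L := by
  simp [sumPoly]

@[simp] theorem sumPoly_append (L L' : List (Mono (Fin N))) :
    sumPoly (L ++ L') = sumPoly L + sumPoly L' := by
  simp [sumPoly]

theorem sumPoly_map_mul (s : Mono (Fin N)) (L) :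
    sumPoly (L.map fun t => s.mul t) = s.poly * sumPoly L := by
  induction L with
  | nil => simp
  | cons t L ih => simp [ih, Mono.poly_mul, mul_add]

theorem sumPoly_flatMap_mul (L L' : List (Mono (Fin N))) :
    sumPoly (L.flatMap fun s => L'.map fun t => s.mul t) = sumPoly L * sumPoly L' := by
  induction L with
  | nil => simp
  | cons s L ih => rw [List.flatMap_cons, sumPoly_append, ih, sumPoly_map_mul, sumPoly_cons, add_mul]

/-- Splitting a coefficient along the binary digits of its numerator does not change the polynomial. -/
theorem sumPoly_split {t : Mono (Fin N)} (ht : 0 < t.1.2.2) : sumPoly t.split = t.poly := by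
  have key : ∀ (l : List Bool) (s : ℕ × ℕ), 0 < s.2 →
      sumPoly (emits (fun s _ => splitStep s)
        (fun s b => if b = true then [((t.1.1, s), t.2)] else []) s l) =
      C ((if t.1.1 = true then -1 else 1) * (ofBits l * (s.1 / s.2) : ℚ)) * (t.2.map X).prod := by
    intro l
    induction l with
    | nil => intro s _; simp [emits]
    | cons b l ih =>
      intro s hs
      have hpos : 0 < (splitStep s).2 := by
        unfold splitStep
        have := Nat.bodd_add_div2 s.2
        cases hb : s.2.bodd with
        | true => simpa [hb] using hs
        | false => simp [hb] at this ⊢; omega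
      have hval : ((splitStep s).1 : ℚ) / (splitStep s).2 = 2 * (s.1 / s.2) := by
        unfold splitStep
        have := Nat.bodd_add_div2 s.2
        cases hb : s.2.bodd with
        | true => simp [Nat.bit, mul_div_assoc]
        | false =>
          simp [hb] at this ⊢
          have h2 : (s.2 : ℚ) = 2 * s.2.div2 := by exact_mod_cast this.symm
          rw [h2]
          have h3 : (s.2.div2 : ℚ) ≠ 0 := by
            have : s.2.div2 ≠ 0 := by omega
            exact_mod_cast this
          field_simp
      rw [emits, sumPoly_append, ih _ hpos, hval, ofBits_cons]
      have hbit : ((Nat.bit b (ofBits l) : ℕ) : ℚ) = (if b = true then 1 else 0) + 2 * ofBits l := by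
        cases b <;> simp [Nat.bit, add_comm]
      rw [hbit]
      have hhead : sumPoly (if b = true then [((t.1.1, s), t.2)] else []) =
          C ((if t.1.1 = true then -1 else 1) * ((if b = true then 1 else 0) * (s.1 / s.2) : ℚ)) *
            (t.2.map X).prod := by
        cases b <;> simp [Mono.poly, Frac.val]
      rw [hhead, ← add_mul, ← C_add]
      congr 2
      ring
  rw [Mono.split, key _ (1, t.1.2.2) ht, ofBits_bits, Mono.poly, Frac.val]
  simp [div_eq_mul_inv]

theorem sumPoly_flatMap_split {L : List (Mono (Fin N))} (hL : ∀ t ∈ L, 0 < t.1.2.2) :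
    sumPoly (L.flatMap Mono.split) = sumPoly L := by
  induction L with
  | nil => rfl
  | cons t L ih =>
    rw [List.flatMap_cons, sumPoly_append, ih fun t ht => hL t (List.mem_cons_of_mem _ ht),
      sumPoly_split (hL t List.mem_cons_self), sumPoly_cons]

theorem val_not (c : Frac) : Frac.val (!c.1, c.2) = -Frac.val c := by
  obtain ⟨s, n, d⟩ := c
  cases s <;> simp [Frac.val]

theorem sumPoly_monos (K : ℕ) (g : GateData (Fin N)) : sumPoly (g.monos K) =
    (X g.2.2.2.1 + C (K : ℚ) * X g.2.2.2.2.1 - C (K : ℚ) * X g.2.2.2.2.2 -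
        (C (Frac.val g.1.1) * X g.2.1 + C (Frac.val g.1.2.1) * X g.2.2.1) -
        C (Frac.val g.1.2.2)) ^ 2
      + C (2 * (K : ℚ) ^ 2) * X g.2.2.2.2.1 * X g.2.2.2.2.2
      + C (2 * (K : ℚ)) * X g.2.2.2.2.1 * (1 - X g.2.2.2.1)
      + C (2 * (K : ℚ)) * X g.2.2.2.2.2 * X g.2.2.2.1 := by
  have hres : sumPoly (g.residual K) = X g.2.2.2.1 + C (K : ℚ) * X g.2.2.2.2.1 -
      C (K : ℚ) * X g.2.2.2.2.2 - (C (Frac.val g.1.1) * X g.2.1 + C (Frac.val g.1.2.1) * X g.2.2.1)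
      - C (Frac.val g.1.2.2) := by
    have h1 : Frac.val (false, 1, 1) = 1 := by simp [Frac.val]
    have h2 : Frac.val (false, K, 1) = K := by simp [Frac.val]
    have h3 : Frac.val (true, K, 1) = -K := by simp [Frac.val]
    simp only [GateData.residual, sumPoly_cons, sumPoly_nil, Mono.poly, val_not, h1, h2, h3,
      List.map_cons, List.map_nil, List.prod_cons, List.prod_nil, C_neg, C_1]
    ring
  rw [GateData.monos, sumPoly_append, sumPoly_flatMap_mul, hres]
  have h1 : Frac.val (false, 2 * (K * K), 1) = 2 * (K : ℚ) ^ 2 := by simp [Frac.val]; ring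
  have h2 : Frac.val (false, 2 * K, 1) = 2 * K := by simp [Frac.val]
  have h3 : Frac.val (true, 2 * K, 1) = -(2 * K) := by simp [Frac.val]
  simp only [sumPoly_cons, sumPoly_nil, Mono.poly, h1, h2, h3, List.map_cons, List.map_nil,
    List.prod_cons, List.prod_nil, C_neg]
  ring

theorem sumPoly_emits_gates (u v : ℕ) (E : GateData (Fin N) → List (Mono (Fin N))) {m : ℕ}
    (f : Fin m → GateData (Fin N)) (s : ℕ × ℕ) :
    sumPoly (emits (fun s _ => (s.1 * u, s.2 * v))
      (fun s g => (E g).map fun t => Mono.mul ((false, s), []) t) s (List.ofFn f)) =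
    ∑ k : Fin m, C ((s.1 / s.2 : ℚ) * (u / v : ℚ) ^ (k : ℕ)) * sumPoly (E (f k)) := by
  induction m generalizing s with
  | zero => simp [emits]
  | succ m ih =>
    rw [List.ofFn_succ, emits, sumPoly_append, ih, Fin.sum_univ_succ, sumPoly_map_mul]
    congr 1
    · simp [Mono.poly, Frac.val]
    · refine Finset.sum_congr rfl fun k _ => ?_
      congr 2
      push_cast
      rw [mul_div_mul_comm, Fin.val_succ, pow_succ']
      ring

theorem foldl_div (u v : ℕ) {α : Type} (L : List α) (s : ℕ × ℕ) :
    (((L.foldl (fun s _ => (s.1 * u, s.2 * v)) s).1 : ℚ) /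
      (L.foldl (fun s _ => (s.1 * u, s.2 * v)) s).2) = (s.1 / s.2) * (u / v) ^ L.length := by
  induction L generalizing s with
  | nil => simp
  | cons a L ih =>
    rw [List.foldl_cons, ih]
    push_cast
    rw [mul_div_mul_comm, List.length_cons, pow_succ']
    ring

end Poly

end StackProg

namespace StackProg

/-! ### The quadratic program as a list of monomials -/

theorem val_fracOfRat (q : ℚ) : Frac.val (fracOfRat q) = q := by
  have h := Rat.num_div_den q
  rw [fracOfRat, Frac.val]
  rcases lt_or_ge q.num 0 with hn | hn
  · have h2 : ((q.num.natAbs : ℕ) : ℚ) = -(q.num : ℚ) := by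
      rw [Nat.cast_natAbs, abs_of_neg hn, Int.cast_neg]
    simp only [hn, decide_true, if_true, h2]
    rw [neg_div, neg_one_mul, neg_neg, h]
  · have h2 : ((q.num.natAbs : ℕ) : ℚ) = (q.num : ℚ) := by
      rw [Nat.cast_natAbs, abs_of_nonneg hn]
    simp only [not_lt.2 hn, decide_false, Bool.false_eq_true, if_false, h2]
    rw [one_mul, h]

theorem abs_le_natAbs_num (q : ℚ) : |q| ≤ q.num.natAbs := by
  have h1 : (1 : ℚ) ≤ q.den := by exact_mod_cast q.den_pos
  rw [← Rat.num_div_den q, abs_div, Nat.abs_cast, Rat.num_div_den, Nat.cast_natAbs, Int.cast_abs]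
  exact div_le_self (abs_nonneg _) h1

/-- The gate bound that the reduction uses for a circuit. -/
def gateBound (C : Circuit) : ℕ := rawBound (rawGates C)

theorem rawBound_pos_and_le (L : List RawGate) : 1 ≤ rawBound L ∧
    ∀ g ∈ L, g.1.1.2.1 + g.1.2.1.2.1 + g.1.2.2.2.1 ≤ rawBound L := by
  have key : ∀ (L : List RawGate) (K : ℕ), 1 ≤ K →
      K ≤ L.foldl (fun K g => K * (g.1.1.2.1 + g.1.2.1.2.1 + g.1.2.2.2.1 + 1)) K ∧
      ∀ g ∈ L, g.1.1.2.1 + g.1.2.1.2.1 + g.1.2.2.2.1 ≤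
        L.foldl (fun K g => K * (g.1.1.2.1 + g.1.2.1.2.1 + g.1.2.2.2.1 + 1)) K := by
    intro L
    induction L with
    | nil => intro K hK; simp
    | cons g L ih =>
      intro K hK
      have h1 : K ≤ K * (g.1.1.2.1 + g.1.2.1.2.1 + g.1.2.2.2.1 + 1) := Nat.le_mul_of_pos_right _
        (Nat.succ_pos _)
      have h2 : g.1.1.2.1 + g.1.2.1.2.1 + g.1.2.2.2.1 + 1 ≤
          K * (g.1.1.2.1 + g.1.2.1.2.1 + g.1.2.2.2.1 + 1) := Nat.le_mul_of_pos_left _ hK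
      obtain ⟨h3, h4⟩ := ih _ (hK.trans h1)
      refine ⟨h1.trans h3, fun g' hg' => ?_⟩
      rcases List.mem_cons.1 hg' with rfl | hg'
      · exact (Nat.le_of_succ_le h2).trans h3
      · exact h4 g' hg'
  exact key L 1 le_rfl

theorem sum_abs_coeff_le (C : Circuit) (k : Fin C.m) :
    ∑ j, |C.coeff k j| ≤ |(C.gate k).a| + |(C.gate k).b| := by
  calc ∑ j, |C.coeff k j| ≤ ∑ j, ((if j = (C.gate k).l then |(C.gate k).a| else 0) +
        (if j = (C.gate k).r then |(C.gate k).b| else 0)) := by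
        refine Finset.sum_le_sum fun j _ => (abs_add_le _ _).trans (le_of_eq ?_)
        rw [apply_ite abs, apply_ite abs, abs_zero]
    _ = _ := by rw [Finset.sum_add_distrib, Finset.sum_ite_eq', Finset.sum_ite_eq']; simp

theorem isGateBound_gateBound (C : Circuit) : C.IsGateBound (gateBound C : ℚ) := by
  obtain ⟨h1, h2⟩ := rawBound_pos_and_le (rawGates C)
  refine ⟨by exact_mod_cast h1, fun k => ?_⟩
  have h3 := h2 (rawGate (C.gate k)) (List.mem_ofFn.2 ⟨k, rfl⟩)
  have h4 : (((C.gate k).a.num.natAbs + (C.gate k).b.num.natAbs + (C.gate k).c.num.natAbs : ℕ) : ℚ)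
      ≤ gateBound C := by exact_mod_cast h3
  push_cast at h4
  have h5 := sum_abs_coeff_le C k
  have ha := abs_le_natAbs_num (C.gate k).a
  have hb := abs_le_natAbs_num (C.gate k).b
  have hc := abs_le_natAbs_num (C.gate k).c
  linarith

theorem rawDelta_spec (I : LinearInstance) {K : ℕ} (hK : 1 ≤ K) :
    0 < (rawDelta (fracOfRat I.δ) K).2 ∧
    ((rawDelta (fracOfRat I.δ) K).1 : ℚ) / (rawDelta (fracOfRat I.δ) K).2 = I.qpDelta K := by
  have hd : (0 : ℚ) < I.δ.den := by exact_mod_cast I.δ.den_pos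
  have hK' : (0 : ℚ) < K := by exact_mod_cast hK
  have hn : ((I.δ.num.natAbs : ℕ) : ℚ) = I.δ.num := by
    rw [Nat.cast_natAbs, abs_of_nonneg (Rat.num_pos.2 I.δ_pos).le]
  have hq := Rat.num_div_den I.δ
  have hle : 4 * I.δ.num.natAbs ≤ I.δ.den ↔ I.δ ≤ 1 / 4 := by
    rw [← Nat.cast_le (α := ℚ), Nat.cast_mul, hn]
    nth_rewrite 3 [← hq]
    rw [div_le_div_iff₀ hd (by norm_num)]
    norm_num [mul_comm]
  rw [rawDelta, LinearInstance.qpDelta, fracOfRat]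
  by_cases h : I.δ ≤ 1 / 4
  · simp only [hle.2 h, decide_true, if_true]
    refine ⟨by have := I.δ.den_pos; positivity, ?_⟩
    rw [min_eq_left]
    · push_cast
      rw [hn, ← div_div, hq, sq]
    · rw [div_le_div_iff₀ (by positivity) (by positivity)]
      nlinarith [sq_nonneg (K : ℚ)]
  · simp only [mt hle.1 h, decide_false, Bool.false_eq_true, if_false]
    refine ⟨by positivity, ?_⟩
    rw [min_eq_right]
    · push_cast
      rw [sq]
    · rw [div_le_div_iff₀ (by positivity) (by positivity)]
      nlinarith [sq_nonneg (K : ℚ), not_le.1 h]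

/-- The data of the gates of a circuit. -/
def gateData (C : Circuit) : List (GateData (Fin (3 * C.m + 2))) :=
  List.ofFn fun k => ((fracOfRat (C.gate k).a, fracOfRat (C.gate k).b, fracOfRat (C.gate k).c),
    C.yIdx (C.earlier k (C.gate k).l), C.yIdx (C.earlier k (C.gate k).r), C.yIdx (C.gateVar k),
    C.zPosIdx k, C.zNegIdx k)

theorem gateDataFrom_ofFn (m k : ℕ) {n : ℕ} (f : Fin n → RawGate) :
    gateDataFrom m k (List.ofFn f) = List.ofFn fun i : Fin n => ((f i).1, (f i).2.1, (f i).2.2,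
      k + i + 2, m + 2 + 2 * (k + i), m + 2 + 2 * (k + i) + 1) := by
  induction n generalizing k with
  | zero => rfl
  | succ n ih =>
    rw [List.ofFn_succ, List.ofFn_succ]
    have h := ih (k + 1) fun i => f i.succ
    refine congrArg₂ List.cons rfl (h.trans ?_)
    congr 1
    funext i
    simp only [Fin.val_succ, Nat.add_assoc, Nat.add_comm 1]

theorem gateDataFrom_rawGates (C : Circuit) :
    gateDataFrom C.m 0 (rawGates C) = (gateData C).map (GateData.map Fin.val) := by
  rw [rawGates, gateDataFrom_ofFn, gateData, List.map_ofFn]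
  congr 1
  funext k
  simp only [Nat.zero_add, Function.comp_apply]
  rfl

theorem count_eq_length {α : Type} (L : List α) : count L = L.length := by
  have h : ∀ (L : List α) (k : ℕ), L.foldl (fun k _ => k + 1) k = k + L.length := by
    intro L
    induction L with
    | nil => intro k; rfl
    | cons a L ih => intro k; rw [List.foldl_cons, ih, List.length_cons]; omega
  rw [count, h, Nat.zero_add]

theorem pos_of_mem_gateData (C : Circuit) : ∀ g ∈ gateData C,
    0 < g.1.1.2.2 ∧ 0 < g.1.2.1.2.2 ∧ 0 < g.1.2.2.2.2 := by
  intro g hg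
  obtain ⟨k, rfl⟩ := List.mem_ofFn.1 hg
  exact ⟨Rat.den_pos _, Rat.den_pos _, Rat.den_pos _⟩

/-- The monomials of the quadratic program of an instance. -/
def instanceMonos (I : LinearInstance) : List (Mono (Fin (3 * I.circuit.m + 2))) :=
  qpTerms (gateBound I.circuit) (rawDelta (fracOfRat I.δ) (gateBound I.circuit)).1
    (rawDelta (fracOfRat I.δ) (gateBound I.circuit)).2 (I.circuit.yIdx (Fin.last _))
    (gateData I.circuit)

/-- The terms of the quadratic program of an instance. -/
def instanceTerms (I : LinearInstance) : List (QTerm (3 * I.circuit.m + 2)) :=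
  (instanceMonos I).map Mono.toQTerm

theorem mem_instanceMonos (I : LinearInstance) {t : Mono (Fin (3 * I.circuit.m + 2))}
    (h : t ∈ instanceMonos I) : Frac.IsReduced t.1 ∧ t.2.length ≤ 2 :=
  mem_qpTerms (rawDelta_spec I (rawBound_pos_and_le _).1).1 (pos_of_mem_gateData _) h

theorem qpWord_eq (I : LinearInstance) : qpWord (fracOfRat I.δ) (rawGates I.circuit) =
    encQuadratic ⟨3 * I.circuit.m + 2, instanceTerms I⟩ := by
  have hlen : count (rawGates I.circuit) = I.circuit.m := by simp [count_eq_length, rawGates]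
  have hun : ∀ L : List RawGate,
      ((L.flatMap fun _ => [Γ'.bit true, Γ'.bit true, Γ'.bit true]) ++
        [Γ'.bit true, Γ'.bit true, Γ'.comma]) = encUnary (3 * L.length + 2) := by
    intro L
    induction L with
    | nil => rfl
    | cons a L ih =>
      rw [List.flatMap_cons, List.append_assoc, ih]
      rfl
  rw [qpWord, encQuadratic, hun, hlen, gateDataFrom_rawGates]
  have h1 := qpTerms_map Fin.val (gateBound I.circuit)
    (rawDelta (fracOfRat I.δ) (gateBound I.circuit)).1
    (rawDelta (fracOfRat I.δ) (gateBound I.circuit)).2 (I.circuit.yIdx (Fin.last _))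
    (gateData I.circuit)
  have hlen2 : (rawGates I.circuit).length = I.circuit.m := by simp [rawGates]
  rw [hlen2]
  refine congrArg _ (congrArg encSeq ?_)
  change (qpTerms _ _ _ ((I.circuit.yIdx (Fin.last _)).val) _).map _ = _
  refine (congrArg (List.map Mono.enc) h1.symm).trans ?_
  rw [instanceTerms, List.map_map, List.map_map]
  refine List.map_congr_left fun t ht => ?_
  have h2 := mem_instanceMonos I ht
  exact (encQTerm_toQTerm h2.1 h2.2).symm

/-- Writing down the quadratic program takes polynomial time. -/
theorem instanceTerms_computable : Nonempty (TM2ComputableInPolyTime encLinearInstance encQuadratic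
    fun I : LinearInstance => (⟨3 * I.circuit.m + 2, instanceTerms I⟩ : Quadratic)) := by
  refine PT.reduceWord.tm2Computable Sum.inl fun I => ?_
  rw [List.map_map, ← qpWord_eq, ← reduceWord_encLinearInstance]
  congr 1
  exact List.map_id _

open MvPolynomial in
theorem sum_coeff_mul (C : Circuit) (k : Fin C.m) :
    ∑ j, MvPolynomial.C (C.coeff k j) * X (C.yIdx (C.earlier k j)) =
      (MvPolynomial.C (C.gate k).a * X (C.yIdx (C.earlier k (C.gate k).l)) +
        MvPolynomial.C (C.gate k).b * X (C.yIdx (C.earlier k (C.gate k).r)) :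
        MvPolynomial (Fin (3 * C.m + 2)) ℚ) := by
  simp only [Circuit.coeff, map_add, add_mul, Finset.sum_add_distrib, apply_ite MvPolynomial.C,
    map_zero, ite_mul, zero_mul, Finset.sum_ite_eq', Finset.mem_univ, if_true]

open MvPolynomial in
theorem toPoly_instanceTerms (I : LinearInstance) :
    Quadratic.toPoly ⟨3 * I.circuit.m + 2, instanceTerms I⟩ = I.qp (gateBound I.circuit : ℚ) := by
  have hK := (rawBound_pos_and_le (rawGates I.circuit)).1
  obtain ⟨hv, hdelta⟩ := rawDelta_spec I (K := gateBound I.circuit) hK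
  have h1 : Quadratic.toPoly ⟨3 * I.circuit.m + 2, instanceTerms I⟩ = sumPoly (instanceMonos I) := by
    rw [Quadratic.toPoly, sumPoly, instanceTerms, List.map_map]
    exact congrArg List.sum (List.map_congr_left fun t ht =>
      toPoly_toQTerm (mem_instanceMonos I ht).2)
  rw [h1, instanceMonos, qpTerms,
    sumPoly_flatMap_split fun t ht => (mem_qpMonos hv (pos_of_mem_gateData _) ht).1, qpMonos,
    sumPoly_append, gateData, sumPoly_emits_gates, LinearInstance.qp, Circuit.qpPoly]
  refine (add_comm _ _).trans ?_
  have h3 : ((((rawDelta (fracOfRat I.δ) (gateBound I.circuit)).1 *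
      (rawDelta (fracOfRat I.δ) (gateBound I.circuit)).1 *
      (rawDelta (fracOfRat I.δ) (gateBound I.circuit)).1 : ℕ) : ℚ) /
      (((rawDelta (fracOfRat I.δ) (gateBound I.circuit)).2 *
      (rawDelta (fracOfRat I.δ) (gateBound I.circuit)).2 *
      (rawDelta (fracOfRat I.δ) (gateBound I.circuit)).2 : ℕ) : ℚ)) =
      I.qpDelta (gateBound I.circuit) ^ 3 := by
    rw [← hdelta]
    push_cast
    rw [div_pow]
    ring
  congr 1
  · rw [sumPoly_cons, sumPoly_nil, add_zero, Mono.poly, Frac.val]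
    simp only [Bool.false_eq_true, if_false, one_mul]
    rw [foldl_div, h3, hdelta, List.length_ofFn, ← pow_add, add_comm 3]
    simp
  · refine Finset.sum_congr rfl fun k _ => ?_
    rw [h3, hdelta, ← pow_add, add_comm 3, sumPoly_monos, Circuit.gatePoly, sum_coeff_mul,
      val_fracOfRat, val_fracOfRat, val_fracOfRat]

end StackProg

namespace StackProg

/-! ### Solutions of the quadratic program -/

/-- The first two coordinates of a rational solution of the quadratic program solve the instance. -/
theorem isSolution_take_two (I : LinearInstance) (s : List ℚ) (hlen : s.length = 3 * I.circuit.m + 2)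
    (hs : IsKKTPoint (Quadratic.toPoly ⟨3 * I.circuit.m + 2, instanceTerms I⟩)
      (toPoint (3 * I.circuit.m + 2) s)) :
    (s.take 2).length = 2 ∧ I.IsSolution (toPoint 2 (s.take 2)) := by
  rw [toPoly_instanceTerms] at hs
  have h := I.isSolution_of_isKKTPoint (isGateBound_gateBound I.circuit) hs
  refine ⟨by rw [List.length_take, hlen]; omega, ?_⟩
  convert h using 1
  funext i
  fin_cases i <;> simp [toPoint, Circuit.yIdx]

end StackProg

end QPKKT

/-- First part: for every admissible `K`, the first two coordinates of any (real) KKT point of the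
quadratic program solve the circuit instance. Second part: writing down that program, for a suitable
admissible `K` depending on the circuit, and reading off the first two coordinates of a solution, is
a polynomial-time reduction from 2D-LINEAR-KKT to QUADRATIC-KKT. -/
theorem mainTheorem2 :
    (∀ (I : QPKKT.LinearInstance) (K : ℚ), I.circuit.IsGateBound K →
      ∀ x : Fin (3 * I.circuit.m + 2) → ℝ, QPKKT.IsKKTPoint (I.qp K) x →
        I.IsSolution ![x (I.circuit.yIdx 0), x (I.circuit.yIdx 1)]) ∧
    ∃ (K : QPKKT.Circuit → ℚ)
      (terms : (I : QPKKT.LinearInstance) → List (QPKKT.QTerm (3 * I.circuit.m + 2))),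
      (∀ C : QPKKT.Circuit, C.IsGateBound (K C)) ∧
      (∀ I : QPKKT.LinearInstance,
        QPKKT.Quadratic.toPoly ⟨3 * I.circuit.m + 2, terms I⟩ = I.qp (K I.circuit)) ∧
      QPKKT.IsPolyTimeReduction QPKKT.linearKKT QPKKT.quadraticKKT
        (fun I : QPKKT.LinearInstance => (⟨3 * I.circuit.m + 2, terms I⟩ : QPKKT.Quadratic))
        (fun x : QPKKT.LinearInstance × List ℚ => x.2.take 2) := by
  exact ⟨fun I K hK x hx => I.isSolution_of_isKKTPoint hK hx,
    fun C => (QPKKT.StackProg.gateBound C : ℚ), QPKKT.StackProg.instanceTerms,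
    QPKKT.StackProg.isGateBound_gateBound, QPKKT.StackProg.toPoly_instanceTerms,
    QPKKT.StackProg.instanceTerms_computable, QPKKT.StackProg.take_two_computable,
    fun I s h => QPKKT.StackProg.isSolution_take_two I s h.1 h.2⟩
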